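/- **Notation.** For $\lambda>-1/2$, $\lambda\ne0$, let $C_n^\lambda(x)=\frac{(2\lambda)_n}{n!}\,{}_2F_1\!\left(-n,n+2\lambda;\lambda+\tfrac12;\tfrac{1-x}{2}\right)$ be the Gegenbauer polynomials, $\omega_\lambda(x)=(1-x^2)^{\lambda-1/2}$, and let $$S_n^\lambda f=\sum_{k=0}^n a_k^\lambda C_k^\lambda,\qquad a_k^\lambda=\frac{\int_{-1}^1\omega_\lambda f\,C_k^\lambda\,dx}{\int_{-1}^1\omega_\lambda (C_k^\lambda)^2\,dx}$$ be the Gegenbauer projection of degree $n$. Let $\|\cdot\|_\infty$ be the maximum norm on $[-1,1]$. For $\rho>1$ let $\mathcal E_\rho=\{\frac12(u+u^{-1}):|u|=\rho\}$ be the Bernstein ellipse, $L(\mathcal E_\rho)$ its length, and let $\mathcal A_\rho$ be the set of complex functions that are analytic in the open region bounded by $\mathcal E_\rho$ and continuous on its closure. For $f\in\mathcal A_\rho$ put $M=\max_{\mathcal E_\rho}|f|$ and $$D_\lambda(\rho)=\frac{M\,L(\mathcal E_\rho)}{\pi\rho}\cdot\begin{cases}\frac{|\Gamma(\lambda)|\Gamma(1+\lambda)\Gamma(1-2\lambda)}{\Gamma(1-\lambda)}(1-\rho^{-2})^{2\lambda-1},&-\tfrac12<\lambda<0,\\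 \frac1\lambda(1-\rho^{-2})^{\lambda-1},&0<\lambda\le1,\\ \Gamma(\lambda)(1+\rho^{-2})^{\lambda-1},&\lambda>1,\end{cases}$$ $$\mathcal K_c=c\,\frac{D_\lambda(\rho)}{\ln\rho}\cdot\begin{cases}1/\Gamma(2\lambda),&0<\lambda\le\tfrac12,\\2\lambda,&\lambda>\tfrac12.\end{cases}$$ **Theorem.** (i) There is an absolute constant $c>0$ such that for all $\lambda>0$, $\rho>1$, $f\in\mathcal A_\rho$ and all integers $n\ge1$ with $n\ge\lfloor\lambda/\ln\rho\rfloor$, $$\|f-S_n^\lambda f\|_\infty\le\mathcal K_c\,\frac{n^\lambda}{\rho^n}.$$ Moreover $c$ is asymptotically $1$: for all $\lambda>0$ and $\varepsilon>0$ there is $X=X(\lambda,\varepsilon)$ such that the bound holds with $c=1+\varepsilon$ for all $\rho>1$, $f\in\mathcal A_\rho$ and $n\ge\max(1,\lfloor\lambda/\ln\rho\rfloor)$ with $n\ln\rho\ge X$. (ii) Let $-1/2<\lambda<0$. There is a constant $C_\lambda>0$ with $|C_k^\lambda(x)|\le C_\lambda k^{\lambda-1}$ for all $|x|\le1$ and $k\ge1$.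 Whenever a constant $C_\lambda$ satisfies this inequality for all $|x|\le 1$ and all integers $k\ge \max(N,1)$, then for all $\rho>1$, $f\in\mathcal A_\rho$ and all integers $n\ge0$ with $n+1\ge N$, $$\|f-S_n^\lambda f\|_\infty\le\frac{D_\lambda(\rho)\,C_\lambda}{(\rho-1)\rho^n}.$$ (Optimality) Up to constant factors neither bound can be improved by a negative power of $n$. (a) For every $\lambda>0$ and $\rho>1$ there is $f\in\mathcal A_\rho$ such that for every $\gamma>0$ and every $c\in\mathbb R$, $\|f-S_n^\lambda f\|_\infty>c\,n^{\lambda-\gamma}\rho^{-n}$ for infinitely many $n$. For every $-1/2<\lambda<0$ and $\rho>1$ there is $f\in\mathcal A_\rho$ such that for every $\gamma>0$ and every $c\in\mathbb R$, $\|f-S_n^\lambda f\|_\infty>c\,n^{-\gamma}\rho^{-n}$ for infinitely many $n$. (b) Let $\omega>1$, $f(x)=1/(x-\omega)$ and $\rho_\omega=\omega+\sqrt{\omega^2-1}$ (so that $f$ is analytic inside $\mathcal E_{\rho_\omega}$, with a pole on $\mathcal E_{\rho_\omega}$). If $\lambda>0$, there is $c>0$ such that $|f(1)-S_n^\lambda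 f(1)|\ge c\,n^\lambda\rho_\omega^{-n}$ for all $n\ge1$. If $-1/2<\lambda<0$, there is $c>0$ such that $\|f-S_n^\lambda f\|_\infty\ge c\,\rho_\omega^{-n}$ for all $n\ge0$. -/

import Mathlib

open Set Filter Topology

noncomputable section

namespace Gegenbauer

/-! ### Gegenbauer polynomials and Gegenbauer projections -/

/-- The Gegenbauer polynomial of degree `n` with parameter `l`, as a function on `ℝ`:
`(2l)_n / n! * ₂F₁(-n, n + 2l; l + 1/2; (1 - x)/2)`. -/
def poly (l : ℝ) (n : ℕ) (x : ℝ) : ℝ :=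
  (ascPochhammer ℝ n).eval (2 * l) / (n.factorial : ℝ) *
    ordinaryHypergeometric (-(n : ℝ)) ((n : ℝ) + 2 * l) (l + 1 / 2) ((1 - x) / 2)

/-- The weight `(1 - x²)^(l - 1/2)`. -/
def weight (l : ℝ) (x : ℝ) : ℝ := (1 - x ^ 2) ^ (l - 1 / 2)

/-- The `k`-th Gegenbauer coefficient of `g`, that is, the inner product of `g` with the `k`-th
Gegenbauer polynomial in the weighted space on `[-1, 1]`, divided by the squared norm of the
`k`-th Gegenbauer polynomial. -/
def coeff (l : ℝ) (g : ℝ → ℂ) (k : ℕ) : ℂ :=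
  (∫ x in (-1 : ℝ)..1, ((weight l x * poly l k x : ℝ) : ℂ) * g x) /
    ((∫ x in (-1 : ℝ)..1, weight l x * poly l k x ^ 2 : ℝ) : ℂ)

/-- The Gegenbauer projection of degree `n` of `g`. -/
def proj (l : ℝ) (n : ℕ) (g : ℝ → ℂ) (x : ℝ) : ℂ :=
  ∑ k ∈ Finset.range (n + 1), coeff l g k * ((poly l k x : ℝ) : ℂ)

/-- The error at `x` of the Gegenbauer projection of degree `n` of the restriction of `f` to the
real line. -/
def err (l : ℝ) (n : ℕ) (f : ℂ → ℂ) (x : ℝ) : ℂ :=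
  f (x : ℂ) - proj l n (fun t : ℝ => f (t : ℂ)) x

/-- The maximum norm on `[-1, 1]`. -/
def supNorm (g : ℝ → ℂ) : ℝ := sSup ((fun x => ‖g x‖) '' Icc (-1 : ℝ) 1)

/-- The Gegenbauer polynomials with parameter `l` of all degrees `k ≥ N`, `k ≥ 1`, are bounded
by `C * k^(l-1)` on `[-1, 1]`. -/
def UniformBound (l C : ℝ) (N : ℕ) : Prop :=
  ∀ k : ℕ, 1 ≤ k → N ≤ k → ∀ x ∈ Icc (-1 : ℝ) 1, |poly l k x| ≤ C * (k : ℝ) ^ (l - 1)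

/-! ### Bernstein ellipses -/

/-- The Joukowski map. -/
def joukowski (u : ℂ) : ℂ := (u + u⁻¹) / 2

/-- The Bernstein ellipse with parameter `ρ` (the curve). -/
def ellipse (ρ : ℝ) : Set ℂ := {z | ∃ u : ℂ, ‖u‖ = ρ ∧ z = joukowski u}

/-- The open region bounded by the Bernstein ellipse with parameter `ρ`: the ellipse has foci
`1` and `-1` and its major axis has length `ρ + ρ⁻¹`. -/
def region (ρ : ℝ) : Set ℂ := {z | ‖z - 1‖ + ‖z + 1‖ < ρ + ρ⁻¹}

/-- The length of the Bernstein ellipse, as the arc length of `θ ↦ joukowski (ρ e^{iθ})`,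
`0 ≤ θ ≤ 2π`. -/
def ellipseLength (ρ : ℝ) : ℝ :=
  ∫ θ in (0 : ℝ)..(2 * Real.pi), ‖deriv (fun t : ℝ => joukowski (circleMap 0 ρ t)) θ‖

/-- The maximum of `|f|` on the Bernstein ellipse. -/
def maxOn (f : ℂ → ℂ) (ρ : ℝ) : ℝ := sSup ((fun z => ‖f z‖) '' ellipse ρ)

/-- The quantity `D_l(ρ)` (it depends on `f` through the maximum of `|f|` on the ellipse). -/
def D (l ρ : ℝ) (f : ℂ → ℂ) : ℝ :=
  maxOn f ρ * ellipseLength ρ / (Real.pi * ρ) *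
    (if l < 0 then
      |Real.Gamma l| * Real.Gamma (1 + l) * Real.Gamma (1 - 2 * l) / Real.Gamma (1 - l) *
        (1 - 1 / ρ ^ 2) ^ (2 * l - 1)
    else if l ≤ 1 then 1 / l * (1 - 1 / ρ ^ 2) ^ (l - 1)
    else Real.Gamma l * (1 + 1 / ρ ^ 2) ^ (l - 1))

/-- The quantity `K` with generic constant `c`. -/
def K (c l ρ : ℝ) (f : ℂ → ℂ) : ℝ :=
  c * (D l ρ f / Real.log ρ) * (if l ≤ 1 / 2 then 1 / Real.Gamma (2 * l) else 2 * l)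

/-- Consistency of `ellipse` and `region`: the ellipse is the locus where the sum of the
distances to the two foci is `ρ + ρ⁻¹`. -/
theorem ellipse_eq {ρ : ℝ} (hρ : 1 < ρ) :
    ellipse ρ = {z | ‖z - 1‖ + ‖z + 1‖ = ρ + ρ⁻¹} := by
  have key : ∀ u : ℂ, u ≠ 0 → ‖joukowski u - 1‖ + ‖joukowski u + 1‖ = ‖u‖ + ‖u‖⁻¹ := by
    intro u hu
    have hn : ‖u‖ ≠ 0 := norm_ne_zero_iff.mpr hu
    have e1 : joukowski u - 1 = (u - 1) ^ 2 / (2 * u) := by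
      unfold joukowski; field_simp; ring
    have e2 : joukowski u + 1 = (u + 1) ^ 2 / (2 * u) := by
      unfold joukowski; field_simp; ring
    have h := parallelogram_law_with_norm ℝ u 1
    simp only [norm_one] at h
    rw [e1, e2]
    simp only [norm_div, norm_pow, norm_mul, Complex.norm_ofNat]
    field_simp
    nlinarith [h]
  have hρ0 : (0 : ℝ) < ρ := by linarith
  ext z
  constructor
  · rintro ⟨u, hu, rfl⟩
    have hu0 : u ≠ 0 := by rw [← norm_pos_iff, hu]; exact hρ0
    have := key u hu0
    rw [hu] at this
    exact this
  · intro hz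
    obtain ⟨s, hs⟩ := IsSquare.exists_sq (z ^ 2 - 1) (IsAlgClosed.exists_pow_nat_eq (z ^ 2 - 1)
      (n := 2) (by norm_num) |>.elim fun s h => ⟨s, by rw [← h, sq]⟩)
    have hmul : (z + s) * (z - s) = 1 := by linear_combination hs
    have hu0 : z + s ≠ 0 := left_ne_zero_of_mul_eq_one hmul
    have hv0 : z - s ≠ 0 := right_ne_zero_of_mul_eq_one hmul
    have hinv : (z + s)⁻¹ = z - s := inv_eq_of_mul_eq_one_right hmul
    have hinv' : (z - s)⁻¹ = z + s := by rw [← hinv, inv_inv]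
    have hJ : joukowski (z + s) = z := by unfold joukowski; rw [hinv]; ring
    have hJ' : joukowski (z - s) = z := by unfold joukowski; rw [hinv']; ring
    have hk := key _ hu0
    rw [hJ, show ‖z - 1‖ + ‖z + 1‖ = ρ + ρ⁻¹ from hz] at hk
    have hn : 0 < ‖z + s‖ := norm_pos_iff.mpr hu0
    have hfac : (‖z + s‖ - ρ) * (‖z + s‖ * ρ - 1) = 0 := by
      field_simp at hk
      linear_combination -hk
    rcases mul_eq_zero.mp hfac with h | h
    · exact ⟨z + s, by linarith, hJ.symm⟩
    · refine ⟨z - s, ?_, hJ'.symm⟩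
      rw [← hinv, norm_inv]
      have h1 : ‖z + s‖ * ρ = 1 := by linarith
      exact inv_eq_of_mul_eq_one_right h1

end Gegenbauer

end

/-!
Pulled back by the Joukowski map, `f` is analytic in an annulus, and its Laurent coefficients there
give an expansion `f = ∑ β_m U_m` in Chebyshev polynomials of the second kind in which `β_m` is the
mean of `f(joukowski u) (1 - u⁻²) u⁻ᵐ` over the circle `|u| = ρ`. Each `U_m` is an explicit
combination of the Gegenbauer polynomials of degree `m, m - 2, …`, so rearranging the double series
yields the Gegenbauer coefficients as

  `a_k = (k! / (l)_k) * mean of f(joukowski u) (1 - u⁻²) u⁻ᵏ ₂F₁(k + 1, 1 - l; k + l + 1; u⁻²)`.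

For `l > 0`, Euler's integral is an average of `(1 - t u⁻²)^(l - 1)` with respect to a beta
distribution, and for `l < 0` the power series of `₂F₁` has a majorant that does not depend on `k`;
both bound `|a_k|` by `D k^(1 - l) ρ⁻ᵏ`. The upper estimates follow by summing the tail.

For `f(x) = 1 / (x - ω)` the coefficients are explicit. If `l > 0`, then every term of the tail at
`x = 1` has the same sign; if `l < 0`, then the tail at `x = 0`, where the odd degrees drop out, is
alternating. Either way the error is bounded below by a multiple of its first term. The other lower
bounds come from a Chebyshev series of degrees `m_i` so sparse that a geometric factor `qⁱ`, which
makes the series converge up to the ellipse, is negligible against any power of `m_i`.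
-/

noncomputable section

namespace Gegenbauer

open Finset.HasAntidiagonal (antidiagonal)
open Ring (multichoose)
open scoped Real

section Multichoose

variable {𝕜 : Type*} [Field 𝕜] [CharZero 𝕜] [BinomialRing 𝕜]

theorem multichoose_eq_eval_div (a : 𝕜) (n : ℕ) :
    multichoose a n = (ascPochhammer 𝕜 n).eval a / n.factorial := by
  rw [eq_div_iff (mod_cast n.factorial_ne_zero), mul_comm, ← nsmul_eq_mul,
    Ring.factorial_nsmul_multichoose_eq_ascPochhammer, Polynomial.ascPochhammer_smeval_eq_eval]

theorem multichoose_succ_mul (a : 𝕜) (n : ℕ) :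
    multichoose a (n + 1) * (n + 1) = multichoose a n * (a + n) := by
  have hn : (n : 𝕜) + 1 ≠ 0 := n.cast_add_one_ne_zero
  rw [multichoose_eq_eval_div, multichoose_eq_eval_div, ascPochhammer_succ_eval,
    Nat.factorial_succ]
  push_cast
  field_simp

theorem multichoose_succ_eq_mul_div (a : 𝕜) (n : ℕ) :
    multichoose a (n + 1) = multichoose a n * ((a + n) / (n + 1)) := by
  rw [← mul_div_assoc, ← multichoose_succ_mul, mul_div_cancel_right₀ _ n.cast_add_one_ne_zero]

theorem multichoose_mul_add (a : 𝕜) (n : ℕ) :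
    multichoose a n * (a + n) = a * multichoose (a + 1) n := by
  induction n with
  | zero => simp
  | succ n ih =>
    rw [multichoose_succ_eq_mul_div, multichoose_succ_eq_mul_div (a + 1), ← mul_assoc a, ← ih]
    push_cast
    ring

theorem multichoose_neg_natCast {n i : ℕ} (h : n < i) : multichoose (-(n : 𝕜)) i = 0 := by
  rw [multichoose_eq_eval_div, ascPochhammer_eval_neg_coe_nat_of_lt h, zero_div]

end Multichoose

theorem multichoose_pos {a : ℝ} (ha : 0 < a) (n : ℕ) : 0 < multichoose a n := by
  rw [multichoose_eq_eval_div]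
  exact div_pos (ascPochhammer_pos n a ha) (by positivity)

theorem multichoose_ne_zero {a : ℝ} (ha : -1 < a) (h0 : a ≠ 0) (n : ℕ) : multichoose a n ≠ 0 := by
  cases n with
  | zero => simp
  | succ n =>
    have h : multichoose a (n + 1) * (n + 1) ≠ 0 := by
      rw [multichoose_succ_mul, multichoose_mul_add]
      exact mul_ne_zero h0 (multichoose_pos (by linarith) n).ne'
    exact left_ne_zero_of_mul h

/-! ### Orthogonality and trigonometric form -/

section GegenbauerPolynomial

open MeasureTheory Polynomial

/-- The coefficient of `((1 - x) / 2) ^ i` in the Gegenbauer polynomial of degree `n`. The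
Pochhammer symbols of the hypergeometric series are written as multichoose numbers, since the
factorials cancel. -/
def hyperCoeff (l : ℝ) (n i : ℕ) : ℝ :=
  multichoose (2 * l) n *
    (multichoose (-(n : ℝ)) i * multichoose (n + 2 * l) i / multichoose (l + 1 / 2) i)

theorem hyperCoeff_of_lt (l : ℝ) {n i : ℕ} (h : n < i) : hyperCoeff l n i = 0 := by
  simp [hyperCoeff, multichoose_neg_natCast h]

@[simp]
theorem hyperCoeff_zero_right (l : ℝ) (n : ℕ) : hyperCoeff l n 0 = multichoose (2 * l) n := by
  simp [hyperCoeff]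

theorem hyperCoeff_succ_right {l : ℝ} (hl : -1 / 2 < l) (n i : ℕ) :
    hyperCoeff l n (i + 1) * ((i + 1) * (l + 1 / 2 + i)) =
      hyperCoeff l n i * ((i - n) * (n + 2 * l + i)) := by
  have hi : l + 1 / 2 + (i : ℝ) ≠ 0 := by
    have : (0 : ℝ) ≤ i := Nat.cast_nonneg i
    linarith
  have hm : multichoose (l + 1 / 2) i ≠ 0 := (multichoose_pos (by linarith) i).ne'
  simp only [hyperCoeff, multichoose_succ_eq_mul_div]
  generalize l + 1 / 2 = c at hi hm ⊢
  field_simp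
  ring

theorem hyperCoeff_succ_left (l : ℝ) (n i : ℕ) :
    hyperCoeff l (n + 1) i * (n + 1 - i) = hyperCoeff l n i * (n + 2 * l + i) := by
  have h₁ := multichoose_succ_mul (2 * l) n
  have h₂ := multichoose_mul_add (-((n + 1 : ℕ) : ℝ)) i
  have h₃ := multichoose_mul_add ((n : ℝ) + 2 * l) i
  rw [show -((n + 1 : ℕ) : ℝ) + 1 = -(n : ℝ) by push_cast; ring] at h₂
  rw [show (n : ℝ) + 2 * l + 1 = (n + 1 : ℕ) + 2 * l by push_cast; ring] at h₃
  simp only [hyperCoeff]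
  push_cast at h₂ h₃ ⊢
  linear_combination
    -(multichoose (2 * l) (n + 1) * multichoose ((n : ℝ) + 1 + 2 * l) i /
        multichoose (l + 1 / 2) i) * h₂ +
      multichoose (-(n : ℝ)) i * multichoose ((n : ℝ) + 1 + 2 * l) i /
        multichoose (l + 1 / 2) i * h₁ -
      multichoose (2 * l) n * multichoose (-(n : ℝ)) i / multichoose (l + 1 / 2) i * h₃

theorem hyperCoeff_succ_succ {l : ℝ} (hl : -1 / 2 < l) (n i : ℕ) :
    hyperCoeff l (n + 1) (i + 1) * ((i + 1) * (l + 1 / 2 + i)) =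
      -(hyperCoeff l n i * ((n + 2 * l + i) * (n + 2 * l + i + 1))) := by
  have h₁ := hyperCoeff_succ_right hl (n + 1) i
  push_cast at h₁
  linear_combination h₁ - (n + 2 * l + i + 1) * hyperCoeff_succ_left l n i

/-- The Gegenbauer polynomial of degree `n` as a polynomial in the variable `(1 - x) / 2` of the
hypergeometric series. -/
def hyperPoly (l : ℝ) (n : ℕ) : ℝ[X] := ∑ i ∈ Finset.range (n + 1), monomial i (hyperCoeff l n i)

theorem coeff_hyperPoly (l : ℝ) (n i : ℕ) : (hyperPoly l n).coeff i = hyperCoeff l n i := by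
  simp only [hyperPoly, finsetSum_coeff, coeff_monomial, Finset.sum_ite_eq', Finset.mem_range]
  split_ifs with h
  · rfl
  · exact (hyperCoeff_of_lt l (by simpa using h)).symm

theorem poly_eq_eval (l : ℝ) (n : ℕ) (x : ℝ) :
    poly l n x = (hyperPoly l n).eval ((1 - x) / 2) := by
  have hvanish : ∀ i ∉ Finset.range (n + 1), ((i.factorial : ℝ)⁻¹ *
      (ascPochhammer ℝ i).eval (-(n : ℝ)) * (ascPochhammer ℝ i).eval (n + 2 * l) *
        ((ascPochhammer ℝ i).eval (l + 1 / 2))⁻¹) • ((1 - x) / 2) ^ i = 0 := by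
    intro i hi
    simp [ascPochhammer_eval_neg_coe_nat_of_lt (by simpa using hi : n < i)]
  rw [poly, ordinaryHypergeometric_eq_tsum]
  simp only
  rw [tsum_eq_sum hvanish, hyperPoly, eval_finsetSum, Finset.mul_sum]
  refine Finset.sum_congr rfl fun i _ => ?_
  simp only [eval_monomial, hyperCoeff, smul_eq_mul, multichoose_eq_eval_div]
  field_simp

theorem contDiff_poly (l : ℝ) (n : ℕ) {m : WithTop ℕ∞} : ContDiff ℝ m (poly l n) := by
  rw [funext (poly_eq_eval l n)]
  exact ((hyperPoly l n).contDiff_aeval m).comp (by fun_prop)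

theorem continuous_poly (l : ℝ) (n : ℕ) : Continuous (poly l n) :=
  (contDiff_poly l n (m := 0)).continuous

theorem poly_zero (l x : ℝ) : poly l 0 x = 1 := by
  simp [poly_eq_eval, hyperPoly]

theorem poly_one_right (l : ℝ) (n : ℕ) : poly l n 1 = multichoose (2 * l) n := by
  rw [poly_eq_eval, sub_self, zero_div, ← coeff_zero_eq_eval_zero, coeff_hyperPoly,
    hyperCoeff_zero_right]

variable {l : ℝ}

theorem poly_one_left (hl : -1 / 2 < l) (x : ℝ) : poly l 1 x = 2 * l * x := by
  have h := hyperCoeff_succ_succ hl 0 0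
  have hsum : poly l 1 x = hyperCoeff l 1 0 + hyperCoeff l 1 1 * ((1 - x) / 2) := by
    simp [poly_eq_eval, hyperPoly, Finset.sum_range_succ]
  rw [hsum, hyperCoeff_zero_right, Ring.multichoose_one_right]
  simp only [hyperCoeff_zero_right, Ring.multichoose_zero_right, zero_add] at h
  push_cast at h
  have hc : hyperCoeff l 1 1 = -4 * l := by
    apply mul_right_cancel₀ (b := l + 1 / 2) (by linarith)
    linear_combination h
  rw [hc]
  ring

theorem hyperPoly_recurrence (hl : -1 / 2 < l) (n : ℕ) :
    C ((n : ℝ) + 2) * hyperPoly l (n + 2) =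
      C (2 * (n + 1 + l)) * (hyperPoly l (n + 1) - C 2 * (X * hyperPoly l (n + 1))) -
        C (n + 2 * l) * hyperPoly l n := by
  ext i
  simp only [coeff_C_mul, coeff_sub]
  cases i with
  | zero =>
    have h₁ := multichoose_succ_mul (2 * l) n
    have h₂ := multichoose_succ_mul (2 * l) (n + 1)
    simp only [mul_coeff_zero, coeff_X_zero, zero_mul, coeff_hyperPoly, hyperCoeff_zero_right]
    push_cast at h₂
    linear_combination h₂ - h₁
  | succ i =>
    simp only [coeff_X_mul, coeff_hyperPoly]
    have hne : ((i : ℝ) + 1) * (l + 1 / 2 + i) ≠ 0 := by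
      have : 0 < l + 1 / 2 + (i : ℝ) := by linarith [Nat.cast_nonneg (α := ℝ) i]
      positivity
    have h₁ := hyperCoeff_succ_succ hl (n + 1) i
    have h₂ := hyperCoeff_succ_right hl (n + 1) i
    push_cast at h₁ h₂
    apply mul_right_cancel₀ hne
    linear_combination (n + 2) * h₁ - 2 * (n + 1 + l) * h₂ +
      (n + 2 * l) * hyperCoeff_succ_right hl n i -
        (n + 2 * l) * (i - n) * hyperCoeff_succ_left l n i

theorem poly_recurrence (hl : -1 / 2 < l) (n : ℕ) (x : ℝ) :
    (n + 2) * poly l (n + 2) x =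
      2 * (n + 1 + l) * x * poly l (n + 1) x - (n + 2 * l) * poly l n x := by
  have h := congrArg (eval ((1 - x) / 2)) (hyperPoly_recurrence hl n)
  simp only [eval_mul, eval_sub, eval_C, eval_X] at h
  simp only [poly_eq_eval]
  linear_combination h

theorem hyperPoly_ode (hl : -1 / 2 < l) (n : ℕ) :
    X * (1 - X) * derivative (derivative (hyperPoly l n)) +
      (C (l + 1 / 2) - C (2 * l + 1) * X) * derivative (hyperPoly l n) +
        C (n * (n + 2 * l)) * hyperPoly l n = 0 := by
  set p := hyperPoly l n
  suffices h : X * derivative (derivative p) - X * (X * derivative (derivative p)) +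
      C (l + 1 / 2) * derivative p - C (2 * l + 1) * (X * derivative p) +
        C (n * (n + 2 * l)) * p = 0 by
    linear_combination h
  ext i
  have hc := hyperCoeff_succ_right hl n i
  rcases i with _ | _ | i <;>
  · simp only [p, coeff_add, coeff_sub, coeff_C_mul, coeff_X_mul, coeff_derivative,
      coeff_hyperPoly, coeff_zero, mul_coeff_zero, coeff_X_zero, coeff_C_zero]
    push_cast at hc ⊢
    linear_combination hc

theorem weight_pos (l : ℝ) {x : ℝ} (hx : x ∈ Ioo (-1 : ℝ) 1) : 0 < weight l x :=
  Real.rpow_pos_of_pos (by nlinarith [hx.1, hx.2]) _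

theorem intervalIntegrable_weight (hl : -1 / 2 < l) :
    IntervalIntegrable (weight l) volume (-1) 1 := by
  have hright : IntervalIntegrable (weight l) volume 0 1 := by
    have hsub : IntervalIntegrable (fun x : ℝ => (1 - x) ^ (l - 1 / 2)) volume 0 1 := by
      simpa using (intervalIntegral.intervalIntegrable_rpow' (a := 1) (b := 0)
        (r := l - 1 / 2) (by linarith)).comp_sub_left 1
    have hadd : ContinuousOn (fun x : ℝ => (1 + x) ^ (l - 1 / 2)) (uIcc 0 1) := by
      refine ContinuousOn.rpow_const (by fun_prop) fun x hx => Or.inl ?_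
      rw [uIcc_of_le zero_le_one] at hx
      linarith [hx.1]
    refine (hsub.mul_continuousOn hadd).congr fun x hx => ?_
    rw [uIoc_of_le zero_le_one] at hx
    rw [weight, ← Real.mul_rpow (by linarith [hx.2]) (by linarith [hx.1])]
    ring_nf
  have hleft : IntervalIntegrable (weight l) volume (-1) 0 := by
    have heven : (fun x => weight l (-x)) = weight l := by ext x; simp [weight]
    simpa [heven] using (hright.comp_sub_left 0).symm
  exact hleft.trans hright

theorem intervalIntegrable_weight_mul (hl : -1 / 2 < l) {g : ℝ → ℝ} (hg : Continuous g) :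
    IntervalIntegrable (fun x => weight l x * g x) volume (-1) 1 :=
  (intervalIntegrable_weight hl).mul_continuousOn hg.continuousOn

theorem deriv_poly (l : ℝ) (n : ℕ) :
    deriv (poly l n) = fun x => -(1 / 2) * (derivative (hyperPoly l n)).eval ((1 - x) / 2) := by
  ext x
  have hy : HasDerivAt (fun x : ℝ => (1 - x) / 2) (-1 / 2) x := by
    simpa using ((hasDerivAt_id x).const_sub 1).div_const 2
  rw [funext (poly_eq_eval l n)]
  exact (((hyperPoly l n).hasDerivAt _).comp x hy).deriv.trans (by ring)

theorem poly_sturmLiouville (hl : -1 / 2 < l) (n : ℕ) {x : ℝ} (hx : x ∈ Ioo (-1 : ℝ) 1) :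
    HasDerivAt (fun x => (1 - x ^ 2) ^ (l + 1 / 2) * deriv (poly l n) x)
      (-(n * (n + 2 * l)) * (weight l x * poly l n x)) x := by
  have hpos : 0 < 1 - x ^ 2 := by nlinarith [hx.1, hx.2]
  have hy : HasDerivAt (fun x : ℝ => (1 - x) / 2) (-1 / 2) x := by
    simpa using ((hasDerivAt_id x).const_sub 1).div_const 2
  have hq : HasDerivAt (fun x : ℝ => 1 - x ^ 2) (-(2 * x)) x := by
    simpa using (hasDerivAt_pow 2 x).const_sub 1
  have hpow := hq.rpow_const (p := l + 1 / 2) (Or.inl hpos.ne')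
  have hder := (((derivative (hyperPoly l n)).hasDerivAt ((1 - x) / 2)).comp x hy).const_mul
    (-(1 / 2 : ℝ))
  rw [deriv_poly]
  refine (hpow.mul hder).congr_deriv ?_
  have ode := congrArg (eval ((1 - x) / 2)) (hyperPoly_ode hl n)
  simp only [eval_add, eval_mul, eval_sub, eval_C, eval_X, eval_one, eval_zero] at ode
  have hsucc : (1 - x ^ 2) ^ (l + 1 / 2) = (1 - x ^ 2) ^ (l - 1 / 2) * (1 - x ^ 2) := by
    rw [← Real.rpow_add_one hpos.ne']; congr 1; ring
  rw [weight, poly_eq_eval, show l + 1 / 2 - 1 = l - 1 / 2 by ring, hsucc]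
  simp only [Function.comp]
  linear_combination (1 - x ^ 2) ^ (l - 1 / 2) * ode

theorem integral_weight_mul_poly_mul_poly (hl : -1 / 2 < l) {n m : ℕ} (h : n ≠ m) :
    ∫ x in (-1 : ℝ)..1, weight l x * (poly l n x * poly l m x) = 0 := by
  -- Green's identity: the Wronskian-type function `G` vanishes at both end points.
  set G : ℝ → ℝ := fun x => (1 - x ^ 2) ^ (l + 1 / 2) * deriv (poly l n) x * poly l m x -
    (1 - x ^ 2) ^ (l + 1 / 2) * deriv (poly l m) x * poly l n x
  have hG : Continuous G := by
    have hpow : Continuous fun x : ℝ => (1 - x ^ 2) ^ (l + 1 / 2) :=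
      (by fun_prop : Continuous fun x : ℝ => 1 - x ^ 2).rpow_const fun x => Or.inr (by linarith)
    have hder (k : ℕ) : Continuous (deriv (poly l k)) :=
      (contDiff_poly l k (m := 1)).continuous_deriv le_rfl
    exact ((hpow.mul (hder n)).mul (continuous_poly l m)).sub
      ((hpow.mul (hder m)).mul (continuous_poly l n))
  have hderiv : ∀ x ∈ Ioo (-1 : ℝ) 1, HasDerivAt G
      ((m * (m + 2 * l) - n * (n + 2 * l)) * (weight l x * (poly l n x * poly l m x))) x := by
    intro x hx
    have hpoly (k : ℕ) : HasDerivAt (poly l k) (deriv (poly l k) x) x :=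
      ((contDiff_poly l k (m := 1)).differentiable one_ne_zero x).hasDerivAt
    exact (((poly_sturmLiouville hl n hx).mul (hpoly m)).sub
      ((poly_sturmLiouville hl m hx).mul (hpoly n))).congr_deriv (by ring)
  have hInt := (intervalIntegrable_weight_mul hl
    ((continuous_poly l n).mul (continuous_poly l m))).const_mul
      (m * (m + 2 * l) - n * (n + 2 * l) : ℝ)
  have hzero := intervalIntegral.integral_eq_sub_of_hasDerivAt_of_le (by norm_num) hG.continuousOn
    hderiv hInt
  have hends : G 1 - G (-1) = 0 := by
    simp [G, -one_div, Real.zero_rpow (by linarith : l + 1 / 2 ≠ 0)]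
  rw [hends, intervalIntegral.integral_const_mul] at hzero
  refine (mul_eq_zero.mp hzero).resolve_left ?_
  rw [show (m * (m + 2 * l) - n * (n + 2 * l) : ℝ) = (m - n) * (m + n + 2 * l) by ring]
  have hsum : (1 : ℝ) ≤ m + n := by exact_mod_cast (by omega : 1 ≤ m + n)
  exact mul_ne_zero (sub_ne_zero.mpr (by exact_mod_cast h.symm)) (by linarith)

theorem integral_weight_mul_poly_sq_pos (hl : -1 / 2 < l) (hl0 : l ≠ 0) (n : ℕ) :
    0 < ∫ x in (-1 : ℝ)..1, weight l x * poly l n x ^ 2 := by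
  have hnonneg : 0 ≤ᵐ[volume.restrict (uIoc (-1) 1)] fun x => weight l x * poly l n x ^ 2 := by
    rw [uIoc_of_le (by norm_num)]
    refine (ae_restrict_iff' measurableSet_Ioc).mpr (.of_forall fun x hx => ?_)
    exact mul_nonneg (Real.rpow_nonneg (by nlinarith [hx.1, hx.2]) _) (sq_nonneg _)
  have hnear : ∀ᶠ x in 𝓝[<] (1 : ℝ), poly l n x ≠ 0 := by
    refine nhdsWithin_le_nhds ((continuous_poly l n).continuousAt.eventually_ne ?_)
    rw [poly_one_right]
    exact multichoose_ne_zero (by linarith) (by simpa using hl0) n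
  obtain ⟨d, hd, hne⟩ := (mem_nhdsLT_iff_exists_Ioo_subset' (by norm_num : (0 : ℝ) < 1)).mp hnear
  rw [intervalIntegral.integral_pos_iff_support_of_nonneg_ae' hnonneg
    (intervalIntegrable_weight_mul hl ((continuous_poly l n).pow 2))]
  refine ⟨by norm_num, lt_of_lt_of_le ?_ (measure_mono (s := Ioo (max d (-1)) 1) fun x hx => ?_)⟩
  · simpa [Real.volume_Ioo] using hd
  · obtain ⟨hdx, hx₁⟩ := max_lt_iff.mp hx.1
    exact ⟨mul_ne_zero (weight_pos l ⟨hx₁, hx.2⟩).ne' (pow_ne_zero 2 (hne ⟨hdx, hx.2⟩)),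
      hx₁, hx.2.le⟩

theorem coeff_poly (hl : -1 / 2 < l) (hl0 : l ≠ 0) (n k : ℕ) :
    coeff l (fun x => (poly l n x : ℂ)) k = if n = k then 1 else 0 := by
  have hnum : ∫ x in (-1 : ℝ)..1, ((weight l x * poly l k x : ℝ) : ℂ) * (poly l n x : ℂ) =
      ((∫ x in (-1 : ℝ)..1, weight l x * (poly l k x * poly l n x) : ℝ) : ℂ) := by
    rw [← intervalIntegral.integral_ofReal]
    simp [mul_assoc]
  rw [coeff, hnum]
  split_ifs with h
  · subst h
    simp only [← sq]
    exact div_self (Complex.ofReal_ne_zero.mpr (integral_weight_mul_poly_sq_pos hl hl0 n).ne')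
  · rw [integral_weight_mul_poly_mul_poly hl (Ne.symm h), Complex.ofReal_zero, zero_div]

theorem coeff_const_mul (l : ℝ) (k : ℕ) (c : ℂ) (g : ℝ → ℂ) :
    coeff l (fun x => c * g x) k = c * coeff l g k := by
  simp only [coeff, mul_left_comm _ c, intervalIntegral.integral_const_mul, mul_div_assoc]

theorem hasSum_coeff {ι : Type*} [Countable ι] (hl : -1 / 2 < l) (k : ℕ)
    {F : ι → ℝ → ℂ} {b : ι → ℝ} {g : ℝ → ℂ} (hF : ∀ i, Continuous (F i)) (hb : Summable b)
    (hFb : ∀ i, ∀ x ∈ Icc (-1 : ℝ) 1, ‖F i x‖ ≤ b i)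
    (hg : ∀ x ∈ Icc (-1 : ℝ) 1, HasSum (fun i => F i x) (g x)) :
    HasSum (fun i => coeff l (F i) k) (coeff l g k) := by
  have hwp := intervalIntegrable_weight_mul hl (continuous_poly l k)
  have hmeas : AEStronglyMeasurable (fun x => ((weight l x * poly l k x : ℝ) : ℂ))
      (volume.restrict (uIoc (-1 : ℝ) 1)) :=
    Complex.continuous_ofReal.comp_aestronglyMeasurable hwp.def'.aestronglyMeasurable
  have hIoc : uIoc (-1 : ℝ) 1 ⊆ Icc (-1) 1 := by
    rw [uIoc_of_le (by norm_num)]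
    exact Ioc_subset_Icc_self
  unfold coeff
  refine HasSum.div_const ?_ _
  refine intervalIntegral.hasSum_integral_of_dominated_convergence
    (fun i x => |weight l x * poly l k x| * b i) (fun i => hmeas.mul (hF i).aestronglyMeasurable)
    (fun i => .of_forall fun x hx => ?_) (.of_forall fun x _ => hb.mul_left _) ?_
    (.of_forall fun x hx => (hg x (hIoc hx)).mul_left _)
  · rw [norm_mul, Complex.norm_real, Real.norm_eq_abs]
    exact mul_le_mul_of_nonneg_left (hFb i x (hIoc hx)) (abs_nonneg _)
  · simp only [tsum_mul_left]
    exact hwp.abs.mul_const _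

end GegenbauerPolynomial

theorem ofReal_multichoose (a : ℝ) (n : ℕ) : ((multichoose a n : ℝ) : ℂ) = multichoose (a : ℂ) n :=
  Ring.map_multichoose Complex.ofRealHom a n

theorem norm_multichoose_ofReal (a : ℝ) (n : ℕ) :
    ‖multichoose (a : ℂ) n‖ = |multichoose a n| := by
  rw [← ofReal_multichoose, Complex.norm_real, Real.norm_eq_abs]

theorem abs_multichoose_le (a : ℝ) (n : ℕ) : |multichoose a n| ≤ multichoose |a| n := by
  induction n with
  | zero => simp
  | succ n ih =>
    rw [multichoose_succ_eq_mul_div, multichoose_succ_eq_mul_div, abs_mul, abs_div,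
      abs_of_pos (by positivity : (0 : ℝ) < n + 1)]
    have htri : |a + n| ≤ |a| + n := (abs_add_le _ _).trans (by simp)
    gcongr
    exact (abs_nonneg _).trans ih

theorem hasSum_multichoose_mul_pow (a : ℝ) {w : ℝ} (hw : |w| < 1) :
    HasSum (fun n => multichoose a n * w ^ n) ((1 - w) ^ (-a)) := by
  have h := (Real.one_div_one_sub_rpow_hasFPowerSeriesOnBall_zero a).hasSum (y := w)
    (by simpa [enorm_eq_nnnorm, ← NNReal.coe_lt_coe] using hw)
  simpa [FormalMultilinearSeries.ofScalars_apply_eq, ← Ring.multichoose_eq, mul_comm,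
    Real.rpow_neg (by linarith [le_abs_self w] : 0 ≤ 1 - w)] using h

theorem summable_abs_multichoose_mul_pow (a : ℝ) {w : ℝ} (h0 : 0 ≤ w) (hw : w < 1) :
    Summable fun n => |multichoose a n| * w ^ n :=
  .of_nonneg_of_le (fun n => by positivity)
    (fun n => mul_le_mul_of_nonneg_right (abs_multichoose_le a n) (pow_nonneg h0 n))
    (hasSum_multichoose_mul_pow |a| (by rwa [abs_of_nonneg h0])).summable

section PowerSeries

open PowerSeries

variable {𝕜 : Type*} [Field 𝕜] [CharZero 𝕜] [BinomialRing 𝕜]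

/-- The formal power series `(1 - z X) ^ (-a)`. -/
def negBinomialSeries (a z : 𝕜) : 𝕜⟦X⟧ := PowerSeries.mk fun n => multichoose a n * z ^ n

theorem negBinomialSeries_ode (a z : 𝕜) :
    (1 - C z * X) * d⁄dX 𝕜 (negBinomialSeries a z) = C (a * z) * negBinomialSeries a z := by
  rw [sub_mul, one_mul, mul_assoc]
  ext n
  rw [map_sub, coeff_C_mul, coeff_C_mul]
  cases n with
  | zero => simp [coeff_derivative, negBinomialSeries, coeff_zero_X_mul]
  | succ n =>
    have h := multichoose_succ_mul a (n + 1)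
    rw [coeff_succ_X_mul, coeff_derivative, coeff_derivative]
    simp only [negBinomialSeries, coeff_mk]
    push_cast at h ⊢
    linear_combination z ^ (n + 2) * h

variable {a z z' x : 𝕜}

theorem negBinomialSeries_mul_ode (a : 𝕜) (hz : z * z' = 1) (hx : z + z' = 2 * x) :
    (1 - C (2 * x) * X + X ^ 2) * d⁄dX 𝕜 (negBinomialSeries a z * negBinomialSeries a z') =
      C (2 * a) * (C x - X) * (negBinomialSeries a z * negBinomialSeries a z') := by
  have h := negBinomialSeries_ode a z
  have h' := negBinomialSeries_ode a z'
  have hmul : (C z * C z' : 𝕜⟦X⟧) = 1 := by rw [← map_mul, hz, map_one]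
  have hadd : (C z + C z' : 𝕜⟦X⟧) = 2 * C x := by rw [← map_add, hx, map_mul, map_ofNat]
  rw [Derivation.leibniz]
  simp only [smul_eq_mul, map_mul, map_ofNat] at h h' ⊢
  set p := negBinomialSeries a z
  set q := negBinomialSeries a z'
  linear_combination (1 - C z' * X) * q * h + (1 - C z * X) * p * h' -
    (X ^ 2 * (p * d⁄dX 𝕜 q + q * d⁄dX 𝕜 p) + 2 * C a * X * p * q) * hmul +
    (X * (p * d⁄dX 𝕜 q + q * d⁄dX 𝕜 p) + C a * p * q) * hadd

theorem coeff_negBinomialSeries_mul_recurrence (a : 𝕜) (hz : z * z' = 1) (hx : z + z' = 2 * x)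
    (n : ℕ) :
    (n + 2) * PowerSeries.coeff (n + 2) (negBinomialSeries a z * negBinomialSeries a z') =
      2 * (n + 1 + a) * x *
          PowerSeries.coeff (n + 1) (negBinomialSeries a z * negBinomialSeries a z') -
        (n + 2 * a) * PowerSeries.coeff n (negBinomialSeries a z * negBinomialSeries a z') := by
  have h := negBinomialSeries_mul_ode a hz hx
  set G := negBinomialSeries a z * negBinomialSeries a z'
  have hexp : d⁄dX 𝕜 G = C (2 * x) * (X * d⁄dX 𝕜 G) - X * (X * d⁄dX 𝕜 G) +
      C (2 * a * x) * G - C (2 * a) * (X * G) := by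
    simp only [map_mul] at h ⊢
    linear_combination h
  have hn := congrArg (PowerSeries.coeff (n + 1)) hexp
  simp only [map_add, map_sub, coeff_C_mul, coeff_succ_X_mul, coeff_derivative] at hn
  cases n <;>
  · simp only [coeff_zero_X_mul, coeff_succ_X_mul, coeff_derivative] at hn
    push_cast at hn ⊢
    linear_combination hn

end PowerSeries

/-- With `z = e^{iθ}` and `z' = e^{-iθ}` this is the expansion of `poly l n (cos θ)` in powers of
`e^{iθ}`. -/
theorem poly_eq_sum_antidiagonal {l : ℝ} (hl : -1 / 2 < l) {z z' : ℂ} {x : ℝ} (hz : z * z' = 1)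
    (hx : z + z' = 2 * x) (n : ℕ) :
    (poly l n x : ℂ) = ∑ p ∈ antidiagonal n,
      (multichoose (l : ℂ) p.1 * z ^ p.1) * (multichoose (l : ℂ) p.2 * z' ^ p.2) := by
  suffices h : (poly l n x : ℂ) =
      PowerSeries.coeff n (negBinomialSeries (l : ℂ) z * negBinomialSeries (l : ℂ) z') by
    simpa [PowerSeries.coeff_mul, negBinomialSeries] using h
  induction n using Nat.twoStepInduction with
  | zero => simp [poly_zero, negBinomialSeries]
  | one =>
    simp [poly_one_left hl, PowerSeries.coeff_mul, Finset.Nat.antidiagonal_succ,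
      negBinomialSeries]
    linear_combination -(l : ℂ) * hx
  | more n ih ih' =>
    have hpoly : ((n : ℂ) + 2) * poly l (n + 2) x =
        2 * (n + 1 + l) * x * poly l (n + 1) x - (n + 2 * l) * poly l n x := by
      exact_mod_cast poly_recurrence hl n x
    rw [ih, ih', ← coeff_negBinomialSeries_mul_recurrence _ hz hx] at hpoly
    exact mul_left_cancel₀ (by exact_mod_cast (by omega : n + 2 ≠ 0)) hpoly

/-- The sum of the absolute values of the coefficients in the expansion of `poly l n (cos θ)` in
powers of `e^{iθ}`; it bounds the polynomial on `[-1, 1]` for either sign of `l`. -/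
def trigBound (l : ℝ) (n : ℕ) : ℝ :=
  ∑ p ∈ antidiagonal n, |multichoose l p.1| * |multichoose l p.2|

theorem trigBound_nonneg (l : ℝ) (n : ℕ) : 0 ≤ trigBound l n :=
  Finset.sum_nonneg fun _ _ => by positivity

theorem summable_trigBound_mul_pow (l : ℝ) {w : ℝ} (h0 : 0 ≤ w) (hw : w < 1) :
    Summable fun n => trigBound l n * w ^ n := by
  have h := (summable_abs_multichoose_mul_pow l h0 hw).norm
  refine (summable_norm_sum_mul_antidiagonal_of_summable_norm h h).congr fun n => ?_
  rw [Real.norm_of_nonneg (Finset.sum_nonneg fun _ _ => by positivity), trigBound, Finset.sum_mul]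
  refine Finset.sum_congr rfl fun p hp => ?_
  rw [← Finset.HasAntidiagonal.mem_antidiagonal.mp hp, pow_add]
  ring

theorem abs_poly_le_trigBound {l : ℝ} (hl : -1 / 2 < l) (n : ℕ) {x : ℝ}
    (hx : x ∈ Icc (-1 : ℝ) 1) : |poly l n x| ≤ trigBound l n := by
  set z : ℂ := Complex.exp (Real.arccos x * Complex.I)
  have hx' : z + z⁻¹ = 2 * x := by
    have h := Complex.two_cos (Real.arccos x : ℂ)
    rw [← Complex.ofReal_cos, Real.cos_arccos hx.1 hx.2] at h
    rw [h, neg_mul, Complex.exp_neg]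
  have h := congrArg norm
    (poly_eq_sum_antidiagonal hl (mul_inv_cancel₀ (Complex.exp_ne_zero _)) hx' n)
  rw [Complex.norm_real, Real.norm_eq_abs] at h
  rw [h, trigBound]
  refine (norm_sum_le _ _).trans (Finset.sum_le_sum fun p _ => ?_)
  simp [norm_multichoose_ofReal, Complex.norm_exp_ofReal_mul_I]

theorem trigBound_of_pos {l : ℝ} (hl : 0 < l) (n : ℕ) : trigBound l n = multichoose (2 * l) n := by
  have h := poly_eq_sum_antidiagonal (l := l) (by linarith) (z := 1) (z' := 1) (x := 1) (by simp)
    (by norm_num) n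
  simp only [poly_one_right, one_pow, mul_one, ← ofReal_multichoose] at h
  simp only [trigBound, abs_of_pos (multichoose_pos hl _)]
  exact_mod_cast h.symm

theorem abs_poly_le {l : ℝ} (hl : 0 < l) (n : ℕ) {x : ℝ} (hx : x ∈ Icc (-1 : ℝ) 1) :
    |poly l n x| ≤ multichoose (2 * l) n :=
  (abs_poly_le_trigBound (by linarith) n hx).trans_eq (trigBound_of_pos hl n)

theorem poly_two_mul_zero {l : ℝ} (hl : -1 / 2 < l) (i : ℕ) :
    poly l (2 * i) 0 = (-1) ^ i * multichoose l i := by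
  induction i with
  | zero => simp [poly_zero]
  | succ i ih =>
    have hrec := poly_recurrence hl (2 * i) 0
    rw [ih] at hrec
    push_cast at hrec
    apply mul_left_cancel₀ (by positivity : 2 * (i : ℝ) + 2 ≠ 0)
    rw [mul_add_one, pow_succ]
    linear_combination hrec + 2 * (-1) ^ i * multichoose_succ_mul l i

/-! ### Chebyshev polynomials of the second kind in terms of Gegenbauer polynomials -/

/-- The Gegenbauer polynomials with integer index, extended by zero to negative indices, so that
the three-term recurrence holds without exception. -/
def intPoly (l : ℝ) (k : ℤ) (x : ℝ) : ℝ := if 0 ≤ k then poly l k.toNat x else 0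

@[simp]
theorem intPoly_natCast (l : ℝ) (k : ℕ) (x : ℝ) : intPoly l k x = poly l k x := by simp [intPoly]

theorem intPoly_of_neg (l : ℝ) {k : ℤ} (hk : k < 0) (x : ℝ) : intPoly l k x = 0 := by
  simp [intPoly, hk]

/-- The factor of `(r - j + l) * poly l (r - j)` in the expansion of the Chebyshev polynomial of
the second kind of degree `j + r` into Gegenbauer polynomials. -/
def connCoeff (l : ℝ) (j r : ℕ) : ℝ := multichoose (1 - l) j / ((r + 1) * multichoose l (r + 1))

/-- The expansion of the Chebyshev polynomial of the second kind of degree `m` into Gegenbauer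
polynomials. -/
def connSum (l : ℝ) (m : ℕ) (x : ℝ) : ℝ :=
  ∑ p ∈ antidiagonal m, connCoeff l p.1 p.2 * ((p.2 - p.1 + l) * intPoly l (p.2 - p.1) x)

section Connection

variable {l : ℝ}

theorem intPoly_recurrence (hl : -1 / 2 < l) (k : ℤ) (x : ℝ) :
    2 * x * ((k + l) * intPoly l k x) =
      (k + 1) * intPoly l (k + 1) x + (k + 2 * l - 1) * intPoly l (k - 1) x := by
  obtain hk | rfl | rfl | hk : k < -1 ∨ k = -1 ∨ k = 0 ∨ 1 ≤ k := by omega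
  · simp [intPoly_of_neg l (by omega : k < 0), intPoly_of_neg l (by omega : k + 1 < 0),
      intPoly_of_neg l (by omega : k - 1 < 0)]
  · simp [intPoly_of_neg]
  · have h₀ : intPoly l 0 x = 1 := (intPoly_natCast l 0 x).trans (poly_zero l x)
    have h₁ : intPoly l 1 x = 2 * l * x := (intPoly_natCast l 1 x).trans (poly_one_left hl x)
    simp only [zero_add, zero_sub, h₀, h₁, intPoly_of_neg l (by decide : (-1 : ℤ) < 0)]
    push_cast
    ring
  · obtain ⟨n, rfl⟩ := Int.eq_ofNat_of_zero_le (by omega : 0 ≤ k - 1) |>.imp fun n hn =>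
      (by omega : k = (n + 1 : ℕ))
    have hpred : ((n + 1 : ℕ) : ℤ) - 1 = n := by push_cast; ring
    have hsucc : ((n + 1 : ℕ) : ℤ) + 1 = (n + 2 : ℕ) := by push_cast; ring
    simp only [hpred, hsucc, intPoly_natCast]
    push_cast
    linear_combination -poly_recurrence hl n x

theorem connCoeff_succ_right (hl : -1 < l) (hl0 : l ≠ 0) (j r : ℕ) :
    connCoeff l j (r + 1) * (r + 1 + l) = connCoeff l j r * (r + 1) := by
  have hm := multichoose_ne_zero hl hl0 (r + 1)
  have hr : l + ((r + 1 : ℕ) : ℝ) ≠ 0 := by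
    push_cast
    linarith [Nat.cast_nonneg (α := ℝ) r]
  rw [connCoeff, connCoeff, mul_comm _ (multichoose l (r + 1 + 1)), Nat.cast_succ,
    ← Nat.cast_succ, multichoose_succ_mul]
  push_cast at hr ⊢
  field_simp
  ring

theorem connCoeff_succ_left (l : ℝ) (j r : ℕ) :
    connCoeff l (j + 1) r * (j + 1) = connCoeff l j r * (1 - l + j) := by
  simp only [connCoeff, div_mul_eq_mul_div, multichoose_succ_mul]

theorem connCoeff_succ_succ (hl : -1 < l) (hl0 : l ≠ 0) (j r : ℕ) :
    connCoeff l (j + 1) (r + 1) * (r - j + l) =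
      connCoeff l (j + 1) r * (r - j) + connCoeff l j (r + 1) * (r - j + 2 * l) -
        connCoeff l j r * (r - j + l) := by
  have hr : (r : ℝ) + 1 + l ≠ 0 := by linarith [Nat.cast_nonneg (α := ℝ) r]
  have hj : (j : ℝ) + 1 ≠ 0 := j.cast_add_one_ne_zero
  have h₁ := connCoeff_succ_right hl hl0 j r
  have h₂ := connCoeff_succ_right hl hl0 (j + 1) r
  have h₃ := connCoeff_succ_left l j r
  rw [← eq_div_iff hr] at h₁ h₂
  rw [← eq_div_iff hj] at h₃
  rw [h₂, h₁, h₃]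
  field_simp
  ring

theorem two_mul_mul_connSum_succ (hl : -1 / 2 < l) (m : ℕ) (x : ℝ) :
    2 * x * connSum l (m + 1) x =
      connCoeff l 0 (m + 1) * ((m + 2) * intPoly l (m + 2) x) +
        ∑ p ∈ antidiagonal m, connCoeff l (p.1 + 1) p.2 *
          ((p.2 - p.1) * intPoly l (p.2 - p.1) x) +
        ∑ p ∈ antidiagonal m, connCoeff l p.1 (p.2 + 1) *
          ((p.2 - p.1 + 2 * l) * intPoly l (p.2 - p.1) x) := by
  have hsplit : 2 * x * connSum l (m + 1) x =
      ∑ p ∈ antidiagonal (m + 1),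
        connCoeff l p.1 p.2 * ((p.2 - p.1 + 1) * intPoly l (p.2 - p.1 + 1) x) +
      ∑ p ∈ antidiagonal (m + 1),
        connCoeff l p.1 p.2 * ((p.2 - p.1 + 2 * l - 1) * intPoly l (p.2 - p.1 - 1) x) := by
    rw [connSum, Finset.mul_sum, ← Finset.sum_add_distrib]
    refine Finset.sum_congr rfl fun p _ => ?_
    have h := intPoly_recurrence hl (p.2 - p.1) x
    push_cast at h
    linear_combination connCoeff l p.1 p.2 * h
  have hneg : intPoly l ((0 : ℕ) - (m + 1 : ℕ) - 1) x = 0 := intPoly_of_neg l (by omega) x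
  rw [hsplit, Finset.Nat.sum_antidiagonal_succ, Finset.Nat.sum_antidiagonal_succ', hneg, mul_zero,
    mul_zero, zero_add]
  refine congrArg₂ _ (congrArg₂ _ ?_ (Finset.sum_congr rfl fun p _ => ?_))
    (Finset.sum_congr rfl fun p _ => ?_) <;>
  · push_cast
    ring_nf

theorem connSum_add_two (hl : -1 / 2 < l) (hl0 : l ≠ 0) (m : ℕ) (x : ℝ) :
    connSum l (m + 2) x = 2 * x * connSum l (m + 1) x - connSum l m x := by
  have hl' : -1 < l := by linarith
  have hpeel : connSum l (m + 2) x = connCoeff l 0 (m + 2) * ((m + 2 + l) * intPoly l (m + 2) x) +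
      ∑ p ∈ antidiagonal m, connCoeff l (p.1 + 1) (p.2 + 1) *
        ((p.2 - p.1 + l) * intPoly l (p.2 - p.1) x) := by
    have hneg : intPoly l ((0 : ℕ) - (m + 1 + 1 : ℕ)) x = 0 := intPoly_of_neg l (by omega) x
    rw [connSum, Finset.Nat.sum_antidiagonal_succ, Finset.Nat.sum_antidiagonal_succ', hneg,
      mul_zero, mul_zero, zero_add]
    refine congrArg₂ _ ?_ (Finset.sum_congr rfl fun p _ => ?_) <;>
    · push_cast
      ring_nf
  have htop := connCoeff_succ_right hl' hl0 0 (m + 1)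
  have hinner : ∑ p ∈ antidiagonal m, connCoeff l (p.1 + 1) (p.2 + 1) *
        ((p.2 - p.1 + l) * intPoly l (p.2 - p.1) x) =
      ∑ p ∈ antidiagonal m, connCoeff l (p.1 + 1) p.2 * ((p.2 - p.1) * intPoly l (p.2 - p.1) x) +
      ∑ p ∈ antidiagonal m, connCoeff l p.1 (p.2 + 1) *
        ((p.2 - p.1 + 2 * l) * intPoly l (p.2 - p.1) x) -
      ∑ p ∈ antidiagonal m, connCoeff l p.1 p.2 *
        ((p.2 - p.1 + l) * intPoly l (p.2 - p.1) x) := by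
    rw [← Finset.sum_add_distrib, ← Finset.sum_sub_distrib]
    refine Finset.sum_congr rfl fun p _ => ?_
    linear_combination intPoly l (p.2 - p.1) x * connCoeff_succ_succ hl' hl0 p.1 p.2
  rw [hpeel, two_mul_mul_connSum_succ hl, connSum]
  push_cast at htop
  linear_combination hinner + intPoly l (m + 2) x * htop

theorem eval_chebyshevU_eq_connSum (hl : -1 / 2 < l) (hl0 : l ≠ 0) (m : ℕ) (x : ℝ) :
    (Polynomial.Chebyshev.U ℝ m).eval x = connSum l m x := by
  induction m using Nat.twoStepInduction with
  | zero =>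
    have h₀ : intPoly l 0 x = 1 := (intPoly_natCast l 0 x).trans (poly_zero l x)
    simp [connSum, connCoeff, h₀, hl0]
  | one =>
    have h₁ : intPoly l 1 x = 2 * l * x := (intPoly_natCast l 1 x).trans (poly_one_left hl x)
    have h := connCoeff_succ_right (by linarith) hl0 0 0
    have h₀ : connCoeff l 0 0 * l = 1 := by simp [connCoeff, hl0]
    simp [connSum, Finset.Nat.antidiagonal_succ, h₁, intPoly_of_neg] at h ⊢
    linear_combination -(2 * l * x) * h - 2 * x * h₀
  | more m ih ih' =>
    rw [connSum_add_two hl hl0, ← ih, ← ih']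
    simp [Polynomial.Chebyshev.U_add_two]

end Connection

/-! ### Growth of generalised binomial coefficients -/

/-- The normalised binomial coefficient `n ^ (1 - a) * (a)_n / n!`, which tends to `1 / Γ(a)`
monotonically. -/
def gammaRatio (a : ℝ) (n : ℕ) : ℝ := multichoose a n * (n : ℝ) ^ (1 - a)

section GammaRatio

variable {a : ℝ} {n : ℕ}

@[simp]
theorem gammaRatio_one (a : ℝ) : gammaRatio a 1 = a := by simp [gammaRatio]

theorem multichoose_eq_gammaRatio_mul (a : ℝ) (hn : 1 ≤ n) :
    multichoose a n = gammaRatio a n * (n : ℝ) ^ (a - 1) := by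
  have : (0 : ℝ) < n := by exact_mod_cast hn
  rw [gammaRatio, mul_assoc, ← Real.rpow_add this]
  simp

theorem abs_multichoose_eq_gammaRatio_mul (a : ℝ) (hn : 1 ≤ n) :
    |multichoose a n| = |gammaRatio a n| * (n : ℝ) ^ (a - 1) := by
  rw [multichoose_eq_gammaRatio_mul a hn, abs_mul,
    abs_of_nonneg (by positivity : 0 ≤ (n : ℝ) ^ (a - 1))]

theorem gammaRatio_succ (a : ℝ) (hn : 1 ≤ n) : gammaRatio a (n + 1) =
    gammaRatio a n * ((1 + -(1 / (n + 1)) * (1 - a)) * (1 + -(1 / (n + 1))) ^ (-(1 - a) : ℝ)) := by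
  have hn' : (0 : ℝ) < n := by exact_mod_cast hn
  have hdiv : (1 + -(1 / (n + 1)) : ℝ) = n / (n + 1) := by field_simp; ring
  rw [gammaRatio, gammaRatio, multichoose_succ_eq_mul_div, hdiv, Real.rpow_neg (by positivity),
    Real.div_rpow (by positivity) (by positivity)]
  have : (n : ℝ) ^ (1 - a) ≠ 0 := (Real.rpow_pos_of_pos hn' _).ne'
  have : ((n : ℝ) + 1) ^ (1 - a) ≠ 0 := (Real.rpow_pos_of_pos (by positivity) _).ne'
  push_cast
  field_simp
  ring

theorem gammaRatio_pos (ha : 0 < a) (hn : 1 ≤ n) : 0 < gammaRatio a n :=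
  mul_pos (multichoose_pos ha n) (Real.rpow_pos_of_pos (by exact_mod_cast hn) _)

theorem one_add_neg_one_div_succ_pos (hn : 1 ≤ n) : 0 < 1 + -(1 / ((n : ℝ) + 1)) := by
  have hn' : (0 : ℝ) < n := by exact_mod_cast hn
  have : 1 / ((n : ℝ) + 1) < 1 := (div_lt_one (by positivity)).2 (by linarith)
  linarith

theorem antitoneOn_gammaRatio (ha : 1 ≤ a) : AntitoneOn (gammaRatio a) (Ici 1) := by
  refine antitoneOn_nat_Ici_of_succ_le fun n hn => ?_
  rw [gammaRatio_succ a hn]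
  refine mul_le_of_le_one_right (gammaRatio_pos (by linarith) hn).le ?_
  have hpos := one_add_neg_one_div_succ_pos hn
  set y : ℝ := 1 / ((n : ℝ) + 1)
  have hlin : 1 + -y * (1 - a) ≤ Real.exp (y * (a - 1)) := by
    linarith [Real.add_one_le_exp (y * (a - 1))]
  have hpow : (1 + -y) ^ (-(1 - a)) ≤ Real.exp (-y * (a - 1)) := by
    rw [Real.exp_mul, neg_sub]
    exact Real.rpow_le_rpow hpos.le (by linarith [Real.add_one_le_exp (-y)]) (by linarith)
  calc _ ≤ Real.exp (y * (a - 1)) * Real.exp (-y * (a - 1)) := by gcongr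
    _ = 1 := by rw [← Real.exp_add]; simp

theorem monotoneOn_gammaRatio (ha : 0 < a) (ha1 : a ≤ 1) : MonotoneOn (gammaRatio a) (Ici 1) := by
  refine monotoneOn_nat_Ici_of_le_succ fun n hn => ?_
  rw [gammaRatio_succ a hn]
  refine le_mul_of_one_le_right (gammaRatio_pos ha hn).le ?_
  have hpos := one_add_neg_one_div_succ_pos hn
  have hbernoulli := rpow_one_add_le_one_add_mul_self (by linarith : -1 ≤ -(1 / ((n : ℝ) + 1)))
    (p := 1 - a) (by linarith) (by linarith)
  rw [Real.rpow_neg hpos.le, ← div_eq_mul_inv, one_le_div (Real.rpow_pos_of_pos hpos _)]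
  linarith

theorem antitoneOn_abs_gammaRatio (ha : -1 ≤ a) (ha0 : a ≤ 0) :
    AntitoneOn (fun n => |gammaRatio a n|) (Ici 1) := by
  refine antitoneOn_nat_Ici_of_succ_le fun n hn => ?_
  rw [gammaRatio_succ a hn, abs_mul]
  refine mul_le_of_le_one_right (abs_nonneg _) ?_
  have hpos := one_add_neg_one_div_succ_pos hn
  have hbernoulli := one_add_mul_self_le_rpow_one_add (by linarith : -1 ≤ -(1 / ((n : ℝ) + 1)))
    (p := 1 - a) (by linarith)
  have hp := Real.rpow_pos_of_pos hpos (1 - a)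
  have hn1 : (1 : ℝ) ≤ n := by exact_mod_cast hn
  have hnonneg : 0 ≤ 1 + -(1 / ((n : ℝ) + 1)) * (1 - a) := by
    have : 1 / ((n : ℝ) + 1) ≤ 1 / 2 := by gcongr; linarith
    nlinarith
  rw [Real.rpow_neg hpos.le, ← div_eq_mul_inv, abs_of_nonneg (div_nonneg hnonneg hp.le),
    div_le_one hp]
  linarith

theorem Gamma_ne_zero_of_neg_one_lt (ha : -1 < a) (h0 : a ≠ 0) : Real.Gamma a ≠ 0 := by
  refine Real.Gamma_ne_zero fun m hm => ?_
  rcases m with _ | m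
  · exact h0 (by simpa using hm)
  · push_cast at hm
    linarith [Nat.cast_nonneg (α := ℝ) m]

theorem prod_range_add_eq_factorial_mul_multichoose (a : ℝ) (n : ℕ) :
    ∏ j ∈ Finset.range n, (a + j) = n.factorial * multichoose a n := by
  induction n with
  | zero => simp
  | succ n ih =>
    rw [Finset.prod_range_succ, ih, mul_assoc, ← multichoose_succ_mul, Nat.factorial_succ]
    push_cast
    ring

theorem tendsto_gammaRatio (ha : -1 < a) (h0 : a ≠ 0) :
    Tendsto (gammaRatio a) atTop (𝓝 (Real.Gamma a)⁻¹) := by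
  have hdiv : Tendsto (fun n : ℕ => (n : ℝ) / (a + n)) atTop (𝓝 1) := by
    simpa [add_comm] using tendsto_natCast_div_add_atTop (𝕜 := ℝ) a
  have hseq := hdiv.mul ((Real.GammaSeq_tendsto_Gamma a).inv₀ (Gamma_ne_zero_of_neg_one_lt ha h0))
  rw [one_mul] at hseq
  refine hseq.congr' ?_
  filter_upwards [eventually_ge_atTop 1] with n hn
  have hn1 : (1 : ℝ) ≤ n := by exact_mod_cast hn
  have hn0 : (0 : ℝ) < n := by linarith
  have hne : a + n ≠ 0 := by linarith
  have := (Real.rpow_pos_of_pos hn0 a).ne'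
  have := multichoose_ne_zero ha h0 n
  rw [Real.GammaSeq, Finset.prod_range_succ, prod_range_add_eq_factorial_mul_multichoose,
    gammaRatio, Real.rpow_sub hn0, Real.rpow_one]
  field_simp

theorem inv_Gamma_le_gammaRatio (ha : 1 ≤ a) (hn : 1 ≤ n) : (Real.Gamma a)⁻¹ ≤ gammaRatio a n := by
  refine le_of_tendsto (tendsto_gammaRatio (by linarith) (by linarith)) ?_
  filter_upwards [eventually_ge_atTop n] with m hm
  exact antitoneOn_gammaRatio ha hn (hn.trans hm) hm

theorem gammaRatio_le_inv_Gamma (ha : 0 < a) (ha1 : a ≤ 1) (hn : 1 ≤ n) :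
    gammaRatio a n ≤ (Real.Gamma a)⁻¹ := by
  refine ge_of_tendsto (tendsto_gammaRatio (by linarith) ha.ne') ?_
  filter_upwards [eventually_ge_atTop n] with m hm
  exact monotoneOn_gammaRatio ha ha1 hn (hn.trans hm) hm

theorem le_gammaRatio (ha : 0 < a) (ha1 : a ≤ 1) (hn : 1 ≤ n) : a ≤ gammaRatio a n := by
  simpa using monotoneOn_gammaRatio ha ha1 self_mem_Ici hn hn

theorem inv_abs_Gamma_le_abs_gammaRatio (ha : -1 < a) (ha0 : a < 0) (hn : 1 ≤ n) :
    |Real.Gamma a|⁻¹ ≤ |gammaRatio a n| := by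
  have h := (tendsto_gammaRatio ha ha0.ne).abs
  rw [abs_inv] at h
  refine le_of_tendsto h ?_
  filter_upwards [eventually_ge_atTop n] with m hm
  exact antitoneOn_abs_gammaRatio ha.le ha0.le hn (hn.trans hm) hm

theorem exists_abs_gammaRatio_bounds (ha : -1 < a) (h0 : a ≠ 0) :
    ∃ m M : ℝ, 0 < m ∧ 0 < M ∧ ∀ n : ℕ, 1 ≤ n → m ≤ |gammaRatio a n| ∧ |gammaRatio a n| ≤ M := by
  have hG := Gamma_ne_zero_of_neg_one_lt ha h0
  rcases lt_or_gt_of_ne h0 with h | h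
  · exact ⟨|Real.Gamma a|⁻¹, |a|, by positivity, by positivity, fun n hn =>
      ⟨inv_abs_Gamma_le_abs_gammaRatio ha h hn,
        by simpa using antitoneOn_abs_gammaRatio ha.le h.le self_mem_Ici hn hn⟩⟩
  have := Real.Gamma_pos_of_pos h
  rcases le_total a 1 with h1 | h1
  · refine ⟨a, (Real.Gamma a)⁻¹, h, by positivity, fun n hn => ?_⟩
    rw [abs_of_pos (gammaRatio_pos h hn)]
    exact ⟨le_gammaRatio h h1 hn, gammaRatio_le_inv_Gamma h h1 hn⟩
  · refine ⟨(Real.Gamma a)⁻¹, a, by positivity, h, fun n hn => ?_⟩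
    rw [abs_of_pos (gammaRatio_pos h hn)]
    exact ⟨inv_Gamma_le_gammaRatio h1 hn,
      by simpa using antitoneOn_gammaRatio h1 self_mem_Ici hn hn⟩

theorem exists_abs_multichoose_bounds (ha : -1 < a) (h0 : a ≠ 0) :
    ∃ m M : ℝ, 0 < m ∧ 0 < M ∧ ∀ n : ℕ, 1 ≤ n →
      m * (n : ℝ) ^ (a - 1) ≤ |multichoose a n| ∧ |multichoose a n| ≤ M * (n : ℝ) ^ (a - 1) := by
  obtain ⟨m, M, hm, hM, h⟩ := exists_abs_gammaRatio_bounds ha h0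
  refine ⟨m, M, hm, hM, fun n hn => ?_⟩
  rw [abs_multichoose_eq_gammaRatio_mul a hn]
  exact ⟨mul_le_mul_of_nonneg_right (h n hn).1 (by positivity),
    mul_le_mul_of_nonneg_right (h n hn).2 (by positivity)⟩

end GammaRatio

/-! ### The connection coefficients as hypergeometric coefficients -/

theorem tendsto_multichoose_add_sub_one_div {b c : ℝ} (hb : 0 < b) (hc : 0 < c)
    (ha : 0 < b + c - 1) :
    Tendsto (fun j => multichoose (b + c - 1) j / (multichoose b j * multichoose c j)) atTop
      (𝓝 (Real.Gamma b * Real.Gamma c / Real.Gamma (b + c - 1))) := by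
  have hΓ : ∀ {x : ℝ}, 0 < x → (Real.Gamma x)⁻¹ ≠ 0 := fun hx =>
    inv_ne_zero (Real.Gamma_pos_of_pos hx).ne'
  have hT : ∀ {x : ℝ}, 0 < x → Tendsto (gammaRatio x) atTop (𝓝 (Real.Gamma x)⁻¹) := fun hx =>
    tendsto_gammaRatio (by linarith) hx.ne'
  have hquot := (hT ha).div ((hT hb).mul (hT hc)) (mul_ne_zero (hΓ hb) (hΓ hc))
  rw [← mul_inv, inv_div_inv] at hquot
  refine hquot.congr' ?_
  filter_upwards [eventually_ge_atTop 1] with n hn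
  have hn0 : (0 : ℝ) < n := by exact_mod_cast hn
  have hpow : (n : ℝ) ^ (1 - (b + c - 1)) = (n : ℝ) ^ (1 - b) * (n : ℝ) ^ (1 - c) := by
    rw [← Real.rpow_add hn0]
    congr 1
    ring
  have := (Real.rpow_pos_of_pos hn0 (1 - b)).ne'
  have := (Real.rpow_pos_of_pos hn0 (1 - c)).ne'
  have := (multichoose_pos hb n).ne'
  have := (multichoose_pos hc n).ne'
  simp only [Pi.div_apply, gammaRatio, hpow]
  field_simp

theorem multichoose_add_sub_one_le {b c : ℝ} (hb : 0 < b) (hc : 0 < c) (h : b * c ≤ b + c - 1)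
    (j : ℕ) :
    multichoose (b + c - 1) j ≤ Real.Gamma b * Real.Gamma c / Real.Gamma (b + c - 1) *
      (multichoose b j * multichoose c j) := by
  have ha : 0 < b + c - 1 := (mul_pos hb hc).trans_le h
  set q : ℕ → ℝ := fun j => multichoose (b + c - 1) j / (multichoose b j * multichoose c j)
  have hmono : Monotone q := by
    refine monotone_nat_of_le_succ fun j => ?_
    have hm := multichoose_pos hb j
    have hm' := multichoose_pos hc j
    have hstep : q (j + 1) = q j * ((b + c - 1 + j) * (j + 1) / ((b + j) * (c + j))) := by
      simp only [q, multichoose_succ_eq_mul_div]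
      field_simp
    rw [hstep]
    refine le_mul_of_one_le_right
      (div_nonneg (multichoose_pos ha j).le (mul_pos hm hm').le) ?_
    rw [one_le_div (by positivity)]
    linarith
  rw [← div_le_iff₀ (mul_pos (multichoose_pos hb j) (multichoose_pos hc j))]
  exact hmono.ge_of_tendsto (tendsto_multichoose_add_sub_one_div hb hc ha) j

/-- The ratio `(k + 1)_j / (k + l + 1)_j`. -/
def risingRatio (l : ℝ) (k j : ℕ) : ℝ :=
  multichoose ((k : ℝ) + 1) j / multichoose ((k : ℝ) + l + 1) j

/-- The constant `Γ(1 + l) Γ(1 - 2l) / Γ(1 - l)` from the definition of `D`. -/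
def gammaConst (l : ℝ) : ℝ := Real.Gamma (1 + l) * Real.Gamma (1 - 2 * l) / Real.Gamma (1 - l)

/-- A majorant of the coefficients `(k + 1)_j (1 - l)_j / ((k + l + 1)_j j!)` which is uniform
in `k`. -/
def connMajorant (l : ℝ) (j : ℕ) : ℝ :=
  if l < 0 then gammaConst l * multichoose (1 - 2 * l) j else |multichoose (1 - l) j|

/-- The function `₂F₁(k + 1, 1 - l; k + l + 1; w)`. -/
def connSeries (l : ℝ) (k : ℕ) (w : ℂ) : ℂ :=
  ∑' j, ((risingRatio l k j * multichoose (1 - l) j : ℝ) : ℂ) * w ^ j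

section RisingRatio

variable {l : ℝ}

@[simp]
theorem risingRatio_zero (l : ℝ) (k : ℕ) : risingRatio l k 0 = 1 := by simp [risingRatio]

theorem risingRatio_succ (l : ℝ) (k j : ℕ) :
    risingRatio l k (j + 1) = risingRatio l k j * ((k + 1 + j) / (k + l + 1 + j)) := by
  have hj : (j : ℝ) + 1 ≠ 0 := j.cast_add_one_ne_zero
  rw [risingRatio, risingRatio, multichoose_succ_eq_mul_div, multichoose_succ_eq_mul_div,
    mul_div_mul_comm, div_div_div_cancel_right₀ hj]

theorem risingRatio_pos (hl : -1 < l) (k j : ℕ) : 0 < risingRatio l k j := by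
  have : (0 : ℝ) ≤ k := k.cast_nonneg
  exact div_pos (multichoose_pos (by linarith) j) (multichoose_pos (by linarith) j)

theorem risingRatio_le_one (hl : 0 ≤ l) (k j : ℕ) : risingRatio l k j ≤ 1 := by
  induction j with
  | zero => simp
  | succ j ih =>
    rw [risingRatio_succ]
    refine mul_le_one₀ ih (by positivity) ?_
    rw [div_le_one (by positivity)]
    linarith

theorem risingRatio_antitone (hl : -1 < l) (hl0 : l ≤ 0) (j : ℕ) :
    Antitone fun k => risingRatio l k j := by
  refine antitone_nat_of_succ_le fun k => ?_
  induction j with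
  | zero => simp
  | succ j ih =>
    rw [risingRatio_succ, risingRatio_succ]
    have : (0 : ℝ) ≤ k := k.cast_nonneg
    have : (0 : ℝ) ≤ j := j.cast_nonneg
    refine mul_le_mul ih ?_ (div_nonneg (by positivity) (by push_cast; linarith))
      (risingRatio_pos hl k j).le
    rw [div_le_div_iff₀ (by push_cast; linarith) (by linarith)]
    push_cast
    nlinarith

theorem multichoose_mul_multichoose_add (l : ℝ) (k j : ℕ) :
    multichoose l k * (k + l) * multichoose ((k : ℝ) + l + 1) j =
      (k + j + 1) * multichoose l (k + j + 1) * multichoose ((k : ℝ) + 1) j := by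
  induction j with
  | zero =>
    have h := multichoose_succ_mul l k
    simp only [Ring.multichoose_zero_right]
    push_cast
    linear_combination -h
  | succ j ih =>
    have hj : (j : ℝ) + 1 ≠ 0 := j.cast_add_one_ne_zero
    have h₁ := multichoose_succ_mul ((k : ℝ) + l + 1) j
    have h₂ := multichoose_succ_mul ((k : ℝ) + 1) j
    have h₃ := multichoose_succ_mul l (k + j + 1)
    apply mul_right_cancel₀ hj
    push_cast at h₃ ⊢
    rw [← add_assoc]
    linear_combination multichoose l k * (k + l) * h₁ + (k + l + 1 + j) * ih -
      (j + 1) * multichoose ((k : ℝ) + 1) (j + 1) * h₃ -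
      (l + k + j + 1) * multichoose l (k + j + 1) * h₂

theorem connCoeff_mul_eq (hl : -1 < l) (hl0 : l ≠ 0) (k j : ℕ) :
    connCoeff l j (k + j) * (k + l) =
      (multichoose l k)⁻¹ * (risingRatio l k j * multichoose (1 - l) j) := by
  have : (0 : ℝ) ≤ k := k.cast_nonneg
  have hm := multichoose_ne_zero hl hl0 k
  have hm' := multichoose_ne_zero hl hl0 (k + j + 1)
  have hm'' := (multichoose_pos (by linarith : 0 < (k : ℝ) + l + 1) j).ne'
  have h := multichoose_mul_multichoose_add l k j
  have hkj : (k : ℝ) + j + 1 ≠ 0 := by positivity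
  rw [connCoeff, risingRatio, Nat.cast_add]
  field_simp
  linear_combination multichoose (1 - l) j * h

theorem gammaConst_pos (hl : -1 < l) (hl0 : l < 0) : 0 < gammaConst l :=
  div_pos (mul_pos (Real.Gamma_pos_of_pos (by linarith)) (Real.Gamma_pos_of_pos (by linarith)))
    (Real.Gamma_pos_of_pos (by linarith))

theorem risingRatio_mul_multichoose_le (hl : -1 < l) (hl0 : l < 0) (k j : ℕ) :
    risingRatio l k j * multichoose (1 - l) j ≤ gammaConst l * multichoose (1 - 2 * l) j := by
  have hm : 0 < multichoose (1 + l) j := multichoose_pos (by linarith) j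
  have hm' : 0 < multichoose (1 - l) j := multichoose_pos (by linarith) j
  have hratio : risingRatio l 0 j = (multichoose (1 + l) j)⁻¹ := by
    simp [risingRatio, add_comm l]
  have h := multichoose_add_sub_one_le (b := 1 + l) (c := 1 - 2 * l) (by linarith) (by linarith)
    (by nlinarith [sq_nonneg l]) j
  rw [show 1 + l + (1 - 2 * l) - 1 = 1 - l by ring, ← gammaConst] at h
  calc risingRatio l k j * multichoose (1 - l) j
      ≤ risingRatio l 0 j * multichoose (1 - l) j :=
        mul_le_mul_of_nonneg_right (risingRatio_antitone hl hl0.le j k.zero_le) hm'.le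
    _ ≤ gammaConst l * multichoose (1 - 2 * l) j := by
        rw [hratio, inv_mul_le_iff₀ hm]
        linarith

theorem connMajorant_nonneg (hl : -1 < l) (j : ℕ) : 0 ≤ connMajorant l j := by
  rw [connMajorant]
  split_ifs with h
  · exact mul_nonneg (gammaConst_pos hl h).le (multichoose_pos (by linarith) j).le
  · positivity

theorem abs_risingRatio_mul_multichoose_le (hl : -1 < l) (k j : ℕ) :
    |risingRatio l k j * multichoose (1 - l) j| ≤ connMajorant l j := by
  rw [connMajorant]
  split_ifs with h
  · rw [abs_of_pos (mul_pos (risingRatio_pos hl k j) (multichoose_pos (by linarith) j))]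
    exact risingRatio_mul_multichoose_le hl h k j
  · rw [abs_mul, abs_of_pos (risingRatio_pos hl k j)]
    exact mul_le_of_le_one_left (abs_nonneg _) (risingRatio_le_one (not_lt.mp h) k j)

variable {r : ℝ}

theorem summable_connMajorant_mul_pow (l : ℝ) (hr0 : 0 ≤ r) (hr : r < 1) :
    Summable fun j => connMajorant l j * r ^ j := by
  simp only [connMajorant]
  split_ifs with h
  · simp only [mul_assoc]
    exact (hasSum_multichoose_mul_pow _ (by rwa [abs_of_nonneg hr0])).summable.mul_left _
  · exact summable_abs_multichoose_mul_pow _ hr0 hr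

theorem tsum_connMajorant_of_neg (hl0 : l < 0) (hr0 : 0 ≤ r) (hr : r < 1) :
    ∑' j, connMajorant l j * r ^ j = gammaConst l * (1 - r) ^ (2 * l - 1) := by
  have h := hasSum_multichoose_mul_pow (1 - 2 * l) (w := r) (by rwa [abs_of_nonneg hr0])
  simp only [connMajorant, if_pos hl0, mul_assoc]
  rw [(h.mul_left (gammaConst l)).tsum_eq, neg_sub]

theorem tsum_connMajorant_of_le_one (hl0 : 0 < l) (hl1 : l ≤ 1) (hr0 : 0 ≤ r) (hr : r < 1) :
    ∑' j, connMajorant l j * r ^ j = (1 - r) ^ (l - 1) := by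
  have h := hasSum_multichoose_mul_pow (1 - l) (w := r) (by rwa [abs_of_nonneg hr0])
  have hnonneg : ∀ j, 0 ≤ multichoose (1 - l) j := fun j => by
    rcases hl1.eq_or_lt with rfl | hl1
    · cases j <;> simp
    · exact (multichoose_pos (by linarith) j).le
  simp only [connMajorant, if_neg hl0.not_gt, abs_of_nonneg (hnonneg _)]
  rw [h.tsum_eq, neg_sub]

theorem norm_connSeries_term_le (hl : -1 < l) (k j : ℕ) {w : ℂ} (hw : ‖w‖ ≤ r) :
    ‖((risingRatio l k j * multichoose (1 - l) j : ℝ) : ℂ) * w ^ j‖ ≤ connMajorant l j * r ^ j := by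
  rw [norm_mul, norm_pow, Complex.norm_real, Real.norm_eq_abs]
  exact mul_le_mul (abs_risingRatio_mul_multichoose_le hl k j)
    (pow_le_pow_left₀ (norm_nonneg w) hw j) (by positivity) (connMajorant_nonneg hl j)

theorem hasSum_connSeries (hl : -1 < l) (k : ℕ) {w : ℂ} (hw : ‖w‖ < 1) :
    HasSum (fun j => ((risingRatio l k j * multichoose (1 - l) j : ℝ) : ℂ) * w ^ j)
      (connSeries l k w) :=
  (Summable.of_norm_bounded (summable_connMajorant_mul_pow l (norm_nonneg w) hw) fun j =>
    norm_connSeries_term_le hl k j le_rfl).hasSum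

theorem norm_connSeries_le (hl : -1 < l) (k : ℕ) {w : ℂ} (hr : r < 1) (hw : ‖w‖ ≤ r) :
    ‖connSeries l k w‖ ≤ ∑' j, connMajorant l j * r ^ j :=
  tsum_of_norm_bounded (summable_connMajorant_mul_pow l ((norm_nonneg w).trans hw) hr).hasSum
    fun j => norm_connSeries_term_le hl k j hw

end RisingRatio

/-! ### Euler's integral -/

section Beta

open MeasureTheory ProbabilityTheory

variable {a b : ℝ}

theorem Gamma_add_natCast (ha : 0 < a) (j : ℕ) :
    Real.Gamma (a + j) = Real.Gamma a * (j.factorial * multichoose a j) := by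
  rw [← prod_range_add_eq_factorial_mul_multichoose]
  induction j with
  | zero => simp
  | succ j ih =>
    rw [Nat.cast_succ, ← add_assoc, Real.Gamma_add_one (by positivity), ih,
      Finset.prod_range_succ]
    ring

theorem beta_add_natCast (ha : 0 < a) (hb : 0 < b) (j : ℕ) :
    beta (a + j) b = beta a b * (multichoose a j / multichoose (a + b) j) := by
  rw [beta, beta, Gamma_add_natCast ha, add_right_comm,
    Gamma_add_natCast (by positivity : 0 < a + b)]
  have := (Real.Gamma_pos_of_pos (by positivity : 0 < a + b)).ne'
  have := (multichoose_pos (by positivity : 0 < a + b) j).ne'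
  field_simp

theorem ae_betaMeasure_mem_Ioo (a b : ℝ) : ∀ᵐ t ∂betaMeasure a b, t ∈ Ioo (0 : ℝ) 1 := by
  have hmeas : Measurable (betaPDF a b) := (measurable_betaPDFReal a b).ennreal_ofReal
  rw [betaMeasure, ae_withDensity_iff hmeas]
  refine .of_forall fun t ht => ?_
  by_contra! hout
  rw [mem_Ioo, not_and_or, not_lt, not_lt] at hout
  exact hout.elim (fun h => ht (betaPDF_eq_zero_of_nonpos h))
    fun h => ht (betaPDF_eq_zero_of_one_le h)

theorem betaPDF_mul_ofReal_pow (ha : 0 < a) (hb : 0 < b) (j : ℕ) (t : ℝ) :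
    betaPDF a b t * ENNReal.ofReal (t ^ j) =
      ENNReal.ofReal (multichoose a j / multichoose (a + b) j) * betaPDF (a + j) b t := by
  rcases le_or_gt t 0 with h | h
  · simp [betaPDF_eq_zero_of_nonpos h]
  rcases le_or_gt 1 t with h' | h'
  · simp [betaPDF_eq_zero_of_one_le h']
  have hm := multichoose_pos ha j
  have hm' := multichoose_pos (by positivity : 0 < a + b) j
  have hpow : t ^ (a + j - 1) = t ^ j * t ^ (a - 1) := by
    rw [← Real.rpow_natCast, ← Real.rpow_add h]
    congr 1
    ring
  rw [betaPDF_of_pos_lt_one h h', betaPDF_of_pos_lt_one h h', mul_comm,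
    ← ENNReal.ofReal_mul (by positivity), ← ENNReal.ofReal_mul (by positivity),
    beta_add_natCast ha hb, hpow]
  have := (beta_pos ha hb).ne'
  congr 1
  field_simp

theorem integral_pow_betaMeasure (ha : 0 < a) (hb : 0 < b) (j : ℕ) :
    ∫ t, t ^ j ∂betaMeasure a b = multichoose a j / multichoose (a + b) j := by
  have hmeas (c : ℝ) : Measurable (betaPDF c b) := (measurable_betaPDFReal c b).ennreal_ofReal
  have hnonneg : 0 ≤ multichoose a j / multichoose (a + b) j :=
    div_nonneg (multichoose_pos ha j).le (multichoose_pos (by positivity) j).le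
  rw [integral_eq_lintegral_of_nonneg_ae
      ((ae_betaMeasure_mem_Ioo a b).mono fun t ht => pow_nonneg ht.1.le j) (by fun_prop),
    betaMeasure, lintegral_withDensity_eq_lintegral_mul _ (hmeas a) (by fun_prop)]
  simp only [Pi.mul_apply, betaPDF_mul_ofReal_pow ha hb]
  rw [lintegral_const_mul _ (hmeas _), lintegral_betaPDF_eq_one (by positivity) hb, mul_one,
    ENNReal.toReal_ofReal hnonneg]

end Beta

theorem hasSum_multichoose_mul_cpow (a : ℝ) {w : ℂ} (hw : ‖w‖ < 1) :
    HasSum (fun n => ((multichoose a n : ℝ) : ℂ) * w ^ n) ((1 - w) ^ (-a : ℂ)) := by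
  have h := (Complex.one_div_one_sub_cpow_hasFPowerSeriesOnBall_zero (a : ℂ)).hasSum (y := w)
    (by simpa [enorm_eq_nnnorm, ← NNReal.coe_lt_coe] using hw)
  simpa [FormalMultilinearSeries.ofScalars_apply_eq, ← Ring.multichoose_eq, ofReal_multichoose,
    Complex.cpow_neg, mul_comm] using h

section EulerIntegral

open MeasureTheory ProbabilityTheory

variable {l : ℝ}

theorem risingRatio_eq_integral (hl : 0 < l) (k j : ℕ) :
    risingRatio l k j = ∫ t, t ^ j ∂betaMeasure (k + 1) l := by
  rw [integral_pow_betaMeasure (by positivity) hl, risingRatio, add_right_comm]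

theorem connSeries_eq_integral (hl : 0 < l) (k : ℕ) {w : ℂ} (hw : ‖w‖ < 1) :
    connSeries l k w =
      ∫ t : ℝ, (1 - (t : ℂ) * w) ^ ((l - 1 : ℝ) : ℂ) ∂betaMeasure (k + 1) l := by
  set μ := betaMeasure (k + 1) l
  have : IsProbabilityMeasure μ := isProbabilityMeasureBeta (by positivity) hl
  have hμ : ∀ᵐ t ∂μ, t ∈ Ioo (0 : ℝ) 1 := ae_betaMeasure_mem_Ioo _ _
  have hInt (j : ℕ) : Integrable (fun t : ℝ => t ^ j) μ :=
    Integrable.of_bound (by fun_prop) 1 (hμ.mono fun t ht => by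
      rw [norm_pow, Real.norm_of_nonneg ht.1.le]
      exact pow_le_one₀ ht.1.le ht.2.le)
  set F : ℕ → ℝ → ℂ := fun j t => ((multichoose (1 - l) j : ℝ) : ℂ) * w ^ j * ((t ^ j : ℝ) : ℂ)
  have hF (j : ℕ) :
      ∫ t, F j t ∂μ = ((risingRatio l k j * multichoose (1 - l) j : ℝ) : ℂ) * w ^ j := by
    rw [integral_const_mul, integral_complex_ofReal, ← risingRatio_eq_integral hl,
      Complex.ofReal_mul]
    ring
  have hnorm (j : ℕ) : ∫ t, ‖F j t‖ ∂μ = |multichoose (1 - l) j| * ‖w‖ ^ j * risingRatio l k j := by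
    rw [risingRatio_eq_integral hl, ← integral_const_mul]
    refine integral_congr_ae (hμ.mono fun t ht => ?_)
    simp [F, abs_of_pos ht.1]
  have hsum := hasSum_integral_of_summable_integral_norm (μ := μ) (F := F)
    (fun j => (hInt j).ofReal.const_mul _) <|
    .of_nonneg_of_le (fun j => integral_nonneg fun t => norm_nonneg _)
      (fun j => (hnorm j).trans_le <|
        mul_le_of_le_one_right (by positivity) (risingRatio_le_one hl.le k j))
      (summable_abs_multichoose_mul_pow (1 - l) (norm_nonneg w) hw)
  rw [funext hF] at hsum
  rw [connSeries, hsum.tsum_eq]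
  refine integral_congr_ae (hμ.mono fun t ht => ?_)
  beta_reduce
  have htw : ‖(t : ℂ) * w‖ < 1 := by
    rw [norm_mul, Complex.norm_real, Real.norm_of_nonneg ht.1.le]
    nlinarith [ht.1, ht.2, norm_nonneg w]
  rw [show ((l - 1 : ℝ) : ℂ) = -((1 - l : ℝ) : ℂ) by push_cast; ring,
    ← (hasSum_multichoose_mul_cpow (1 - l) htw).tsum_eq]
  refine tsum_congr fun j => ?_
  simp only [F, mul_pow, Complex.ofReal_pow]
  ring

theorem norm_connSeries_le_of_one_le (hl : 1 ≤ l) (k : ℕ) {w : ℂ} {r : ℝ} (hr : r < 1)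
    (hw : ‖w‖ ≤ r) : ‖connSeries l k w‖ ≤ (1 + r) ^ (l - 1) := by
  have hl0 : 0 < l := by linarith
  have : IsProbabilityMeasure (betaMeasure (k + 1) l) :=
    isProbabilityMeasureBeta (by positivity) hl0
  rw [connSeries_eq_integral hl0 k (hw.trans_lt hr)]
  refine (norm_integral_le_of_norm_le_const (C := (1 + r) ^ (l - 1))
    ((ae_betaMeasure_mem_Ioo _ _).mono fun t ht => ?_)).trans (by simp)
  rw [Complex.norm_cpow_real]
  refine Real.rpow_le_rpow (norm_nonneg _) ((norm_sub_le _ _).trans ?_) (by linarith)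
  rw [norm_one, norm_mul, Complex.norm_real, Real.norm_of_nonneg ht.1.le]
  nlinarith [ht.1, ht.2, norm_nonneg w]

variable {w : ℝ}

theorem hasSum_re_connSeries (hl : -1 < l) (k : ℕ) (hw : |w| < 1) :
    HasSum (fun j => risingRatio l k j * multichoose (1 - l) j * w ^ j) (connSeries l k w).re := by
  have h := Complex.hasSum_re (hasSum_connSeries hl k (w := w) (by simpa using hw))
  simpa only [← Complex.ofReal_pow, ← Complex.ofReal_mul, Complex.ofReal_re] using h

theorem ofReal_re_connSeries (l : ℝ) (k : ℕ) (w : ℝ) :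
    ((connSeries l k w).re : ℂ) = connSeries l k w := by
  rw [← Complex.conj_eq_iff_re, connSeries, Complex.conj_tsum]
  simp

theorem rpow_mem_uIcc_one {c x : ℝ} (a : ℝ) (hc : 0 < c) (hx : x ∈ Icc c 1) :
    x ^ a ∈ uIcc 1 (c ^ a) := by
  have hx0 : 0 < x := hc.trans_le hx.1
  rcases le_total 0 a with ha | ha
  · exact mem_uIcc_of_ge (Real.rpow_le_rpow hc.le hx.1 ha) (Real.rpow_le_one hx0.le hx.2 ha)
  · exact mem_uIcc_of_le (Real.one_le_rpow_of_pos_of_le_one_of_nonpos hx0 hx.2 ha)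
      (Real.rpow_le_rpow_of_nonpos hc hx.1 ha)

theorem min_one_rpow_le_re_connSeries (hl : 0 < l) (k : ℕ) (hw0 : 0 ≤ w) (hw : w < 1) :
    min 1 ((1 - w) ^ (l - 1)) ≤ (connSeries l k w).re := by
  set μ := betaMeasure (k + 1) l
  have : IsProbabilityMeasure μ := isProbabilityMeasureBeta (by positivity) hl
  have hmem : ∀ᵐ t ∂μ, (1 - t * w) ∈ Icc (1 - w) 1 := (ae_betaMeasure_mem_Ioo _ _).mono
    fun t ht => ⟨by nlinarith [ht.2], by nlinarith [ht.1]⟩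
  have hbounds : ∀ᵐ t ∂μ, (1 - t * w) ^ (l - 1) ∈ uIcc 1 ((1 - w) ^ (l - 1)) :=
    hmem.mono fun t ht => rpow_mem_uIcc_one _ (by linarith) ht
  have hreal : (connSeries l k w).re = ∫ t, (1 - t * w) ^ (l - 1) ∂μ := by
    rw [connSeries_eq_integral hl k (by simpa [abs_of_nonneg hw0] using hw),
      ← Complex.ofReal_re (∫ t, (1 - t * w) ^ (l - 1) ∂μ), ← integral_complex_ofReal]
    refine congrArg Complex.re (integral_congr_ae (hmem.mono fun t ht => ?_))
    beta_reduce
    rw [Complex.ofReal_cpow (by linarith [ht.1])]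
    simp
  have hmeas : Measurable fun t : ℝ => (1 - t * w) ^ (l - 1) := by fun_prop
  have hInt : Integrable (fun t : ℝ => (1 - t * w) ^ (l - 1)) μ :=
    .of_mem_Icc _ _ hmeas.aemeasurable hbounds
  rw [hreal]
  simpa using integral_mono_ae (integrable_const (μ := μ) (min 1 ((1 - w) ^ (l - 1)))) hInt
    (hbounds.mono fun t ht => ht.1)

theorem one_le_re_connSeries (hl : -1 < l) (hl0 : l < 0) (k : ℕ) (hw0 : 0 ≤ w) (hw : w < 1) :
    1 ≤ (connSeries l k w).re := by
  have h := hasSum_re_connSeries hl k (w := w) (by rwa [abs_of_nonneg hw0])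
  simpa using le_hasSum h 0 fun j _ => mul_nonneg
    (mul_pos (risingRatio_pos hl k j) (multichoose_pos (by linarith) j)).le (pow_nonneg hw0 j)

theorem antitone_re_connSeries (hl : -1 < l) (hl0 : l < 0) (hw0 : 0 ≤ w) (hw : w < 1) :
    Antitone fun k => (connSeries l k w).re := fun k k' hk => by
  have h (k : ℕ) := hasSum_re_connSeries hl k (w := w) (by rwa [abs_of_nonneg hw0])
  refine hasSum_le (fun j => ?_) (h k') (h k)
  have := (multichoose_pos (by linarith : 0 < 1 - l) j).le
  exact mul_le_mul_of_nonneg_right (mul_le_mul_of_nonneg_right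
    (risingRatio_antitone hl hl0.le j hk) this) (pow_nonneg hw0 j)

end EulerIntegral

/-! ### From Chebyshev series to Gegenbauer series -/

/-- The `k`-th Gegenbauer coefficient of `∑ β_m U_m`, with `U_m` the Chebyshev polynomials of the
second kind. -/
def seriesCoeff (l : ℝ) (β : ℕ → ℂ) (k : ℕ) : ℂ :=
  ∑' j, β (k + 2 * j) * ((connCoeff l j (k + j) * (k + l) : ℝ) : ℂ)

/-- The contribution of `β_m U_m`, `m = k + 2 j`, to the `k`-th term of the Gegenbauer expansion of
`∑ β_m U_m`; the index is `p = (k, j)`. -/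
def doubleTerm (l : ℝ) (β : ℕ → ℂ) (x : ℝ) (p : ℕ × ℕ) : ℂ :=
  β (p.1 + 2 * p.2) * ((connCoeff l p.2 (p.1 + p.2) * (p.1 + l) : ℝ) : ℂ) * (poly l p.1 x : ℂ)

/-- A majorant of `doubleTerm l β x`, uniform in `x ∈ [-1, 1]`, if `‖β m‖ ≤ B * q ^ m`. -/
def doubleBound (l B q : ℝ) (p : ℕ × ℕ) : ℝ :=
  B * (q ^ p.1 * |multichoose l p.1|⁻¹ * trigBound l p.1) * (connMajorant l p.2 * (q ^ 2) ^ p.2)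

section Chebyshev

open Polynomial.Chebyshev

variable {l : ℝ}

theorem exists_inv_abs_multichoose_le (hl : -1 < l) (hl0 : l ≠ 0) :
    ∃ A : ℝ, 0 < A ∧ ∀ k, |multichoose l k|⁻¹ ≤ A * multichoose (|l| + 2) k := by
  obtain ⟨m, _, hm, _, hlow⟩ := exists_abs_multichoose_bounds hl hl0
  have hl2 : 0 < |l| + 2 := by positivity
  obtain ⟨m', _, hm', _, hlow'⟩ :=
    exists_abs_multichoose_bounds (a := |l| + 2) (by linarith) hl2.ne'
  refine ⟨max 1 ((m * m')⁻¹), by positivity, fun k => ?_⟩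
  rcases Nat.eq_zero_or_pos k with rfl | hk
  · simp
  have hk1 : (1 : ℝ) ≤ k := by exact_mod_cast hk
  have hk0 : (0 : ℝ) < k := by linarith
  have hpow : ((k : ℝ) ^ (l - 1))⁻¹ ≤ (k : ℝ) ^ (|l| + 2 - 1) := by
    rw [← Real.rpow_neg hk0.le]
    exact Real.rpow_le_rpow_of_exponent_le hk1 (by linarith [neg_abs_le l])
  have hlow'' := (hlow' k hk).1
  rw [abs_of_pos (multichoose_pos hl2 k), mul_comm, ← le_div_iff₀ hm'] at hlow''
  have := Real.rpow_pos_of_pos hk0 (l - 1)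
  calc |multichoose l k|⁻¹ ≤ (m * (k : ℝ) ^ (l - 1))⁻¹ := by gcongr; exact (hlow k hk).1
    _ ≤ m⁻¹ * (multichoose (|l| + 2) k / m') := by
        rw [mul_inv]
        gcongr
        exact hpow.trans hlow''
    _ = (m * m')⁻¹ * multichoose (|l| + 2) k := by rw [mul_inv]; ring
    _ ≤ _ := mul_le_mul_of_nonneg_right (le_max_right _ _) (multichoose_pos hl2 k).le

variable {β : ℕ → ℂ} {B q : ℝ}

theorem summable_pow_mul_inv_mul_trigBound (hl : -1 < l) (hl0 : l ≠ 0) (hq0 : 0 ≤ q) (hq : q < 1) :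
    Summable fun k => q ^ k * |multichoose l k|⁻¹ * trigBound l k := by
  obtain ⟨A, hA, hinv⟩ := exists_inv_abs_multichoose_le hl hl0
  have hs0 := Real.sqrt_nonneg q
  have hs1 : √q < 1 := by rwa [Real.sqrt_lt' one_pos, one_pow]
  have hsum : Summable fun k => A * (multichoose (|l| + 2) k * √q ^ k) :=
    ((hasSum_multichoose_mul_pow (|l| + 2) (by rwa [abs_of_nonneg hs0])).summable).mul_left A
  have hsum' := summable_trigBound_mul_pow l hs0 hs1
  have hnonneg (k : ℕ) : 0 ≤ A * (multichoose (|l| + 2) k * √q ^ k) :=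
    mul_nonneg hA.le (mul_nonneg (multichoose_pos (by positivity) k).le (by positivity))
  have hnonneg' (k : ℕ) : 0 ≤ trigBound l k * √q ^ k :=
    mul_nonneg (trigBound_nonneg l k) (by positivity)
  refine .of_nonneg_of_le (fun k => mul_nonneg (by positivity) (trigBound_nonneg l k))
    (fun k => ?_) (hsum.mul_right (∑' k, trigBound l k * √q ^ k))
  calc q ^ k * |multichoose l k|⁻¹ * trigBound l k
      = (|multichoose l k|⁻¹ * √q ^ k) * (trigBound l k * √q ^ k) := by
        nth_rw 1 [← Real.mul_self_sqrt hq0]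
        rw [mul_pow]
        ring
    _ ≤ (A * (multichoose (|l| + 2) k * √q ^ k)) * (trigBound l k * √q ^ k) := by
        refine mul_le_mul_of_nonneg_right ?_ (hnonneg' k)
        rw [← mul_assoc]
        exact mul_le_mul_of_nonneg_right (hinv k) (by positivity)
    _ ≤ _ := mul_le_mul_of_nonneg_left (hsum'.le_tsum k fun j _ => hnonneg' j) (hnonneg k)

theorem norm_mul_connCoeff_le (hl : -1 < l) (hl0 : l ≠ 0) {k j : ℕ}
    (hβ : ‖β (k + 2 * j)‖ ≤ B * q ^ (k + 2 * j)) :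
    ‖β (k + 2 * j) * ((connCoeff l j (k + j) * (k + l) : ℝ) : ℂ)‖ ≤
      B * (q ^ k * |multichoose l k|⁻¹) * (connMajorant l j * (q ^ 2) ^ j) := by
  rw [norm_mul, Complex.norm_real, connCoeff_mul_eq hl hl0, Real.norm_eq_abs, abs_mul, abs_inv]
  calc _ ≤ (B * q ^ (k + 2 * j)) * (|multichoose l k|⁻¹ * connMajorant l j) :=
        mul_le_mul hβ (mul_le_mul_of_nonneg_left (abs_risingRatio_mul_multichoose_le hl k j)
          (by positivity)) (by positivity) ((norm_nonneg _).trans hβ)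
    _ = _ := by rw [pow_add, pow_mul]; ring

theorem hasSum_seriesCoeff (hl : -1 < l) (hl0 : l ≠ 0) (hq0 : 0 ≤ q) (hq : q < 1)
    (hβ : ∀ m, ‖β m‖ ≤ B * q ^ m) (k : ℕ) :
    HasSum (fun j => β (k + 2 * j) * ((connCoeff l j (k + j) * (k + l) : ℝ) : ℂ))
      (seriesCoeff l β k) :=
  (Summable.of_norm_bounded
    ((summable_connMajorant_mul_pow l (by positivity) (by nlinarith : q ^ 2 < 1)).mul_left _)
    fun j => norm_mul_connCoeff_le hl hl0 (hβ _)).hasSum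

theorem norm_doubleTerm_le (hl : -1 / 2 < l) (hl0 : l ≠ 0) (hβ : ∀ m, ‖β m‖ ≤ B * q ^ m) {x : ℝ}
    (hx : x ∈ Icc (-1 : ℝ) 1) (p : ℕ × ℕ) : ‖doubleTerm l β x p‖ ≤ doubleBound l B q p := by
  have h := norm_mul_connCoeff_le (by linarith) hl0 (hβ (p.1 + 2 * p.2))
  rw [doubleTerm, norm_mul, Complex.norm_real, Real.norm_eq_abs]
  calc _ ≤ _ := mul_le_mul h (abs_poly_le_trigBound hl p.1 hx) (abs_nonneg _)
        ((norm_nonneg _).trans h)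
    _ = _ := by rw [doubleBound]; ring

theorem summable_doubleBound (hl : -1 < l) (hl0 : l ≠ 0) (hB : 0 ≤ B) (hq0 : 0 ≤ q) (hq : q < 1) :
    Summable (doubleBound l B q) :=
  ((summable_pow_mul_inv_mul_trigBound hl hl0 hq0 hq).mul_left B).mul_of_nonneg
    (summable_connMajorant_mul_pow l (by positivity) (by nlinarith : q ^ 2 < 1))
    (fun k => mul_nonneg hB (mul_nonneg (by positivity) (trigBound_nonneg l k)))
    (fun j => mul_nonneg (connMajorant_nonneg hl j) (by positivity))

/-- The terms of `doubleTerm`, indexed by `(j, r)` with `r = k + j`, so that the contributions of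
`β_m U_m` lie on an antidiagonal. -/
def antidiagonalTerm (l : ℝ) (β : ℕ → ℂ) (x : ℝ) (p : ℕ × ℕ) : ℂ :=
  β (p.1 + p.2) *
    ((connCoeff l p.1 p.2 * ((p.2 - p.1 + l) * intPoly l (p.2 - p.1) x) : ℝ) : ℂ)

theorem sum_antidiagonalTerm (hl : -1 / 2 < l) (hl0 : l ≠ 0) (β : ℕ → ℂ) (x : ℝ) (m : ℕ) :
    ∑ p ∈ antidiagonal m, antidiagonalTerm l β x p = β m * ((U ℝ m).eval x : ℝ) := by
  rw [eval_chebyshevU_eq_connSum hl hl0, connSum, Complex.ofReal_sum, Finset.mul_sum]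
  refine Finset.sum_congr rfl fun p hp => ?_
  rw [antidiagonalTerm, Finset.HasAntidiagonal.mem_antidiagonal.mp hp]

theorem hasSum_antidiagonalTerm_iff (l : ℝ) (β : ℕ → ℂ) (x : ℝ) (s : ℂ) :
    HasSum (antidiagonalTerm l β x) s ↔ HasSum (doubleTerm l β x) s := by
  have hinj : Function.Injective fun p : ℕ × ℕ => (p.2, p.1 + p.2) := by
    rintro ⟨a, b⟩ ⟨c, d⟩ h
    simp only [Prod.mk.injEq] at h ⊢
    omega
  rw [← hinj.hasSum_iff]
  · refine iff_of_eq (congrArg (HasSum · s) (funext fun p => ?_))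
    have hk : ((p.1 + p.2 : ℕ) : ℤ) - (p.2 : ℕ) = (p.1 : ℕ) := by push_cast; ring
    simp only [Function.comp_apply, antidiagonalTerm, doubleTerm, hk, intPoly_natCast]
    rw [show p.2 + (p.1 + p.2) = p.1 + 2 * p.2 by ring]
    push_cast
    ring
  · rintro ⟨j, r⟩ hp
    have hlt : r < j := by
      by_contra! hle
      exact hp ⟨(r - j, j), by simp [hle]⟩
    simp [antidiagonalTerm, intPoly_of_neg l (by omega : (r : ℤ) - j < 0)]

theorem hasSum_doubleTerm (hl : -1 / 2 < l) (hl0 : l ≠ 0) (hq0 : 0 ≤ q) (hq : q < 1)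
    (hβ : ∀ m, ‖β m‖ ≤ B * q ^ m) {x : ℝ} (hx : x ∈ Icc (-1 : ℝ) 1) {y : ℂ}
    (hy : HasSum (fun m : ℕ => β m * ((U ℝ m).eval x : ℝ)) y) : HasSum (doubleTerm l β x) y := by
  have hB : 0 ≤ B := by simpa using (norm_nonneg _).trans (hβ 0)
  obtain ⟨s, hs⟩ := Summable.of_norm_bounded
    (summable_doubleBound (by linarith) hl0 hB hq0 hq) (norm_doubleTerm_le hl hl0 hβ hx)
  have hsigma := (Finset.HasAntidiagonal.sigmaAntidiagonalEquivProd.hasSum_iff.mpr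
    ((hasSum_antidiagonalTerm_iff l β x s).mpr hs)).sigma fun m => hasSum_fintype _
  have hfiber (m : ℕ) : ∑ p : antidiagonal m, (antidiagonalTerm l β x ∘
      Finset.HasAntidiagonal.sigmaAntidiagonalEquivProd) ⟨m, p⟩ =
        β m * ((U ℝ m).eval x : ℝ) := by
    simp only [Function.comp_apply, Finset.HasAntidiagonal.sigmaAntidiagonalEquivProd_apply]
    rw [← sum_antidiagonalTerm hl hl0, Finset.sum_coe_sort _ (antidiagonalTerm l β x)]
  rw [funext hfiber] at hsigma
  exact hsigma.unique hy ▸ hs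

variable {g : ℝ → ℂ}

theorem coeff_doubleTerm (hl : -1 / 2 < l) (hl0 : l ≠ 0) (β : ℕ → ℂ) (k : ℕ) (p : ℕ × ℕ) :
    coeff l (fun x => doubleTerm l β x p) k =
      if p.1 = k then β (p.1 + 2 * p.2) * ((connCoeff l p.2 (p.1 + p.2) * (p.1 + l) : ℝ) : ℂ)
      else 0 := by
  simp only [doubleTerm]
  rw [coeff_const_mul, coeff_poly hl hl0, mul_ite, mul_one, mul_zero]

theorem coeff_eq_seriesCoeff (hl : -1 / 2 < l) (hl0 : l ≠ 0) (hq0 : 0 ≤ q) (hq : q < 1)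
    (hβ : ∀ m, ‖β m‖ ≤ B * q ^ m)
    (hg : ∀ x ∈ Icc (-1 : ℝ) 1, HasSum (fun m : ℕ => β m * ((U ℝ m).eval x : ℝ)) (g x)) (k : ℕ) :
    coeff l g k = seriesCoeff l β k := by
  have hB : 0 ≤ B := by simpa using (norm_nonneg _).trans (hβ 0)
  have hcont (p : ℕ × ℕ) : Continuous fun x => doubleTerm l β x p :=
    continuous_const.mul (Complex.continuous_ofReal.comp (continuous_poly l p.1))
  have h := hasSum_coeff hl k hcont (summable_doubleBound (by linarith) hl0 hB hq0 hq)
    (fun p x hx => norm_doubleTerm_le hl hl0 hβ hx p)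
    fun x hx => hasSum_doubleTerm hl hl0 hq0 hq hβ hx (hg x hx)
  rw [funext (coeff_doubleTerm hl hl0 β k), ← (Prod.mk_right_injective k).hasSum_iff] at h
  · simp only [Function.comp_def, if_true] at h
    exact h.unique (hasSum_seriesCoeff (by linarith) hl0 hq0 hq hβ k)
  · exact fun p hp => if_neg fun hpk => hp ⟨p.2, Prod.ext hpk.symm rfl⟩

theorem hasSum_sub_proj (hl : -1 / 2 < l) (hl0 : l ≠ 0) (hq0 : 0 ≤ q) (hq : q < 1)
    (hβ : ∀ m, ‖β m‖ ≤ B * q ^ m)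
    (hg : ∀ x ∈ Icc (-1 : ℝ) 1, HasSum (fun m : ℕ => β m * ((U ℝ m).eval x : ℝ)) (g x)) (n : ℕ)
    {x : ℝ} (hx : x ∈ Icc (-1 : ℝ) 1) :
    HasSum (fun i => seriesCoeff l β (i + (n + 1)) * (poly l (i + (n + 1)) x : ℂ))
      (g x - proj l n g x) := by
  have hseries : HasSum (fun k => seriesCoeff l β k * (poly l k x : ℂ)) (g x) := by
    refine (hasSum_doubleTerm hl hl0 hq0 hq hβ hx (hg x hx)).prod_fiberwise fun k => ?_
    simp only [doubleTerm]
    exact (hasSum_seriesCoeff (by linarith) hl0 hq0 hq hβ k).mul_right _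
  have hproj : proj l n g x = ∑ k ∈ Finset.range (n + 1), seriesCoeff l β k * (poly l k x : ℂ) :=
    Finset.sum_congr rfl fun k _ => by rw [coeff_eq_seriesCoeff hl hl0 hq0 hq hβ hg]
  rw [hproj]
  exact (hasSum_nat_add_iff' (n + 1)).mpr hseries

end Chebyshev

/-! ### The Joukowski map on an annulus -/

theorem norm_joukowski_sub_add {u : ℂ} (hu : u ≠ 0) :
    ‖joukowski u - 1‖ + ‖joukowski u + 1‖ = ‖u‖ + ‖u‖⁻¹ := by
  have hn : ‖u‖ ≠ 0 := norm_ne_zero_iff.mpr hu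
  have hsub : joukowski u - 1 = (u - 1) ^ 2 / (2 * u) := by
    unfold joukowski; field_simp; ring
  have hadd : joukowski u + 1 = (u + 1) ^ 2 / (2 * u) := by
    unfold joukowski; field_simp; ring
  have h := parallelogram_law_with_norm ℝ u 1
  simp only [norm_one] at h
  rw [hsub, hadd]
  simp only [norm_div, norm_pow, norm_mul, Complex.norm_ofNat]
  field_simp
  nlinarith [h]

theorem add_inv_lt_add_inv {a b : ℝ} (ha : 1 ≤ a) (hab : a < b) : a + a⁻¹ < b + b⁻¹ := by
  have : 0 < a := by linarith
  have hb0 : 0 < b := by linarith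
  have hdiff : b + b⁻¹ - (a + a⁻¹) = (b - a) * (a * b - 1) / (a * b) := by field_simp; ring
  have hpos : 0 < (b - a) * (a * b - 1) / (a * b) :=
    div_pos (mul_pos (by linarith) (by nlinarith)) (by positivity)
  linarith

theorem ellipse_eq_image (ρ : ℝ) : ellipse ρ = joukowski '' Metric.sphere 0 ρ := by
  ext z
  simp only [ellipse, mem_ofPred_eq, mem_image, mem_sphere_zero_iff_norm, eq_comm]

theorem isOpen_region (ρ : ℝ) : IsOpen (region ρ) := by
  have h : Continuous fun z : ℂ => ‖z - 1‖ + ‖z + 1‖ := by fun_prop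
  exact h.isOpen_preimage _ isOpen_Iio

theorem differentiableAt_joukowski {u : ℂ} (hu : u ≠ 0) : DifferentiableAt ℂ joukowski u :=
  (differentiableAt_id.add (differentiableAt_inv hu)).div_const 2

theorem joukowski_circleMap_one (θ : ℝ) : joukowski (circleMap 0 1 θ) = (Real.cos θ : ℂ) := by
  rw [circleMap_zero, joukowski, Complex.ofReal_one, one_mul, ← Complex.exp_neg,
    Complex.ofReal_cos, Complex.cos, neg_mul]

/-- The closed annulus `1 ≤ |u| ≤ ρ`, which the Joukowski map sends onto the closure of the region
bounded by the Bernstein ellipse. -/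
def annulus (ρ : ℝ) : Set ℂ := {u | 1 ≤ ‖u‖ ∧ ‖u‖ ≤ ρ}

section Annulus

variable {f : ℂ → ℂ} {ρ : ℝ} {u : ℂ}

theorem ne_zero_of_mem_annulus (hu : u ∈ annulus ρ) : u ≠ 0 :=
  norm_pos_iff.mp (one_pos.trans_le hu.1)

theorem circleMap_mem_annulus (hρ : 1 ≤ ρ) (θ : ℝ) : circleMap 0 ρ θ ∈ annulus ρ := by
  simp [annulus, abs_of_nonneg (zero_le_one.trans hρ), hρ]

theorem joukowski_mem_region (h1 : 1 ≤ ‖u‖) (h2 : ‖u‖ < ρ) : joukowski u ∈ region ρ := by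
  rw [region, mem_ofPred_eq, norm_joukowski_sub_add (norm_pos_iff.mp (by linarith))]
  exact add_inv_lt_add_inv h1 h2

theorem joukowski_mem_closure_region (hρ : 1 < ρ) (hu : u ∈ annulus ρ) :
    joukowski u ∈ closure (region ρ) := by
  rcases hu.2.lt_or_eq with hlt | heq
  · exact subset_closure (joukowski_mem_region hu.1 hlt)
  have hρ0 : 0 < ρ := by linarith
  have hlim : Tendsto (fun t : ℝ => (t : ℂ) * u) (𝓝[<] 1) (𝓝 u) := by
    have : Continuous fun t : ℝ => (t : ℂ) * u := by fun_prop
    simpa using (this.tendsto 1).mono_left nhdsWithin_le_nhds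
  have hgt : ∀ᶠ t : ℝ in 𝓝[<] 1, ρ⁻¹ < t :=
    (eventually_gt_nhds (inv_lt_one_of_one_lt₀ hρ)).filter_mono nhdsWithin_le_nhds
  refine mem_closure_of_tendsto ((differentiableAt_joukowski
    (ne_zero_of_mem_annulus hu)).continuousAt.tendsto.comp hlim) ?_
  filter_upwards [hgt, self_mem_nhdsWithin] with t ht (ht1 : t < 1)
  have hnorm : ‖(t : ℂ) * u‖ = t * ρ := by
    rw [norm_mul, Complex.norm_real, Real.norm_of_nonneg ((inv_pos.mpr hρ0).trans ht).le, heq]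
  refine joukowski_mem_region ?_ ?_ <;> rw [hnorm]
  · exact ((inv_lt_iff_one_lt_mul₀ hρ0).mp ht).le
  · nlinarith

theorem continuousOn_comp_joukowski (hf : DiffContOnCl ℂ f (region ρ)) (hρ : 1 < ρ) :
    ContinuousOn (fun u => f (joukowski u)) (annulus ρ) :=
  hf.continuousOn.comp (fun _ hu => (differentiableAt_joukowski
    (ne_zero_of_mem_annulus hu)).continuousAt.continuousWithinAt)
    fun _ hu => joukowski_mem_closure_region hρ hu

theorem differentiableAt_comp_joukowski (hf : DiffContOnCl ℂ f (region ρ)) (h1 : 1 < ‖u‖)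
    (h2 : ‖u‖ < ρ) : DifferentiableAt ℂ (fun u => f (joukowski u)) u :=
  (hf.differentiableAt (isOpen_region ρ) (joukowski_mem_region h1.le h2)).comp u
    (differentiableAt_joukowski (norm_pos_iff.mp (by linarith)))

theorem continuous_comp_joukowski_circleMap (hf : DiffContOnCl ℂ f (region ρ)) (hρ : 1 < ρ) :
    Continuous fun θ => f (joukowski (circleMap 0 ρ θ)) :=
  (continuousOn_comp_joukowski hf hρ).comp_continuous (continuous_circleMap 0 ρ)
    (circleMap_mem_annulus hρ.le)

theorem norm_circleMap_of_pos (hρ : 0 < ρ) (θ : ℝ) : ‖circleMap 0 ρ θ‖ = ρ := by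
  rw [norm_circleMap_zero, abs_of_pos hρ]

theorem continuous_circleMap_inv_of_pos (hρ : 0 < ρ) : Continuous fun θ => (circleMap 0 ρ θ)⁻¹ :=
  (continuous_circleMap 0 ρ).inv₀ fun _ => circleMap_ne_center hρ.ne'

theorem norm_le_maxOn (hf : DiffContOnCl ℂ f (region ρ)) (hρ : 1 < ρ) (hu : ‖u‖ = ρ) :
    ‖f (joukowski u)‖ ≤ maxOn f ρ := by
  refine le_csSup ?_ ⟨_, ⟨u, hu, rfl⟩, rfl⟩
  have hsub : Metric.sphere (0 : ℂ) ρ ⊆ annulus ρ := fun v hv => by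
    rw [mem_sphere_zero_iff_norm] at hv
    exact ⟨by linarith, hv.le⟩
  rw [ellipse_eq_image, image_image]
  exact (isCompact_sphere (0 : ℂ) ρ).bddAbove_image
    ((continuousOn_comp_joukowski hf hρ).mono hsub).norm

theorem maxOn_nonneg (f : ℂ → ℂ) (ρ : ℝ) : 0 ≤ maxOn f ρ := by
  refine Real.sSup_nonneg ?_
  rintro _ ⟨z, -, rfl⟩
  exact norm_nonneg _

theorem integral_circleMap_eq_of_annulus (hρ : 1 < ρ) {F : ℂ → ℂ} (hc : ContinuousOn F (annulus ρ))
    (hd : ∀ u : ℂ, 1 < ‖u‖ → ‖u‖ < ρ → DifferentiableAt ℂ F u) :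
    ∫ θ in (0 : ℝ)..2 * π, F (circleMap 0 ρ θ) = ∫ θ in (0 : ℝ)..2 * π, F (circleMap 0 1 θ) := by
  have hset : Metric.closedBall (0 : ℂ) ρ \ Metric.ball 0 1 = annulus ρ := by
    ext u
    simp [annulus, and_comm]
  have h := Complex.circleIntegral_sub_center_inv_smul_eq_of_differentiable_on_annulus_off_countable
    (c := 0) one_pos hρ.le (f := F) (s := ∅) countable_empty (hset ▸ hc) fun z hz =>
      hd z (by simpa using hz.1.2) (by simpa using hz.1.1)
  have hcircle (R : ℝ) (hR : R ≠ 0) : circleIntegral (fun z => (z - 0)⁻¹ • F z) 0 R =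
      Complex.I * ∫ θ in (0 : ℝ)..2 * π, F (circleMap 0 R θ) := by
    rw [circleIntegral, ← intervalIntegral.integral_const_mul]
    refine intervalIntegral.integral_congr fun θ _ => ?_
    have : circleMap 0 R θ ≠ 0 := circleMap_ne_center hR
    simp only [deriv_circleMap, smul_eq_mul, sub_zero]
    field_simp
  rw [hcircle ρ (by linarith), hcircle 1 one_ne_zero] at h
  exact mul_left_cancel₀ Complex.I_ne_zero h

/-! ### Laurent coefficients -/

/-- The coefficient of `u ^ m` in the Laurent expansion of `f (joukowski u)`, as an integral over
the circle `|u| = ρ`. -/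
def laurentCoeff (f : ℂ → ℂ) (ρ : ℝ) (m : ℕ) : ℂ :=
  (2 * π : ℂ)⁻¹ * ∫ θ in (0 : ℝ)..2 * π,
    f (joukowski (circleMap 0 ρ θ)) * (circleMap 0 ρ θ)⁻¹ ^ m

theorem laurentCoeff_eq_laurentCoeff_one (hf : DiffContOnCl ℂ f (region ρ)) (hρ : 1 < ρ) (m : ℕ) :
    laurentCoeff f ρ m = laurentCoeff f 1 m := by
  rw [laurentCoeff, laurentCoeff]
  congr 1
  refine integral_circleMap_eq_of_annulus hρ (F := fun u => f (joukowski u) * u⁻¹ ^ m) ?_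
    fun u h1 h2 => ?_
  · exact (continuousOn_comp_joukowski hf hρ).mul
      ((continuousOn_inv₀.mono fun u => ne_zero_of_mem_annulus).pow m)
  · exact (differentiableAt_comp_joukowski hf h1 h2).mul
      ((differentiableAt_inv (norm_pos_iff.mp (by linarith))).pow m)

theorem norm_inv_two_pi : ‖(2 * π : ℂ)⁻¹‖ = (2 * π)⁻¹ := by
  rw [norm_inv, norm_mul, Complex.norm_real, Real.norm_of_nonneg Real.pi_pos.le,
    Complex.norm_ofNat]

theorem norm_laurentCoeff_le (hf : DiffContOnCl ℂ f (region ρ)) (hρ : 1 < ρ) (m : ℕ) :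
    ‖laurentCoeff f ρ m‖ ≤ maxOn f ρ * ρ⁻¹ ^ m := by
  have hρ0 : 0 < ρ := by linarith
  have h := intervalIntegral.norm_integral_le_of_norm_le_const (a := 0) (b := 2 * π)
    (f := fun θ => f (joukowski (circleMap 0 ρ θ)) * (circleMap 0 ρ θ)⁻¹ ^ m)
    (C := maxOn f ρ * ρ⁻¹ ^ m) fun θ _ => by
      have hnorm := norm_circleMap_of_pos hρ0 θ
      rw [norm_mul, norm_pow, norm_inv, hnorm]
      exact mul_le_mul_of_nonneg_right (norm_le_maxOn hf hρ hnorm) (by positivity)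
  rw [sub_zero, abs_of_pos Real.two_pi_pos] at h
  rw [laurentCoeff, norm_mul, norm_inv_two_pi, inv_mul_le_iff₀ Real.two_pi_pos]
  linarith

theorem ellipseLength_eq (hρ : 0 < ρ) : ellipseLength ρ =
    ρ / 2 * ∫ θ in (0 : ℝ)..2 * π, ‖1 - (circleMap 0 ρ θ)⁻¹ ^ 2‖ := by
  rw [ellipseLength, ← intervalIntegral.integral_const_mul]
  refine intervalIntegral.integral_congr fun θ _ => ?_
  have h0 : circleMap 0 ρ θ ≠ 0 := circleMap_ne_center hρ.ne'
  have hJ : HasDerivAt joukowski ((1 + -(circleMap 0 ρ θ ^ 2)⁻¹) / 2) (circleMap 0 ρ θ) :=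
    ((hasDerivAt_id _).add (hasDerivAt_inv h0)).div_const 2
  have hderiv : deriv (fun t => joukowski (circleMap 0 ρ t)) θ = _ :=
    (hJ.comp θ (hasDerivAt_circleMap 0 ρ θ)).deriv
  simp only [hderiv, norm_mul, norm_div, norm_circleMap_of_pos hρ, Complex.norm_I,
    Complex.norm_ofNat, mul_one, inv_pow, ← sub_eq_add_neg]
  ring

theorem ellipseLength_nonneg (hρ : 0 < ρ) : 0 ≤ ellipseLength ρ := by
  rw [ellipseLength_eq hρ]
  exact mul_nonneg (by linarith)
    (intervalIntegral.integral_nonneg Real.two_pi_pos.le fun _ _ => norm_nonneg _)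

end Annulus

/-! ### Chebyshev expansions -/

section Fourier

theorem fourier_two_pi_apply [Fact (0 < 2 * π)] (n : ℤ) (θ : ℝ) :
    fourier n (θ : AddCircle (2 * π)) = Complex.exp (n * (θ * Complex.I)) := by
  have hπ : (π : ℂ) ≠ 0 := Complex.ofReal_ne_zero.mpr Real.pi_ne_zero
  rw [fourier_coe_apply]
  congr 1
  push_cast
  field_simp

theorem fourierCoeff_neg_of_even {T : ℝ} [Fact (0 < T)] {F : AddCircle T → ℂ} (hF : F.Even)
    (n : ℤ) : fourierCoeff F (-n) = fourierCoeff F n := by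
  rw [fourierCoeff, ← MeasureTheory.integral_neg_eq_self]
  simp only [fourierCoeff, hF _, fourier_apply, neg_neg, smul_neg, neg_smul]

theorem hasSum_fourierCoeff_mul_cos [Fact (0 < 2 * π)] {F : C(AddCircle (2 * π), ℂ)}
    (hF : (F : AddCircle (2 * π) → ℂ).Even) (hs : Summable fun m : ℕ => fourierCoeff F m) (θ : ℝ) :
    HasSum (fun m : ℕ => 2 * fourierCoeff F m * (Real.cos (m * θ) : ℂ))
      (F θ + fourierCoeff F 0) := by
  have hsZ : Summable (fourierCoeff F) := by
    rw [summable_int_iff_summable_nat_and_neg]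
    simp only [fourierCoeff_neg_of_even hF]
    exact ⟨hs, hs⟩
  have h := (has_pointwise_sum_fourier_series_of_summable hsZ (θ : AddCircle (2 * π))).nat_add_neg
  simp only [fourierCoeff_neg_of_even hF, fourier_two_pi_apply, smul_eq_mul, Int.cast_zero,
    zero_mul, Complex.exp_zero, mul_one] at h
  refine h.congr_fun fun m => ?_
  rw [Complex.ofReal_cos, Complex.cos]
  push_cast
  simp only [mul_assoc, neg_mul]
  ring

end Fourier

section ChebyshevExpansion

open Polynomial.Chebyshev

variable {f : ℂ → ℂ} {ρ : ℝ}

theorem continuous_comp_cos (hf : DiffContOnCl ℂ f (region ρ)) (hρ : 1 < ρ) :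
    Continuous fun θ : Real.Angle => f (Real.Angle.cos θ : ℝ) := by
  refine hf.continuousOn.comp_continuous
    (Complex.continuous_ofReal.comp Real.Angle.continuous_cos) fun θ => ?_
  induction θ using Real.Angle.induction_on with
  | _ θ =>
    rw [Real.Angle.cos_coe, ← joukowski_circleMap_one]
    exact joukowski_mem_closure_region hρ
      ⟨(norm_circleMap_of_pos one_pos θ).ge, (norm_circleMap_of_pos one_pos θ).trans_le hρ.le⟩

theorem fourierCoeff_comp_cos [Fact (0 < 2 * π)] (f : ℂ → ℂ) (m : ℕ) :
    fourierCoeff (T := 2 * π) (fun θ => f (Real.Angle.cos θ : ℝ)) m = laurentCoeff f 1 m := by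
  rw [fourierCoeff_eq_intervalIntegral _ _ 0, laurentCoeff, zero_add, Complex.real_smul]
  congr 1
  · push_cast
    rw [one_div]
  refine intervalIntegral.integral_congr fun θ _ => ?_
  have hcos : Real.Angle.cos (θ : AddCircle (2 * π)) = Real.cos θ := Real.Angle.cos_coe θ
  simp only [hcos, ← joukowski_circleMap_one, fourier_two_pi_apply, circleMap_zero]
  rw [smul_eq_mul, mul_comm, Complex.ofReal_one, one_mul, ← Complex.exp_neg, ← Complex.exp_nat_mul]
  push_cast
  ring_nf

theorem summable_laurentCoeff (hf : DiffContOnCl ℂ f (region ρ)) (hρ : 1 < ρ) :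
    Summable (laurentCoeff f ρ) :=
  .of_norm_bounded ((summable_geometric_of_lt_one (inv_nonneg.mpr (by linarith))
    (inv_lt_one_of_one_lt₀ hρ)).mul_left _) (norm_laurentCoeff_le hf hρ)

theorem hasSum_laurentCoeff_mul_chebyshevT (hf : DiffContOnCl ℂ f (region ρ)) (hρ : 1 < ρ) {x : ℝ}
    (hx : x ∈ Icc (-1 : ℝ) 1) :
    HasSum (fun m : ℕ => 2 * laurentCoeff f ρ m * ((T ℝ m).eval x : ℝ))
      (f x + laurentCoeff f ρ 0) := by
  have : Fact (0 < 2 * π) := ⟨Real.two_pi_pos⟩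
  let F : C(AddCircle (2 * π), ℂ) := ⟨_, continuous_comp_cos hf hρ⟩
  have hF : (F : AddCircle (2 * π) → ℂ).Even := fun θ =>
    congrArg (fun t : ℝ => f t) (Real.Angle.cos_neg θ)
  have hcoeff (m : ℕ) : fourierCoeff F m = laurentCoeff f ρ m := by
    rw [laurentCoeff_eq_laurentCoeff_one hf hρ]
    exact fourierCoeff_comp_cos f m
  have h := hasSum_fourierCoeff_mul_cos hF
    (by simpa only [hcoeff] using summable_laurentCoeff hf hρ) (Real.arccos x)
  have hFx : F (Real.arccos x : AddCircle (2 * π)) = f x := by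
    change f (Real.Angle.cos (Real.arccos x : Real.Angle) : ℝ) = f x
    rw [Real.Angle.cos_coe, Real.cos_arccos hx.1 hx.2]
  have hT (m : ℕ) : Real.cos (m * Real.arccos x) = (T ℝ m).eval x := by
    conv_rhs => rw [← Real.cos_arccos hx.1 hx.2, T_real_cos, Int.cast_natCast]
  simpa only [← Nat.cast_zero (R := ℤ), hcoeff, hFx, hT] using h

theorem eval_chebyshevU_add_two (m : ℕ) (x : ℝ) :
    (U ℝ (m + 2 : ℕ)).eval x = 2 * (T ℝ (m + 2 : ℕ)).eval x + (U ℝ m).eval x := by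
  have h := congrArg (Polynomial.eval x) (U_eq_two_mul_T_add_U ℝ (m : ℤ))
  simpa using h

theorem abs_eval_chebyshevU_le (m : ℕ) {x : ℝ} (hx : x ∈ Icc (-1 : ℝ) 1) :
    |(U ℝ m).eval x| ≤ m + 1 := by
  induction m using Nat.twoStepInduction with
  | zero => simp
  | one =>
    have := abs_le.mpr hx
    simp [abs_mul]
    linarith
  | more m ih _ =>
    have hT := abs_eval_T_real_le_one ((m + 2 : ℕ) : ℤ) (abs_le.mpr hx)
    rw [eval_chebyshevU_add_two]
    refine (abs_add_le _ _).trans ?_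
    rw [abs_mul, abs_two]
    push_cast
    push_cast at hT
    linarith

/-- The coefficients of the expansion of `f` in Chebyshev polynomials of the second kind. -/
def chebyshevCoeff (f : ℂ → ℂ) (ρ : ℝ) (m : ℕ) : ℂ := laurentCoeff f ρ m - laurentCoeff f ρ (m + 2)

theorem norm_chebyshevCoeff_le (hf : DiffContOnCl ℂ f (region ρ)) (hρ : 1 < ρ) (m : ℕ) :
    ‖chebyshevCoeff f ρ m‖ ≤ 2 * maxOn f ρ * ρ⁻¹ ^ m := by
  have hmono : maxOn f ρ * ρ⁻¹ ^ (m + 2) ≤ maxOn f ρ * ρ⁻¹ ^ m :=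
    mul_le_mul_of_nonneg_left (pow_le_pow_of_le_one (inv_nonneg.mpr (by linarith))
      (inv_lt_one_of_one_lt₀ hρ).le (by omega)) (maxOn_nonneg f ρ)
  refine (norm_sub_le _ _).trans ?_
  linarith [norm_laurentCoeff_le hf hρ m, norm_laurentCoeff_le hf hρ (m + 2)]

theorem summable_laurentCoeff_mul_chebyshevU (hf : DiffContOnCl ℂ f (region ρ)) (hρ : 1 < ρ)
    {x : ℝ} (hx : x ∈ Icc (-1 : ℝ) 1) :
    Summable fun m : ℕ => laurentCoeff f ρ m * ((U ℝ m).eval x : ℝ) := by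
  have hρ0 : 0 ≤ ρ⁻¹ := inv_nonneg.mpr (by linarith)
  have hρ1 := inv_lt_one_of_one_lt₀ hρ
  have hmaj : Summable fun m : ℕ => maxOn f ρ * ((m : ℝ) ^ 1 * ρ⁻¹ ^ m + ρ⁻¹ ^ m) :=
    ((summable_pow_mul_geometric_of_norm_lt_one 1 (by rwa [Real.norm_of_nonneg hρ0])).add
      (summable_geometric_of_lt_one hρ0 hρ1)).mul_left _
  refine .of_norm_bounded hmaj fun m => ?_
  rw [norm_mul, Complex.norm_real, Real.norm_eq_abs]
  calc _ ≤ (maxOn f ρ * ρ⁻¹ ^ m) * (m + 1) :=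
        mul_le_mul (norm_laurentCoeff_le hf hρ m) (abs_eval_chebyshevU_le m hx) (abs_nonneg _)
          (mul_nonneg (maxOn_nonneg f ρ) (by positivity))
    _ = _ := by ring

theorem hasSum_chebyshevCoeff_mul_chebyshevU (hf : DiffContOnCl ℂ f (region ρ)) (hρ : 1 < ρ)
    {x : ℝ} (hx : x ∈ Icc (-1 : ℝ) 1) :
    HasSum (fun m : ℕ => chebyshevCoeff f ρ m * ((U ℝ m).eval x : ℝ)) (f x) := by
  obtain ⟨s, hs⟩ := summable_laurentCoeff_mul_chebyshevU hf hρ hx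
  have hT := (hasSum_nat_add_iff' 2).mpr (hasSum_laurentCoeff_mul_chebyshevT hf hρ hx)
  have h := hs.sub (((hasSum_nat_add_iff' 2).mpr hs).sub hT)
  convert! h using 1
  · ext m
    rw [eval_chebyshevU_add_two, chebyshevCoeff]
    push_cast
    ring
  · simp only [Finset.sum_range_succ, Finset.sum_range_zero, Nat.cast_zero, Nat.cast_one, U_zero,
      U_one, T_zero, T_one, Polynomial.eval_one, Polynomial.eval_X, Polynomial.eval_mul,
      Polynomial.eval_ofNat, Complex.ofReal_one, Complex.ofReal_mul, Complex.ofReal_ofNat]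
    ring

end ChebyshevExpansion

/-! ### Bounds for the Gegenbauer coefficients -/

theorem seriesCoeff_const_mul_pow {l : ℝ} (hl : -1 < l) (hl0 : l ≠ 0) (c v : ℂ) (k : ℕ) :
    seriesCoeff l (fun m => c * v ^ m) k =
      c * v ^ k * (((multichoose l k : ℝ) : ℂ)⁻¹ * connSeries l k (v ^ 2)) := by
  rw [seriesCoeff, connSeries, ← tsum_mul_left, ← tsum_mul_left]
  refine tsum_congr fun j => ?_
  rw [connCoeff_mul_eq hl hl0, pow_add, pow_mul]
  push_cast
  ring

/-- The density in the integral formula for the Chebyshev coefficients of `f` of the second kind: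
`f (joukowski u) * (1 - u⁻²)` at `u = ρ e^{iθ}`. -/
def chebyshevDensity (f : ℂ → ℂ) (ρ θ : ℝ) : ℂ :=
  f (joukowski (circleMap 0 ρ θ)) * (1 - (circleMap 0 ρ θ)⁻¹ ^ 2)

section ChebyshevDensity

variable {f : ℂ → ℂ} {ρ : ℝ}

theorem continuous_chebyshevDensity (hf : DiffContOnCl ℂ f (region ρ)) (hρ : 1 < ρ) :
    Continuous (chebyshevDensity f ρ) :=
  (continuous_comp_joukowski_circleMap hf hρ).mul
    (continuous_const.sub ((continuous_circleMap_inv_of_pos (one_pos.trans hρ)).pow 2))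

theorem norm_chebyshevDensity_le (hf : DiffContOnCl ℂ f (region ρ)) (hρ : 1 < ρ) (θ : ℝ) :
    ‖chebyshevDensity f ρ θ‖ ≤ maxOn f ρ * ‖1 - (circleMap 0 ρ θ)⁻¹ ^ 2‖ := by
  rw [chebyshevDensity, norm_mul]
  exact mul_le_mul_of_nonneg_right (norm_le_maxOn hf hρ (norm_circleMap_of_pos (by linarith) θ))
    (norm_nonneg _)

theorem norm_circleMap_inv_pow (hρ : 0 < ρ) (θ : ℝ) (n : ℕ) :
    ‖(circleMap 0 ρ θ)⁻¹ ^ n‖ = ρ⁻¹ ^ n := by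
  rw [norm_pow, norm_inv, norm_circleMap_of_pos hρ]

theorem norm_chebyshevDensity_mul_pow_le (hf : DiffContOnCl ℂ f (region ρ)) (hρ : 1 < ρ) (θ : ℝ)
    (m : ℕ) :
    ‖chebyshevDensity f ρ θ * (circleMap 0 ρ θ)⁻¹ ^ m‖ ≤ maxOn f ρ * 2 * ρ⁻¹ ^ m := by
  have hρ0 : 0 < ρ := one_pos.trans hρ
  have h2 : ‖1 - (circleMap 0 ρ θ)⁻¹ ^ 2‖ ≤ 2 := by
    refine (norm_sub_le _ _).trans ?_
    rw [norm_circleMap_inv_pow hρ0, norm_one]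
    linarith [pow_le_one₀ (n := 2) (inv_pos.mpr hρ0).le (inv_le_one_of_one_le₀ hρ.le)]
  rw [norm_mul, norm_circleMap_inv_pow hρ0]
  exact mul_le_mul_of_nonneg_right ((norm_chebyshevDensity_le hf hρ θ).trans
    (mul_le_mul_of_nonneg_left h2 (maxOn_nonneg f ρ))) (by positivity)

theorem chebyshevCoeff_eq_integral (hf : DiffContOnCl ℂ f (region ρ)) (hρ : 1 < ρ) (m : ℕ) :
    chebyshevCoeff f ρ m = (2 * π : ℂ)⁻¹ * ∫ θ in (0 : ℝ)..2 * π,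
      chebyshevDensity f ρ θ * (circleMap 0 ρ θ)⁻¹ ^ m := by
  have hcomp := continuous_comp_joukowski_circleMap hf hρ
  have hinv := continuous_circleMap_inv_of_pos (one_pos.trans hρ)
  rw [chebyshevCoeff, laurentCoeff, laurentCoeff, ← mul_sub, ← intervalIntegral.integral_sub]
  · congr 2
    ext θ
    rw [chebyshevDensity]
    ring
  · exact (hcomp.mul (hinv.pow m)).intervalIntegrable _ _
  · exact (hcomp.mul (hinv.pow (m + 2))).intervalIntegrable _ _

variable {l : ℝ}

theorem seriesCoeff_chebyshevCoeff_eq_integral (hf : DiffContOnCl ℂ f (region ρ)) (hρ : 1 < ρ)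
    (hl : -1 < l) (hl0 : l ≠ 0) (k : ℕ) :
    seriesCoeff l (chebyshevCoeff f ρ) k = (2 * π : ℂ)⁻¹ * ∫ θ in (0 : ℝ)..2 * π,
      chebyshevDensity f ρ θ * (circleMap 0 ρ θ)⁻¹ ^ k *
        (((multichoose l k : ℝ) : ℂ)⁻¹ * connSeries l k ((circleMap 0 ρ θ)⁻¹ ^ 2)) := by
  have hq0 : 0 ≤ ρ⁻¹ := by positivity
  have hq : ρ⁻¹ < 1 := inv_lt_one_of_one_lt₀ hρ
  set β : ℝ → ℕ → ℂ := fun θ m => chebyshevDensity f ρ θ * (circleMap 0 ρ θ)⁻¹ ^ m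
  have hbound : ∀ θ m, ‖β θ m‖ ≤ maxOn f ρ * 2 * ρ⁻¹ ^ m :=
    norm_chebyshevDensity_mul_pow_le hf hρ
  have hcont : ∀ m, Continuous fun θ => β θ m := fun m =>
    (continuous_chebyshevDensity hf hρ).mul
      ((continuous_circleMap_inv_of_pos (one_pos.trans hρ)).pow m)
  have hS : HasSum (fun j => ∫ θ in (0 : ℝ)..2 * π,
      β θ (k + 2 * j) * ((connCoeff l j (k + j) * (k + l) : ℝ) : ℂ))
      (∫ θ in (0 : ℝ)..2 * π, seriesCoeff l (β θ) k) :=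
    intervalIntegral.hasSum_integral_of_dominated_convergence
      (fun j _ => maxOn f ρ * 2 * (ρ⁻¹ ^ k * |multichoose l k|⁻¹) *
        (connMajorant l j * (ρ⁻¹ ^ 2) ^ j))
      (fun j => ((hcont _).mul continuous_const).aestronglyMeasurable)
      (fun j => .of_forall fun θ _ => norm_mul_connCoeff_le hl hl0 (hbound θ _))
      (.of_forall fun _ _ =>
        (summable_connMajorant_mul_pow l (by positivity) (by nlinarith)).mul_left _)
      intervalIntegrable_const
      (.of_forall fun θ _ => hasSum_seriesCoeff hl hl0 hq0 hq (hbound θ) k)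
  simp only [← seriesCoeff_const_mul_pow hl hl0]
  rw [seriesCoeff, ← (hS.mul_left _).tsum_eq]
  refine tsum_congr fun j => ?_
  rw [chebyshevCoeff_eq_integral hf hρ, intervalIntegral.integral_mul_const, mul_assoc]

theorem norm_seriesCoeff_chebyshevCoeff_le (hf : DiffContOnCl ℂ f (region ρ)) (hρ : 1 < ρ)
    (hl : -1 < l) (hl0 : l ≠ 0) (k : ℕ) {H : ℝ}
    (hH : ∀ w : ℂ, ‖w‖ ≤ 1 / ρ ^ 2 → ‖connSeries l k w‖ ≤ H) :
    ‖seriesCoeff l (chebyshevCoeff f ρ) k‖ ≤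
      maxOn f ρ * ellipseLength ρ / (π * ρ) * (|multichoose l k|⁻¹ * H) / ρ ^ k := by
  have hρ0 : 0 < ρ := one_pos.trans hρ
  have hpointwise : ∀ θ, ‖chebyshevDensity f ρ θ * (circleMap 0 ρ θ)⁻¹ ^ k *
      (((multichoose l k : ℝ) : ℂ)⁻¹ * connSeries l k ((circleMap 0 ρ θ)⁻¹ ^ 2))‖ ≤
      (maxOn f ρ * ρ⁻¹ ^ k * (|multichoose l k|⁻¹ * H)) * ‖1 - (circleMap 0 ρ θ)⁻¹ ^ 2‖ :=
    fun θ => by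
    have hw : ‖(circleMap 0 ρ θ)⁻¹ ^ 2‖ ≤ 1 / ρ ^ 2 := by
      rw [norm_circleMap_inv_pow hρ0, inv_pow, one_div]
    rw [norm_mul, norm_mul, norm_mul, norm_circleMap_inv_pow hρ0, norm_inv,
      Complex.norm_real, Real.norm_eq_abs]
    calc _ ≤ (maxOn f ρ * ‖1 - (circleMap 0 ρ θ)⁻¹ ^ 2‖) * ρ⁻¹ ^ k * (|multichoose l k|⁻¹ * H) :=
          mul_le_mul
            (mul_le_mul_of_nonneg_right (norm_chebyshevDensity_le hf hρ θ) (by positivity))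
            (mul_le_mul_of_nonneg_left (hH _ hw) (by positivity)) (by positivity)
            (mul_nonneg (mul_nonneg (maxOn_nonneg f ρ) (norm_nonneg _)) (by positivity))
      _ = _ := by ring
  have hcont : Continuous fun θ => ‖1 - (circleMap 0 ρ θ)⁻¹ ^ 2‖ :=
    (continuous_const.sub ((continuous_circleMap_inv_of_pos hρ0).pow 2)).norm
  rw [seriesCoeff_chebyshevCoeff_eq_integral hf hρ hl hl0, norm_mul, norm_inv_two_pi,
    inv_mul_le_iff₀ Real.two_pi_pos]
  refine (intervalIntegral.norm_integral_le_of_norm_le Real.two_pi_pos.le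
    (.of_forall fun θ _ => hpointwise θ)
    ((hcont.const_mul _).intervalIntegrable _ _)).trans_eq ?_
  rw [intervalIntegral.integral_const_mul, ellipseLength_eq hρ0, inv_pow]
  field_simp

end ChebyshevDensity

/-- The factor of `D l ρ f` that depends only on `l` and `ρ`. -/
def dFactor (l ρ : ℝ) : ℝ :=
  if l < 0 then
    |Real.Gamma l| * Real.Gamma (1 + l) * Real.Gamma (1 - 2 * l) / Real.Gamma (1 - l) *
      (1 - 1 / ρ ^ 2) ^ (2 * l - 1)
  else if l ≤ 1 then 1 / l * (1 - 1 / ρ ^ 2) ^ (l - 1)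
  else Real.Gamma l * (1 + 1 / ρ ^ 2) ^ (l - 1)

section CoefficientBound

variable {f : ℂ → ℂ} {ρ l : ℝ}

theorem inv_abs_gammaRatio_mul_norm_connSeries_le (hl : -1 < l) (hl0 : l ≠ 0) (hρ : 1 < ρ) {k : ℕ}
    (hk : 1 ≤ k) {w : ℂ} (hw : ‖w‖ ≤ 1 / ρ ^ 2) :
    |gammaRatio l k|⁻¹ * ‖connSeries l k w‖ ≤ dFactor l ρ := by
  have hr : 1 / ρ ^ 2 < 1 := (div_lt_one (by positivity)).mpr (by nlinarith)
  have hr0 : 0 ≤ 1 / ρ ^ 2 := by positivity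
  have hmajorant := norm_connSeries_le hl k hr hw
  rw [dFactor]
  split_ifs with hneg hle
  · have hratio : |gammaRatio l k|⁻¹ ≤ |Real.Gamma l| :=
      inv_le_of_inv_le₀ (abs_pos.mpr (Gamma_ne_zero_of_neg_one_lt hl hl0))
        (inv_abs_Gamma_le_abs_gammaRatio hl hneg hk)
    rw [tsum_connMajorant_of_neg hneg hr0 hr] at hmajorant
    refine (mul_le_mul hratio hmajorant (norm_nonneg _) (abs_nonneg _)).trans_eq ?_
    rw [gammaConst]
    ring
  · have hpos : 0 < l := lt_of_le_of_ne (not_lt.mp hneg) hl0.symm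
    rw [tsum_connMajorant_of_le_one hpos hle hr0 hr] at hmajorant
    rw [abs_of_pos (gammaRatio_pos hpos hk), one_div]
    exact mul_le_mul (inv_anti₀ hpos (le_gammaRatio hpos hle hk)) hmajorant (norm_nonneg _)
      (inv_nonneg.mpr hpos.le)
  · have hpos : 0 < l := lt_of_le_of_ne (not_lt.mp hneg) hl0.symm
    have hΓ := Real.Gamma_pos_of_pos hpos
    rw [abs_of_pos (gammaRatio_pos hpos hk)]
    exact mul_le_mul (inv_le_of_inv_le₀ hΓ (inv_Gamma_le_gammaRatio (not_le.mp hle).le hk))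
      (norm_connSeries_le_of_one_le (not_le.mp hle).le k hr hw) (norm_nonneg _) hΓ.le

theorem dFactor_nonneg (hl : -1 < l) (hl0 : l ≠ 0) (hρ : 1 < ρ) : 0 ≤ dFactor l ρ :=
  le_trans (by positivity) (inv_abs_gammaRatio_mul_norm_connSeries_le hl hl0 hρ le_rfl
    (w := 0) (by rw [norm_zero]; positivity))

theorem maxOn_mul_ellipseLength_nonneg (f : ℂ → ℂ) (hρ : 0 < ρ) :
    0 ≤ maxOn f ρ * ellipseLength ρ / (π * ρ) :=
  div_nonneg (mul_nonneg (maxOn_nonneg f ρ) (ellipseLength_nonneg hρ)) (by positivity)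

theorem D_nonneg (f : ℂ → ℂ) (hρ : 1 < ρ) (hl : -1 < l) (hl0 : l ≠ 0) : 0 ≤ D l ρ f :=
  mul_nonneg (maxOn_mul_ellipseLength_nonneg f (one_pos.trans hρ)) (dFactor_nonneg hl hl0 hρ)

theorem norm_seriesCoeff_chebyshevCoeff_le_D (hf : DiffContOnCl ℂ f (region ρ)) (hρ : 1 < ρ)
    (hl : -1 < l) (hl0 : l ≠ 0) {k : ℕ} (hk : 1 ≤ k) :
    ‖seriesCoeff l (chebyshevCoeff f ρ) k‖ ≤ D l ρ f * ((k : ℝ) ^ (1 - l) / ρ ^ k) := by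
  have hratio : 0 < |gammaRatio l k| := by
    obtain ⟨m, _, hm, _, h⟩ := exists_abs_gammaRatio_bounds hl hl0
    exact hm.trans_le (h k hk).1
  have hH : ∀ w : ℂ, ‖w‖ ≤ 1 / ρ ^ 2 → ‖connSeries l k w‖ ≤ |gammaRatio l k| * dFactor l ρ :=
    fun w hw => (inv_mul_le_iff₀ hratio).mp
      (inv_abs_gammaRatio_mul_norm_connSeries_le hl hl0 hρ hk hw)
  refine (norm_seriesCoeff_chebyshevCoeff_le hf hρ hl hl0 k hH).trans_eq ?_
  rw [abs_multichoose_eq_gammaRatio_mul l hk, mul_inv,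
    ← Real.rpow_neg (Nat.cast_nonneg k), neg_sub, D, ← dFactor]
  field_simp

theorem hasSum_err (hf : DiffContOnCl ℂ f (region ρ)) (hρ : 1 < ρ) (hl : -1 / 2 < l) (hl0 : l ≠ 0)
    (n : ℕ) {x : ℝ} (hx : x ∈ Icc (-1 : ℝ) 1) :
    HasSum (fun i => seriesCoeff l (chebyshevCoeff f ρ) (i + (n + 1)) *
      (poly l (i + (n + 1)) x : ℂ)) (err l n f x) :=
  hasSum_sub_proj hl hl0 (inv_nonneg.mpr (by linarith)) (inv_lt_one_of_one_lt₀ hρ)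
    (norm_chebyshevCoeff_le hf hρ) (g := fun t : ℝ => f t)
    (fun _ hx => hasSum_chebyshevCoeff_mul_chebyshevU hf hρ hx) n hx

/-! ### Upper bounds for the projection error -/

theorem supNorm_le {g : ℝ → ℂ} {c : ℝ} (h : ∀ x ∈ Icc (-1 : ℝ) 1, ‖g x‖ ≤ c) : supNorm g ≤ c := by
  refine csSup_le ⟨_, mem_image_of_mem _ (left_mem_Icc.mpr (by norm_num))⟩ ?_
  rintro _ ⟨x, hx, rfl⟩
  exact h x hx

theorem supNorm_err_le (hf : DiffContOnCl ℂ f (region ρ)) (hρ : 1 < ρ) (hl : -1 / 2 < l)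
    (hl0 : l ≠ 0) {n : ℕ} {E p T : ℝ} {b : ℕ → ℝ}
    (hE : ∀ k, n + 1 ≤ k → ∀ x ∈ Icc (-1 : ℝ) 1, |poly l k x| ≤ E * (k : ℝ) ^ p)
    (hb : ∀ i : ℕ, ((i + (n + 1) : ℕ) : ℝ) ^ (1 - l + p) / ρ ^ (i + (n + 1)) ≤ b i)
    (hT : HasSum b T) : supNorm (err l n f) ≤ D l ρ f * E * T := by
  have hD : 0 ≤ D l ρ f := D_nonneg f hρ (by linarith) hl0
  have hE0 : 0 ≤ E := nonneg_of_mul_nonneg_left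
    ((abs_nonneg _).trans (hE (n + 1) le_rfl 0 (by norm_num))) (by positivity)
  refine supNorm_le fun x hx => ?_
  rw [← (hasSum_err hf hρ hl hl0 n hx).tsum_eq]
  refine tsum_of_norm_bounded (hT.mul_left _) fun i => ?_
  refine le_trans ?_ (mul_le_mul_of_nonneg_left (hb i) (mul_nonneg hD hE0))
  set k := i + (n + 1)
  have hk : 1 ≤ k := by omega
  have hcoeff := norm_seriesCoeff_chebyshevCoeff_le_D hf hρ (by linarith) hl0 hk
  rw [norm_mul, Complex.norm_real, Real.norm_eq_abs, Real.rpow_add (by exact_mod_cast hk)]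
  calc _ ≤ (D l ρ f * ((k : ℝ) ^ (1 - l) / ρ ^ k)) * (E * (k : ℝ) ^ p) :=
        mul_le_mul hcoeff (hE k (by omega) x hx) (abs_nonneg _) ((norm_nonneg _).trans hcoeff)
    _ = _ := by ring

theorem supNorm_err_le_of_uniformBound (hf : DiffContOnCl ℂ f (region ρ)) (hρ : 1 < ρ)
    (hl : -1 / 2 < l) (hl0 : l ≠ 0) {C : ℝ} {N n : ℕ} (hC : UniformBound l C N)
    (hN : N ≤ n + 1) : supNorm (err l n f) ≤ D l ρ f * C / ((ρ - 1) * ρ ^ n) := by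
  have hρ0 : 0 < ρ := one_pos.trans hρ
  have hgeo := (hasSum_geometric_of_lt_one (inv_nonneg.mpr hρ0.le)
    (inv_lt_one_of_one_lt₀ hρ)).mul_left (ρ ^ (n + 1))⁻¹
  refine (supNorm_err_le hf hρ hl hl0 (fun k hk => hC k (by omega) (by omega))
    (fun i => le_of_eq ?_) hgeo).trans_eq ?_
  · rw [sub_add_sub_cancel, sub_self, Real.rpow_zero, pow_add, inv_pow]
    field_simp
  · have hρ1 : ρ - 1 ≠ 0 := by linarith
    have hsub : 1 - ρ⁻¹ = (ρ - 1) / ρ := by field_simp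
    rw [hsub, pow_succ]
    field_simp

theorem supNorm_err_le_of_pos (hf : DiffContOnCl ℂ f (region ρ)) (hρ : 1 < ρ) (hl : 0 < l)
    {n : ℕ} {E T : ℝ} {b : ℕ → ℝ} (hE : ∀ k, n + 1 ≤ k → gammaRatio (2 * l) k ≤ E)
    (hb : ∀ i : ℕ, ((i + (n + 1) : ℕ) : ℝ) ^ l / ρ ^ (i + (n + 1)) ≤ b i) (hT : HasSum b T) :
    supNorm (err l n f) ≤ D l ρ f * E * T := by
  refine supNorm_err_le hf hρ (by linarith) hl.ne' (p := 2 * l - 1) (fun k hk x hx => ?_)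
    (fun i => ?_) hT
  · refine (abs_poly_le hl k hx).trans ?_
    rw [multichoose_eq_gammaRatio_mul _ (by omega)]
    exact mul_le_mul_of_nonneg_right (hE k hk) (by positivity)
  · convert! hb i using 3
    ring

end CoefficientBound

section NegativeParameter

variable {l : ℝ}

theorem summable_abs_multichoose (hl : -1 < l) (hl0 : l < 0) :
    Summable fun i => |multichoose l i| := by
  obtain ⟨_, M, _, _, hM⟩ := exists_abs_multichoose_bounds hl hl0.ne
  refine Summable.of_norm_bounded_eventually_nat
    ((Real.summable_nat_rpow.mpr (by linarith : l - 1 < -1)).mul_left M) ?_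
  filter_upwards [eventually_ge_atTop 1] with i hi
  rw [Real.norm_eq_abs, abs_abs]
  exact (hM i hi).2

/-- In each product `multichoose l i * multichoose l j`, `i + j = k`, the larger index is at least
`k / 2`; the other factors are summable. -/
theorem exists_trigBound_le (hl : -1 < l) (hl0 : l < 0) :
    ∃ C : ℝ, 0 < C ∧ ∀ k : ℕ, 1 ≤ k → trigBound l k ≤ C * (k : ℝ) ^ (l - 1) := by
  obtain ⟨_, M, _, hM, hbound⟩ := exists_abs_multichoose_bounds hl hl0.ne
  set Z := ∑' i, |multichoose l i|
  have : 0 ≤ Z := tsum_nonneg fun _ => abs_nonneg _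
  refine ⟨M * 2⁻¹ ^ (l - 1) * (2 * Z + 1), by positivity, fun k hk => ?_⟩
  set A := M * 2⁻¹ ^ (l - 1) * (k : ℝ) ^ (l - 1) with hA
  have hA0 : 0 ≤ A := by positivity
  have hlarge : ∀ i : ℕ, k ≤ 2 * i → |multichoose l i| ≤ A := fun i hi => by
    refine (hbound i (by omega)).2.trans ?_
    rw [hA, mul_assoc, ← Real.mul_rpow (by norm_num) (Nat.cast_nonneg k)]
    refine mul_le_mul_of_nonneg_left
      (Real.rpow_le_rpow_of_nonpos (by positivity) ?_ (by linarith)) hM.le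
    have : (k : ℝ) ≤ 2 * i := by exact_mod_cast hi
    linarith
  have hproduct : ∀ p ∈ antidiagonal k, |multichoose l p.1| * |multichoose l p.2| ≤
      A * (|multichoose l p.1| + |multichoose l p.2|) := fun p hp => by
    have hp' := Finset.HasAntidiagonal.mem_antidiagonal.mp hp
    rcases le_total p.1 p.2 with h | h
    · nlinarith [mul_le_mul_of_nonneg_left (hlarge p.2 (by omega)) (abs_nonneg (multichoose l p.1)),
        mul_nonneg hA0 (abs_nonneg (multichoose l p.2))]
    · nlinarith [
        mul_le_mul_of_nonneg_right (hlarge p.1 (by omega)) (abs_nonneg (multichoose l p.2)),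
        mul_nonneg hA0 (abs_nonneg (multichoose l p.1))]
  have hsum : ∑ i ∈ Finset.range (k + 1), |multichoose l i| ≤ Z :=
    (summable_abs_multichoose hl hl0).sum_le_tsum _ fun _ _ => abs_nonneg _
  calc trigBound l k
      ≤ A * ∑ p ∈ antidiagonal k, (|multichoose l p.1| + |multichoose l p.2|) := by
        rw [Finset.mul_sum]
        exact Finset.sum_le_sum hproduct
    _ = A * (2 * ∑ i ∈ Finset.range (k + 1), |multichoose l i|) := by
        rw [Finset.sum_add_distrib, ← Finset.Nat.sum_antidiagonal_eq_sum_range_succ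
          (fun i _ => |multichoose l i|), two_mul]
        congr 2
        exact Finset.Nat.sum_antidiagonal_swap (f := fun p => |multichoose l p.1|)
    _ ≤ A * (2 * Z + 1) := mul_le_mul_of_nonneg_left (by linarith) hA0
    _ = _ := by ring

theorem exists_uniformBound (hl : -1 / 2 < l) (hl0 : l < 0) :
    ∃ C : ℝ, 0 < C ∧ UniformBound l C 1 := by
  obtain ⟨C, hC, h⟩ := exists_trigBound_le (by linarith) hl0
  exact ⟨C, hC, fun k hk _ x hx => (abs_poly_le_trigBound hl k hx).trans (h k hk)⟩

end NegativeParameter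

section Tail

variable {l ρ : ℝ} {n : ℕ}

theorem pow_add_eq_pow_mul_exp_log (hρ : 0 < ρ) (i n : ℕ) :
    ρ ^ (i + (n + 1)) = ρ ^ n * Real.exp ((i + 1) * Real.log ρ) := by
  rw [mul_comm _ (Real.log ρ), Real.exp_mul, Real.exp_log hρ, ← Nat.cast_add_one,
    Real.rpow_natCast, ← pow_add]
  congr 1
  ring

theorem exp_neg_mul_inv_one_sub_exp_neg_le {v : ℝ} (hv : 0 < v) :
    Real.exp (-v) * (1 - Real.exp (-v))⁻¹ ≤ v⁻¹ := by
  have hexp := Real.add_one_le_exp v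
  rw [Real.exp_neg, ← mul_inv]
  refine inv_anti₀ hv ?_
  rw [mul_sub, mul_one, mul_inv_cancel₀ (Real.exp_pos v).ne']
  linarith

theorem hasSum_geometric_exp_neg {v : ℝ} (hv : 0 < v) :
    HasSum (fun i : ℕ => Real.exp (-v) ^ i) (1 - Real.exp (-v))⁻¹ :=
  hasSum_geometric_of_lt_one (Real.exp_pos _).le (Real.exp_lt_one_iff.mpr (by linarith))

/-- Uses `(1 + (i + 1) / n) ^ l ≤ exp (l (i + 1) / n)`. -/
theorem rpow_div_pow_le_mul_exp (hl : 0 ≤ l) (hρ : 0 < ρ) (hn : 1 ≤ n) {v : ℝ}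
    (hv : l / n ≤ Real.log ρ - v) (i : ℕ) :
    ((i + (n + 1) : ℕ) : ℝ) ^ l / ρ ^ (i + (n + 1)) ≤
      (n : ℝ) ^ l / ρ ^ n * (Real.exp (-v) * Real.exp (-v) ^ i) := by
  have hn0 : (0 : ℝ) < n := by exact_mod_cast hn
  have hindex : ((i + (n + 1) : ℕ) : ℝ) = n * (1 + (i + 1) / n) := by
    push_cast; field_simp; ring
  have hgrowth : (1 + ((i : ℝ) + 1) / n) ^ l ≤ Real.exp ((i + 1) * (Real.log ρ - v)) := by
    calc _ ≤ Real.exp (((i : ℝ) + 1) / n) ^ l := by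
          refine Real.rpow_le_rpow (by positivity) ?_ hl
          linarith [Real.add_one_le_exp (((i : ℝ) + 1) / n)]
      _ = Real.exp ((i + 1) * (l / n)) := by rw [← Real.exp_mul]; congr 1; ring
      _ ≤ _ := Real.exp_le_exp.mpr (mul_le_mul_of_nonneg_left hv (by positivity))
  have hdecay : Real.exp (-v) * Real.exp (-v) ^ i =
      Real.exp ((i + 1) * (Real.log ρ - v)) / Real.exp ((i + 1) * Real.log ρ) := by
    rw [← Real.exp_nat_mul, ← Real.exp_add, ← Real.exp_sub]; congr 1; ring
  rw [hindex, Real.mul_rpow hn0.le (by positivity), pow_add_eq_pow_mul_exp_log hρ, hdecay,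
    mul_div_mul_comm]
  gcongr

theorem one_add_le_mul_exp_half (x : ℝ) : 1 + x ≤ 5 / 4 * Real.exp (x / 2) := by
  have hhalf : (8 / 5 : ℝ) ≤ Real.exp (1 / 2) := by
    have hsq : Real.exp (1 / 2) * Real.exp (1 / 2) = Real.exp 1 := by
      rw [← Real.exp_add]; norm_num
    nlinarith [Real.exp_one_gt_d9, Real.exp_pos (1 / 2)]
  have hsplit : Real.exp (x / 2) = Real.exp (1 / 2) * Real.exp ((x - 1) / 2) := by
    rw [← Real.exp_add]; congr 1; ring
  rw [hsplit]
  nlinarith [Real.add_one_le_exp ((x - 1) / 2),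
    mul_le_mul_of_nonneg_right hhalf (Real.exp_pos ((x - 1) / 2)).le]

/-- Uses `(1 + i / (n + 1)) ^ l ≤ (1 + i log ρ / l) ^ l ≤ (5 / 4) ^ l * exp (i log ρ / 2)`. -/
theorem rpow_div_pow_le_mul_exp_half (hl : 0 < l) (hρ : 1 < ρ) (hn : 1 ≤ n)
    (hln : l ≤ (n + 1) * Real.log ρ) (i : ℕ) :
    ((i + (n + 1) : ℕ) : ℝ) ^ l / ρ ^ (i + (n + 1)) ≤
      (5 / 2) ^ l * ((n : ℝ) ^ l / ρ ^ n) *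
        (Real.exp (-Real.log ρ) * Real.exp (-(Real.log ρ / 2)) ^ i) := by
  set s := Real.log ρ
  have hs : 0 < s := Real.log_pos hρ
  have hn1 : (1 : ℝ) ≤ n := by exact_mod_cast hn
  have hindex : ((i + (n + 1) : ℕ) : ℝ) = (n + 1) * (1 + i / (n + 1)) := by
    push_cast; field_simp; ring
  have hgrowth : (1 + (i : ℝ) / (n + 1)) ^ l ≤ (5 / 4) ^ l * Real.exp (i * s / 2) := by
    calc _ ≤ (1 + i * s / l) ^ l := by
          refine Real.rpow_le_rpow (by positivity) ?_ hl.le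
          gcongr 1 + ?_
          rw [div_le_div_iff₀ (by positivity) hl, mul_assoc, mul_comm s]
          gcongr
      _ ≤ (5 / 4 * Real.exp (i * s / l / 2)) ^ l :=
          Real.rpow_le_rpow (by positivity) (one_add_le_mul_exp_half _) hl.le
      _ = _ := by
          rw [Real.mul_rpow (by norm_num) (Real.exp_pos _).le, ← Real.exp_mul]
          congr 2; field_simp
  have hbase : ((n : ℝ) + 1) ^ l ≤ 2 ^ l * (n : ℝ) ^ l := by
    rw [← Real.mul_rpow (by norm_num) (by linarith)]
    exact Real.rpow_le_rpow (by positivity) (by linarith) hl.le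
  have hdecay : Real.exp (-s) * Real.exp (-(s / 2)) ^ i =
      Real.exp (i * s / 2) / Real.exp ((i + 1) * s) := by
    rw [← Real.exp_nat_mul, ← Real.exp_add, ← Real.exp_sub]; congr 1; ring
  have hconst : (5 / 2 : ℝ) ^ l = 2 ^ l * (5 / 4) ^ l := by
    rw [← Real.mul_rpow (by norm_num) (by norm_num)]; norm_num
  rw [hindex, Real.mul_rpow (by positivity) (by positivity),
    pow_add_eq_pow_mul_exp_log (one_pos.trans hρ), hdecay, hconst]
  calc _ ≤ (2 ^ l * (n : ℝ) ^ l) * ((5 / 4) ^ l * Real.exp (i * s / 2)) /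
        (ρ ^ n * Real.exp ((i + 1) * s)) := by gcongr
    _ = _ := by ring

end Tail

section PositiveParameter

variable {f : ℂ → ℂ} {ρ l : ℝ} {n : ℕ} {E : ℝ}

theorem nonneg_of_gammaRatio_le (hl : 0 < l) (hE : ∀ k, n + 1 ≤ k → gammaRatio (2 * l) k ≤ E) :
    0 ≤ E :=
  (gammaRatio_pos (by linarith) (by omega)).le.trans (hE (n + 1) le_rfl)

theorem supNorm_err_le_asymptotic (hf : DiffContOnCl ℂ f (region ρ)) (hρ : 1 < ρ) (hl : 0 < l)
    (hn : 1 ≤ n) {ε : ℝ} (hε : 0 < ε) (hnε : l * (1 + ε) / ε ≤ n * Real.log ρ)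
    (hE : ∀ k, n + 1 ≤ k → gammaRatio (2 * l) k ≤ E) :
    supNorm (err l n f) ≤ (1 + ε) * (D l ρ f / Real.log ρ) * E * ((n : ℝ) ^ l / ρ ^ n) := by
  have hs : 0 < Real.log ρ := Real.log_pos hρ
  have hn0 : (0 : ℝ) < n := by exact_mod_cast hn
  have hD : 0 ≤ D l ρ f := D_nonneg f hρ (by linarith) hl.ne'
  have hE0 : 0 ≤ E := nonneg_of_gammaRatio_le hl hE
  set v := Real.log ρ / (1 + ε) with hv
  have hv0 : 0 < v := by positivity
  have hln : l / n ≤ Real.log ρ - v := by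
    have hsub : Real.log ρ - v = Real.log ρ * ε / (1 + ε) := by rw [hv]; field_simp; ring
    rw [hsub, div_le_div_iff₀ hn0 (by positivity)]
    rw [div_le_iff₀ hε] at hnε
    linarith
  have hgeo := ((hasSum_geometric_exp_neg hv0).mul_left (Real.exp (-v))).mul_left
    ((n : ℝ) ^ l / ρ ^ n)
  calc supNorm (err l n f)
      ≤ D l ρ f * E * ((n : ℝ) ^ l / ρ ^ n * (Real.exp (-v) * (1 - Real.exp (-v))⁻¹)) :=
        supNorm_err_le_of_pos hf hρ hl hE
          (rpow_div_pow_le_mul_exp hl.le (one_pos.trans hρ) hn hln) hgeo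
    _ ≤ D l ρ f * E * ((n : ℝ) ^ l / ρ ^ n * v⁻¹) := by
        gcongr
        exact exp_neg_mul_inv_one_sub_exp_neg_le hv0
    _ = _ := by rw [hv, inv_div]; ring

theorem supNorm_err_le_absolute (hf : DiffContOnCl ℂ f (region ρ)) (hρ : 1 < ρ) (hl : 0 < l)
    (hn : 1 ≤ n) (hnl : ⌊l / Real.log ρ⌋₊ ≤ n)
    (hE : ∀ k, n + 1 ≤ k → gammaRatio (2 * l) k ≤ E) :
    supNorm (err l n f) ≤
      2 * (5 / 2) ^ l * (D l ρ f / Real.log ρ) * E * ((n : ℝ) ^ l / ρ ^ n) := by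
  have hD : 0 ≤ D l ρ f := D_nonneg f hρ (by linarith) hl.ne'
  have hE0 : 0 ≤ E := nonneg_of_gammaRatio_le hl hE
  set s := Real.log ρ
  have hs0 : 0 < s := Real.log_pos hρ
  have hln : l ≤ (n + 1) * s := by
    have h : l / s < n + 1 :=
      (Nat.lt_floor_add_one _).trans_le (by exact_mod_cast Nat.succ_le_succ hnl)
    exact ((div_lt_iff₀ hs0).mp h).le
  have hgeo := ((hasSum_geometric_exp_neg (half_pos hs0)).mul_left (Real.exp (-s))).mul_left
    ((5 / 2) ^ l * ((n : ℝ) ^ l / ρ ^ n))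
  have hhalf : Real.exp (-(s / 2)) ≤ 1 := Real.exp_le_one_iff.mpr (by linarith)
  have htotal : Real.exp (-s) * (1 - Real.exp (-(s / 2)))⁻¹ ≤ 2 / s := by
    rw [show -s = -(s / 2) + -(s / 2) by ring, Real.exp_add, mul_assoc]
    refine (mul_le_of_le_one_left ?_ hhalf).trans
      ((exp_neg_mul_inv_one_sub_exp_neg_le (half_pos hs0)).trans_eq (inv_div s 2))
    exact mul_nonneg (Real.exp_pos _).le (inv_nonneg.mpr (sub_nonneg.mpr hhalf))
  calc supNorm (err l n f)
      ≤ D l ρ f * E * ((5 / 2) ^ l * ((n : ℝ) ^ l / ρ ^ n) *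
          (Real.exp (-s) * (1 - Real.exp (-(s / 2)))⁻¹)) :=
        supNorm_err_le_of_pos hf hρ hl hE (rpow_div_pow_le_mul_exp_half hl hρ hn hln) hgeo
    _ ≤ D l ρ f * E * ((5 / 2) ^ l * ((n : ℝ) ^ l / ρ ^ n) * (2 / s)) := by gcongr
    _ = _ := by ring

/-- The factor of `K c l ρ f` that depends only on `l`. -/
def kFactor (l : ℝ) : ℝ := if l ≤ 1 / 2 then 1 / Real.Gamma (2 * l) else 2 * l

theorem gammaRatio_le_kFactor (hl : 0 < l) {k : ℕ} (hk : 1 ≤ k) :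
    gammaRatio (2 * l) k ≤ kFactor l := by
  rw [kFactor]
  split_ifs with h
  · rw [one_div]
    exact gammaRatio_le_inv_Gamma (by linarith) (by linarith) hk
  · exact (antitoneOn_gammaRatio (by linarith) (mem_Ici.mpr le_rfl) hk hk).trans_eq
      (gammaRatio_one _)

theorem gammaRatio_two (a : ℝ) : gammaRatio a 2 = a * (a + 1) * 2 ^ (-a) := by
  have hchoose : multichoose a 2 = a * (a + 1) / 2 := by
    have h := multichoose_succ_mul a 1
    rw [Ring.multichoose_one_right] at h
    push_cast at h
    linarith
  rw [gammaRatio, hchoose, sub_eq_neg_add]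
  push_cast
  rw [Real.rpow_add two_pos, Real.rpow_one]
  ring

theorem two_mul_add_one_mul_rpow_le (hl : 0 ≤ l) : (2 * l + 1) * (5 / 8 : ℝ) ^ l ≤ 6 := by
  have hexp : (5 / 8 : ℝ) ^ l ≤ Real.exp (-(3 / 8 * l)) := by
    rw [← neg_mul, Real.exp_mul]
    exact Real.rpow_le_rpow (by norm_num) (by linarith [Real.add_one_le_exp (-(3 / 8 : ℝ))]) hl
  calc _ ≤ (2 * l + 1) * Real.exp (-(3 / 8 * l)) := by gcongr
    _ ≤ 6 := by
      rw [Real.exp_neg, ← div_eq_mul_inv, div_le_iff₀ (Real.exp_pos _)]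
      linarith [Real.add_one_le_exp (3 / 8 * l)]

/-- For `l > 1/2` the factor `(5/2)^l` is compensated by `gammaRatio (2 * l) 2`, which is
`2l (2l + 1) / 4^l`. -/
theorem exists_gammaRatio_le_kFactor (hl : 0 < l) :
    ∃ E, (∀ k, 2 ≤ k → gammaRatio (2 * l) k ≤ E) ∧ 2 * (5 / 2) ^ l * E ≤ 12 * kFactor l := by
  rcases le_or_gt l (1 / 2) with h | h
  · refine ⟨_, fun k hk => gammaRatio_le_kFactor hl (by omega), ?_⟩
    have hrpow : (5 / 2 : ℝ) ^ l ≤ 5 / 2 :=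
      Real.rpow_le_self_of_one_le (by norm_num) (by linarith)
    refine mul_le_mul_of_nonneg_right (by linarith) ?_
    exact (gammaRatio_pos (by linarith) le_rfl).le.trans (gammaRatio_le_kFactor hl le_rfl)
  · refine ⟨gammaRatio (2 * l) 2, fun k hk => antitoneOn_gammaRatio (by linarith)
      (by norm_num) (mem_Ici.mpr (by omega)) hk, ?_⟩
    have hrpow : (5 / 2 : ℝ) ^ l * 2 ^ (-(2 * l)) = (5 / 8) ^ l := by
      rw [← mul_neg, Real.rpow_mul two_pos.le, Real.rpow_neg (by norm_num),
        ← Real.inv_rpow (by norm_num), ← Real.mul_rpow (by norm_num) (by norm_num)]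
      norm_num
    rw [gammaRatio_two, kFactor, if_neg (not_le.mpr h)]
    calc _ = 2 * (2 * l) * ((2 * l + 1) * ((5 / 2 : ℝ) ^ l * 2 ^ (-(2 * l)))) := by ring
      _ ≤ 2 * (2 * l) * 6 := by
          rw [hrpow]
          exact mul_le_mul_of_nonneg_left (two_mul_add_one_mul_rpow_le hl.le) (by linarith)
      _ = _ := by ring

theorem K_eq (c l ρ : ℝ) (f : ℂ → ℂ) : K c l ρ f = c * (D l ρ f / Real.log ρ) * kFactor l := rfl

theorem supNorm_err_le_K (hf : DiffContOnCl ℂ f (region ρ)) (hρ : 1 < ρ) (hl : 0 < l)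
    (hn : 1 ≤ n) (hnl : ⌊l / Real.log ρ⌋₊ ≤ n) :
    supNorm (err l n f) ≤ K 12 l ρ f * ((n : ℝ) ^ l / ρ ^ n) := by
  obtain ⟨E, hE, hEK⟩ := exists_gammaRatio_le_kFactor hl
  refine (supNorm_err_le_absolute hf hρ hl hn hnl fun k hk => hE k (by omega)).trans ?_
  refine mul_le_mul_of_nonneg_right ?_ (by positivity)
  calc _ = (D l ρ f / Real.log ρ) * (2 * (5 / 2) ^ l * E) := by ring
    _ ≤ (D l ρ f / Real.log ρ) * (12 * kFactor l) := mul_le_mul_of_nonneg_left hEK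
        (div_nonneg (D_nonneg f hρ (by linarith) hl.ne') (Real.log_pos hρ).le)
    _ = _ := by rw [K_eq]; ring

theorem supNorm_err_le_K_one_add (hf : DiffContOnCl ℂ f (region ρ)) (hρ : 1 < ρ) (hl : 0 < l)
    (hn : 1 ≤ n) {ε : ℝ} (hε : 0 < ε) (hnε : l * (1 + ε) / ε ≤ n * Real.log ρ) :
    supNorm (err l n f) ≤ K (1 + ε) l ρ f * ((n : ℝ) ^ l / ρ ^ n) :=
  supNorm_err_le_asymptotic hf hρ hl hn hε hnε fun _ hk => gammaRatio_le_kFactor hl (by omega)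

end PositiveParameter

/-! ### Lower bounds for a function with a pole on the ellipse -/

/-- The function `x ↦ 1 / (x - ω)`, which has a simple pole at `ω`. -/
def cauchyKernel (ω : ℝ) (z : ℂ) : ℂ := 1 / (z - ω)

/-- The negative of the `k`-th Gegenbauer coefficient of `1 / (x - ω)`, `ω = (t + t⁻¹) / 2`. -/
def kernelCoeff (l t : ℝ) (k : ℕ) : ℝ :=
  2 * t ^ (k + 1) * ((multichoose l k)⁻¹ * (connSeries l k ((t ^ 2 : ℝ) : ℂ)).re)

theorem le_supNorm_err {f : ℂ → ℂ} (hf : ContinuousOn (fun x : ℝ => f x) (Icc (-1) 1)) (l : ℝ)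
    (n : ℕ) {x : ℝ} (hx : x ∈ Icc (-1 : ℝ) 1) : ‖err l n f x‖ ≤ supNorm (err l n f) := by
  have hproj : Continuous (proj l n fun t : ℝ => f t) :=
    continuous_finsetSum _ fun k _ => continuous_const.mul
      (Complex.continuous_ofReal.comp (continuous_poly l k))
  have herr : ContinuousOn (fun x => ‖err l n f x‖) (Icc (-1) 1) :=
    (hf.sub hproj.continuousOn).norm
  exact le_csSup (isCompact_Icc.bddAbove_image herr) (mem_image_of_mem _ hx)

section GeneratingFunction

open Polynomial.Chebyshev

variable {t x : ℝ}

theorem summable_chebyshevU_mul_pow (ht0 : 0 ≤ t) (ht : t < 1) (hx : x ∈ Icc (-1 : ℝ) 1) :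
    Summable fun m : ℕ => (U ℝ m).eval x * t ^ m := by
  have hbound : Summable fun m : ℕ => ((m : ℝ) + 1) * t ^ m := by
    have h := summable_pow_mul_geometric_of_norm_lt_one (R := ℝ) 1
      (by rwa [Real.norm_of_nonneg ht0] : ‖t‖ < 1)
    exact (h.add (summable_geometric_of_lt_one ht0 ht)).congr fun m => by ring
  refine Summable.of_norm_bounded hbound fun m => ?_
  rw [norm_mul, Real.norm_eq_abs, norm_pow, Real.norm_of_nonneg ht0]
  exact mul_le_mul_of_nonneg_right (abs_eval_chebyshevU_le m hx) (by positivity)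

theorem tsum_chebyshevU_mul_pow (ht0 : 0 ≤ t) (ht : t < 1) (hx : x ∈ Icc (-1 : ℝ) 1) :
    (∑' m : ℕ, (U ℝ m).eval x * t ^ m) * (1 - 2 * x * t + t ^ 2) = 1 := by
  have h := summable_chebyshevU_mul_pow ht0 ht hx
  have hrec (m : ℕ) : (U ℝ (m + 2 : ℕ)).eval x * t ^ (m + 2) =
      2 * x * t * ((U ℝ (m + 1 : ℕ)).eval x * t ^ (m + 1)) -
        t ^ 2 * ((U ℝ m).eval x * t ^ m) := by
    push_cast
    rw [U_add_two]
    simp only [Polynomial.eval_sub, Polynomial.eval_mul, Polynomial.eval_ofNat, Polynomial.eval_X]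
    ring
  have htail₁ := h.sum_add_tsum_nat_add 1
  have htail₂ := h.sum_add_tsum_nat_add 2
  rw [tsum_congr hrec, (((summable_nat_add_iff 1).mpr h).mul_left _).tsum_sub (h.mul_left _),
    tsum_mul_left, tsum_mul_left] at htail₂
  simp only [Finset.sum_range_succ, Finset.sum_range_zero, Nat.cast_zero, Nat.cast_one, U_zero,
    U_one, Polynomial.eval_one, Polynomial.eval_mul, Polynomial.eval_ofNat, Polynomial.eval_X,
    pow_zero, pow_one, mul_one, zero_add] at htail₁ htail₂
  linear_combination 2 * x * t * htail₁ - htail₂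

theorem hasSum_cauchyKernel (ht0 : 0 < t) (ht : t < 1) (hx : x ∈ Icc (-1 : ℝ) 1) :
    HasSum (fun m : ℕ => (-2 * t : ℂ) * (t : ℂ) ^ m * ((U ℝ m).eval x : ℝ))
      (cauchyKernel ((t + t⁻¹) / 2) x) := by
  have hsum := (summable_chebyshevU_mul_pow ht0.le ht hx).hasSum.mul_left (-2 * t)
  have htsum := tsum_chebyshevU_mul_pow ht0.le ht hx
  have hfactor : x - (t + t⁻¹) / 2 = -(1 - 2 * x * t + t ^ 2) / (2 * t) := by field_simp; ring
  have hvalue : -2 * t * ∑' m : ℕ, (U ℝ m).eval x * t ^ m = 1 / (x - (t + t⁻¹) / 2) := by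
    rw [hfactor, eq_div_of_mul_eq (right_ne_zero_of_mul_eq_one htsum) htsum]
    field_simp
  rw [hvalue] at hsum
  convert! Complex.hasSum_ofReal.mpr hsum using 1
  · ext m
    push_cast
    ring
  · rw [cauchyKernel]
    push_cast
    rfl

end GeneratingFunction

section Pole

variable {l t : ℝ}

theorem hasSum_err_cauchyKernel (hl : -1 / 2 < l) (hl0 : l ≠ 0) (ht0 : 0 < t) (ht : t < 1)
    (n : ℕ) {x : ℝ} (hx : x ∈ Icc (-1 : ℝ) 1) :
    HasSum (fun i => kernelCoeff l t (i + (n + 1)) * poly l (i + (n + 1)) x)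
      (-(err l n (cauchyKernel ((t + t⁻¹) / 2)) x).re) := by
  have h := Complex.hasSum_re (hasSum_sub_proj hl hl0 ht0.le ht (B := 2 * t)
    (fun m => by simp [abs_of_pos ht0])
    (g := fun x : ℝ => cauchyKernel ((t + t⁻¹) / 2) x)
    (fun x hx => hasSum_cauchyKernel ht0 ht hx) n hx)
  refine h.neg.congr_fun fun i => ?_
  have hreal : seriesCoeff l (fun m => (-2 * t : ℂ) * (t : ℂ) ^ m) (i + (n + 1)) *
      (poly l (i + (n + 1)) x : ℂ) =
      ((-(kernelCoeff l t (i + (n + 1)) * poly l (i + (n + 1)) x) : ℝ) : ℂ) := by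
    have hre := ofReal_re_connSeries l (i + (n + 1)) (t ^ 2)
    rw [seriesCoeff_const_mul_pow (by linarith) hl0, kernelCoeff]
    push_cast at hre ⊢
    rw [hre]
    ring
  rw [hreal, Complex.ofReal_re, neg_neg]

theorem exists_le_inv_multichoose_mul (hl : 0 < l) : ∃ c : ℝ, 0 < c ∧
    ∀ k : ℕ, 1 ≤ k → c * (k : ℝ) ^ l ≤ (multichoose l k)⁻¹ * multichoose (2 * l) k := by
  obtain ⟨m, _, hm, _, hlower⟩ :=
    exists_abs_multichoose_bounds (a := 2 * l) (by linarith) (by positivity)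
  obtain ⟨_, M, _, hM, hupper⟩ := exists_abs_multichoose_bounds (a := l) (by linarith) hl.ne'
  refine ⟨m / M, by positivity, fun k hk => ?_⟩
  have hk0 : (0 : ℝ) < k := by exact_mod_cast hk
  have hpos := multichoose_pos hl k
  have hle := (hlower k hk).1
  have hge := (hupper k hk).2
  rw [abs_of_pos (multichoose_pos (by positivity) _)] at hle
  rw [abs_of_pos hpos] at hge
  rw [inv_mul_eq_div, le_div_iff₀ hpos]
  calc _ ≤ m / M * (k : ℝ) ^ l * (M * (k : ℝ) ^ (l - 1)) := by gcongr
    _ = m * ((k : ℝ) ^ l * (k : ℝ) ^ (l - 1)) := by field_simp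
    _ = m * (k : ℝ) ^ (2 * l - 1) := by rw [← Real.rpow_add hk0]; congr 2; ring
    _ ≤ _ := hle

theorem exists_le_kernelCoeff_mul_poly_one (hl : 0 < l) (ht0 : 0 < t) (ht : t < 1) :
    ∃ c : ℝ, 0 < c ∧ ∀ k : ℕ, 1 ≤ k →
      c * ((k : ℝ) ^ l * t ^ k) ≤ kernelCoeff l t k * poly l k 1 := by
  obtain ⟨c, hc, hratio⟩ := exists_le_inv_multichoose_mul hl
  have ht2 : t ^ 2 < 1 := by nlinarith
  set m := min 1 ((1 - t ^ 2) ^ (l - 1))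
  have hm : 0 < m := lt_min one_pos (Real.rpow_pos_of_pos (by linarith) _)
  refine ⟨2 * t * c * m, by positivity, fun k hk => ?_⟩
  have hseries := min_one_rpow_le_re_connSeries hl k (sq_nonneg t) ht2
  rw [kernelCoeff, poly_one_right]
  calc _ = 2 * t ^ (k + 1) * (c * (k : ℝ) ^ l * m) := by ring
    _ ≤ 2 * t ^ (k + 1) * ((multichoose l k)⁻¹ * multichoose (2 * l) k *
          (connSeries l k ((t ^ 2 : ℝ) : ℂ)).re) :=
        mul_le_mul_of_nonneg_left (mul_le_mul (hratio k hk) hseries hm.le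
          ((by positivity : 0 ≤ c * (k : ℝ) ^ l).trans (hratio k hk))) (by positivity)
    _ = _ := by ring

theorem exists_le_norm_err_one (hl : 0 < l) (ht0 : 0 < t) (ht : t < 1) :
    ∃ c : ℝ, 0 < c ∧ ∀ n : ℕ, 1 ≤ n →
      c * ((n : ℝ) ^ l * t ^ n) ≤ ‖err l n (cauchyKernel ((t + t⁻¹) / 2)) 1‖ := by
  obtain ⟨c, hc, hterm⟩ := exists_le_kernelCoeff_mul_poly_one hl ht0 ht
  refine ⟨c * t, by positivity, fun n hn => ?_⟩
  have hsum := hasSum_err_cauchyKernel (by linarith) hl.ne' ht0 ht n (x := 1) (by norm_num)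
  have hnonneg (i : ℕ) : 0 ≤ kernelCoeff l t (i + (n + 1)) * poly l (i + (n + 1)) 1 :=
    le_trans (by positivity) (hterm (i + (n + 1)) (by omega))
  have hmono : (n : ℝ) ^ l ≤ ((n + 1 : ℕ) : ℝ) ^ l :=
    Real.rpow_le_rpow n.cast_nonneg (by push_cast; linarith) hl.le
  calc _ = c * ((n : ℝ) ^ l * t ^ (n + 1)) := by ring
    _ ≤ c * (((n + 1 : ℕ) : ℝ) ^ l * t ^ (n + 1)) := by gcongr
    _ ≤ kernelCoeff l t (n + 1) * poly l (n + 1) 1 := hterm _ (by omega)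
    _ ≤ -(err l n (cauchyKernel ((t + t⁻¹) / 2)) 1).re := by
        simpa only [zero_add] using le_hasSum hsum 0 fun i _ => hnonneg i
    _ ≤ _ := (neg_le_abs _).trans (Complex.abs_re_le_norm _)

end Pole

theorem sub_mul_le_of_hasSum_alternating {b : ℕ → ℝ} {r S : ℝ} (hr : r ≤ 1) (hb : ∀ j, 0 ≤ b j)
    (hstep : ∀ j, b (j + 1) ≤ r * b j) (hS : HasSum (fun j => (-1) ^ j * b j) S) :
    (1 - r) * b 0 ≤ S := by
  have hanti : Antitone b := antitone_nat_of_succ_le fun j =>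
    (hstep j).trans (mul_le_of_le_one_left (hb j) hr)
  have h := hanti.alternating_series_le_tendsto hS.tendsto_sum_nat 1
  simp only [mul_one, Finset.sum_range_succ, Finset.sum_range_zero, zero_add, pow_zero, one_mul,
    pow_one] at h
  linarith [hstep 0]

theorem hasSum_two_mul_of_hasSum_add {g : ℕ → ℝ} {S : ℝ} {n i : ℕ} (hodd : ∀ j, g (2 * j + 1) = 0)
    (hle : n ≤ 2 * i) (hge : 2 * i ≤ n + 1) (hS : HasSum (fun j => g (j + n)) S) :
    HasSum (fun j => g (2 * (i + j))) S := by
  have hinj : Function.Injective fun j => 2 * (i + j) - n := fun a b hab => by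
    simp only at hab
    omega
  rw [← hinj.hasSum_iff] at hS
  · refine hS.congr_fun fun j => ?_
    rw [Function.comp_apply, Nat.sub_add_cancel (by omega)]
  · intro k hk
    rcases Nat.even_or_odd' (k + n) with ⟨j, hj | hj⟩
    · exact absurd ⟨j - i, by simp only; omega⟩ hk
    · rw [hj, hodd]

section NegativeParameter

variable {l t : ℝ}

theorem poly_two_mul_add_one_zero (hl : -1 / 2 < l) (i : ℕ) : poly l (2 * i + 1) 0 = 0 := by
  induction i with
  | zero => simp [poly_one_left hl]
  | succ i ih =>
    have h := poly_recurrence hl (2 * i + 1) 0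
    rw [ih] at h
    have hne : ((2 * i + 1 : ℕ) : ℝ) + 2 ≠ 0 := by positivity
    exact (mul_eq_zero.mp (h.trans (by ring))).resolve_left hne

theorem multichoose_succ_neg (hl : -1 < l) (hl0 : l < 0) (i : ℕ) : multichoose l (i + 1) < 0 := by
  induction i with
  | zero => simpa [Ring.multichoose_one_right] using hl0
  | succ i ih =>
    rw [multichoose_succ_eq_mul_div]
    refine mul_neg_of_neg_of_pos ih (div_pos ?_ (by positivity))
    push_cast
    linarith [Nat.cast_nonneg (α := ℝ) i]

/-- The quotient `multichoose l i / multichoose l (2 * i)`, up to sign the value at `0` of the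
Gegenbauer polynomial of degree `2 * i` divided by `multichoose l (2 * i)`. The index is shifted by
one, since the quotient is monotone and bounded below only for `i ≥ 1`. -/
def evenRatio (l : ℝ) (i : ℕ) : ℝ := (multichoose l (2 * (i + 1)))⁻¹ * multichoose l (i + 1)

theorem evenRatio_pos (hl : -1 < l) (hl0 : l < 0) (i : ℕ) : 0 < evenRatio l i :=
  mul_pos_of_neg_of_neg (inv_lt_zero.mpr (multichoose_succ_neg hl hl0 (2 * i + 1)))
    (multichoose_succ_neg hl hl0 i)

theorem antitone_evenRatio (hl : -1 < l) (hl0 : l < 0) : Antitone (evenRatio l) := by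
  refine antitone_nat_of_succ_le fun i => ?_
  have : (0 : ℝ) ≤ i := i.cast_nonneg
  have h₁ : 0 < l + 2 * ((i : ℝ) + 1) := by linarith
  have h₂ : 0 < l + (2 * ((i : ℝ) + 1) + 1) := by linarith
  have hne := (multichoose_succ_neg hl hl0 (2 * i + 1)).ne
  have hstep : evenRatio l (i + 1) = evenRatio l i *
      (((l + (i + 1)) * (2 * (2 * (i + 1) + 1))) /
        ((l + 2 * (i + 1)) * (l + (2 * (i + 1) + 1)))) := by
    rw [evenRatio, evenRatio, show 2 * (i + 1 + 1) = 2 * (i + 1) + 1 + 1 by ring,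
      multichoose_succ_eq_mul_div l (2 * (i + 1) + 1),
      multichoose_succ_eq_mul_div l (2 * (i + 1)), multichoose_succ_eq_mul_div l (i + 1)]
    push_cast
    rw [show 2 * i + 1 + 1 = 2 * (i + 1) by ring] at hne
    field_simp
    ring
  rw [hstep]
  refine mul_le_of_le_one_right (evenRatio_pos hl hl0 i).le ?_
  rw [div_le_one (by positivity)]
  nlinarith

theorem exists_le_evenRatio (hl : -1 < l) (hl0 : l < 0) :
    ∃ c : ℝ, 0 < c ∧ ∀ i : ℕ, c ≤ evenRatio l i := by
  obtain ⟨m, M, hm, hM, hbound⟩ := exists_abs_multichoose_bounds hl hl0.ne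
  refine ⟨m / M, by positivity, fun i => ?_⟩
  have hlower := (hbound (i + 1) (by omega)).1
  have hupper := (hbound (2 * (i + 1)) (by omega)).2
  have hmono : ((2 * (i + 1) : ℕ) : ℝ) ^ (l - 1) ≤ ((i + 1 : ℕ) : ℝ) ^ (l - 1) :=
    Real.rpow_le_rpow_of_nonpos (by positivity) (by push_cast; linarith [i.cast_nonneg (α := ℝ)])
      (by linarith)
  have hne : multichoose l (2 * (i + 1)) ≠ 0 := (multichoose_succ_neg hl hl0 (2 * i + 1)).ne
  rw [← abs_of_pos (evenRatio_pos hl hl0 i), evenRatio, abs_mul, abs_inv, inv_mul_eq_div,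
    div_le_div_iff₀ hM (abs_pos.mpr hne)]
  calc _ ≤ m * (M * ((i + 1 : ℕ) : ℝ) ^ (l - 1)) :=
        mul_le_mul_of_nonneg_left
          (hupper.trans (mul_le_mul_of_nonneg_left hmono hM.le)) hm.le
    _ = m * ((i + 1 : ℕ) : ℝ) ^ (l - 1) * M := by ring
    _ ≤ _ := mul_le_mul_of_nonneg_right hlower hM.le

/-- Up to sign, the term of degree `2 * (i + 1)` in the Gegenbauer expansion at `0` of
`1 / (x - ω)`, `ω = (t + t⁻¹) / 2`. -/
def evenTerm (l t : ℝ) (i : ℕ) : ℝ :=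
  2 * t ^ (2 * (i + 1) + 1) * (evenRatio l i * (connSeries l (2 * (i + 1)) ((t ^ 2 : ℝ) : ℂ)).re)

theorem kernelCoeff_mul_poly_zero (hl : -1 / 2 < l) (i : ℕ) :
    kernelCoeff l t (2 * (i + 1)) * poly l (2 * (i + 1)) 0 = (-1) ^ (i + 1) * evenTerm l t i := by
  rw [poly_two_mul_zero hl, kernelCoeff, evenTerm, evenRatio]
  ring

theorem le_evenTerm {c : ℝ} (hl : -1 < l) (hl0 : l < 0) (ht0 : 0 ≤ t) (ht : t < 1) {i : ℕ}
    (hc : c ≤ evenRatio l i) : 2 * t ^ (2 * (i + 1) + 1) * c ≤ evenTerm l t i :=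
  mul_le_mul_of_nonneg_left (hc.trans (le_mul_of_one_le_right (evenRatio_pos hl hl0 i).le
    (one_le_re_connSeries hl hl0 _ (sq_nonneg t) (by nlinarith)))) (by positivity)

theorem evenTerm_succ_le (hl : -1 < l) (hl0 : l < 0) (ht0 : 0 ≤ t) (ht : t < 1) (i : ℕ) :
    evenTerm l t (i + 1) ≤ t ^ 2 * evenTerm l t i := by
  have ht2 : t ^ 2 < 1 := by nlinarith
  have hratio := antitone_evenRatio hl hl0 i.le_succ
  have hseries := antitone_re_connSeries hl hl0 (sq_nonneg t) ht2
    (show 2 * (i + 1) ≤ 2 * (i + 1 + 1) by omega)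
  have hnonneg := zero_le_one.trans
    (one_le_re_connSeries hl hl0 (2 * (i + 1 + 1)) (sq_nonneg t) ht2)
  calc evenTerm l t (i + 1)
      ≤ 2 * t ^ (2 * (i + 1 + 1) + 1) *
          (evenRatio l i * (connSeries l (2 * (i + 1)) ((t ^ 2 : ℝ) : ℂ)).re) :=
        mul_le_mul_of_nonneg_left (mul_le_mul hratio hseries hnonneg (evenRatio_pos hl hl0 i).le)
          (by positivity)
    _ = t ^ 2 * evenTerm l t i := by rw [evenTerm]; ring

/-- At `x = 0` only the even degrees contribute, with alternating signs, so that the error is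
comparable to its first term. -/
theorem exists_le_norm_err_zero (hl : -1 / 2 < l) (hl0 : l < 0) (ht0 : 0 < t) (ht : t < 1) :
    ∃ c : ℝ, 0 < c ∧ ∀ n : ℕ, c * t ^ n ≤ ‖err l n (cauchyKernel ((t + t⁻¹) / 2)) 0‖ := by
  have hl' : -1 < l := by linarith
  have ht2 : t ^ 2 < 1 := by nlinarith
  obtain ⟨c, hc, hratio⟩ := exists_le_evenRatio hl' hl0
  refine ⟨(1 - t ^ 2) * (2 * t ^ 3 * c), mul_pos (by linarith) (by positivity), fun n => ?_⟩
  set e := (err l n (cauchyKernel ((t + t⁻¹) / 2)) 0).re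
  obtain ⟨i, hi, hi'⟩ : ∃ i, n + 1 ≤ 2 * (i + 1) ∧ 2 * (i + 1) ≤ n + 1 + 1 :=
    ⟨n / 2, by omega, by omega⟩
  have hlower (j : ℕ) := le_evenTerm hl' hl0 ht0.le ht (hratio j)
  have hsum : HasSum (fun j => (-1) ^ j * evenTerm l t (i + j)) ((-1) ^ i * e) := by
    have h := (hasSum_two_mul_of_hasSum_add (g := fun k => kernelCoeff l t k * poly l k 0)
      (fun j => by rw [poly_two_mul_add_one_zero hl, mul_zero]) hi hi'
      (hasSum_err_cauchyKernel hl hl0.ne ht0 ht n (by norm_num))).mul_left ((-1) ^ (i + 1))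
    rw [show (-1) ^ (i + 1) * -e = (-1) ^ i * e by ring] at h
    refine h.congr_fun fun j => ?_
    rw [show i + 1 + j = i + j + 1 by ring, kernelCoeff_mul_poly_zero hl, ← mul_assoc, ← pow_add,
      show i + 1 + (i + j + 1) = j + 2 * (i + 1) by ring, pow_add, pow_mul, neg_one_sq, one_pow,
      mul_one]
  calc _ = (1 - t ^ 2) * (2 * t ^ (n + 3) * c) := by ring
    _ ≤ (1 - t ^ 2) * (2 * t ^ (2 * (i + 1) + 1) * c) := by
        have hpow := pow_le_pow_of_le_one ht0.le ht.le (show 2 * (i + 1) + 1 ≤ n + 3 by omega)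
        have := sub_pos.mpr ht2
        gcongr
    _ ≤ (1 - t ^ 2) * evenTerm l t (i + 0) :=
        mul_le_mul_of_nonneg_left (hlower i) (by linarith)
    _ ≤ (-1) ^ i * e := sub_mul_le_of_hasSum_alternating ht2.le
        (fun j => le_trans (by positivity) (hlower (i + j)))
        (fun j => evenTerm_succ_le hl' hl0 ht0.le ht (i + j)) hsum
    _ ≤ |e| := (le_abs_self _).trans_eq (by rw [abs_mul, abs_neg_one_pow, one_mul])
    _ ≤ _ := Complex.abs_re_le_norm _

end NegativeParameter

section RealPole

variable {l ω : ℝ}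

theorem exists_inv_joukowski (hω : 1 < ω) :
    ∃ t : ℝ, 0 < t ∧ t < 1 ∧ (t + t⁻¹) / 2 = ω ∧ ω + √(ω ^ 2 - 1) = t⁻¹ := by
  have h := Real.sq_sqrt (show 0 ≤ ω ^ 2 - 1 by nlinarith)
  have h0 := Real.sqrt_nonneg (ω ^ 2 - 1)
  have hmul : (ω + √(ω ^ 2 - 1)) * (ω - √(ω ^ 2 - 1)) = 1 := by linear_combination -h
  refine ⟨(ω + √(ω ^ 2 - 1))⁻¹, inv_pos.mpr (by linarith), inv_lt_one_of_one_lt₀ (by linarith),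
    ?_, (inv_inv _).symm⟩
  rw [inv_inv, inv_eq_of_mul_eq_one_right hmul]
  ring

theorem continuousOn_cauchyKernel (hω : 1 < ω) :
    ContinuousOn (fun x : ℝ => cauchyKernel ω x) (Icc (-1) 1) := by
  refine continuousOn_const.div (Complex.continuous_ofReal.sub continuous_const).continuousOn
    fun x hx => ?_
  rw [← Complex.ofReal_sub, Complex.ofReal_ne_zero]
  linarith [hx.2]

theorem exists_le_norm_err_cauchyKernel_one (hl : 0 < l) (hω : 1 < ω) :
    ∃ c : ℝ, 0 < c ∧ ∀ n : ℕ, 1 ≤ n →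
      c * ((n : ℝ) ^ l / (ω + √(ω ^ 2 - 1)) ^ n) ≤ ‖err l n (cauchyKernel ω) 1‖ := by
  obtain ⟨t, ht0, ht, rfl, hρ⟩ := exists_inv_joukowski hω
  simpa only [hρ, inv_pow, div_inv_eq_mul] using exists_le_norm_err_one hl ht0 ht

theorem exists_le_supNorm_err_cauchyKernel (hl : -1 / 2 < l) (hl0 : l < 0) (hω : 1 < ω) :
    ∃ c : ℝ, 0 < c ∧ ∀ n : ℕ,
      c / (ω + √(ω ^ 2 - 1)) ^ n ≤ supNorm (err l n (cauchyKernel ω)) := by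
  obtain ⟨t, ht0, ht, rfl, hρ⟩ := exists_inv_joukowski hω
  obtain ⟨c, hc, h⟩ := exists_le_norm_err_zero hl hl0 ht0 ht
  refine ⟨c, hc, fun n => ?_⟩
  rw [hρ, inv_pow, div_inv_eq_mul]
  exact (h n).trans (le_supNorm_err (continuousOn_cauchyKernel hω) l n (by norm_num))

end RealPole

/-! ### Lower bounds for lacunary Chebyshev series -/

section ChebyshevOnEllipse

open Polynomial.Chebyshev

variable {ρ : ℝ} {z : ℂ}

theorem closure_region_subset (ρ : ℝ) :
    closure (region ρ) ⊆ {z | ‖z - 1‖ + ‖z + 1‖ ≤ ρ + ρ⁻¹} :=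
  closure_minimal (fun _ hz => hz.out.le) (isClosed_le (by fun_prop) continuous_const)

theorem exists_joukowski_eq (z : ℂ) : ∃ u : ℂ, 1 ≤ ‖u‖ ∧ joukowski u = z := by
  obtain ⟨s, hs⟩ := IsAlgClosed.exists_pow_nat_eq (z ^ 2 - 1) two_pos
  have hmul : (z + s) * (z - s) = 1 := by linear_combination -hs
  have hnorm : ‖z + s‖ * ‖z - s‖ = 1 := by rw [← norm_mul, hmul, norm_one]
  rcases le_or_gt 1 ‖z + s‖ with h | h
  · refine ⟨_, h, ?_⟩
    rw [joukowski, inv_eq_of_mul_eq_one_right hmul]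
    ring
  · refine ⟨z - s, by nlinarith [norm_nonneg (z - s)], ?_⟩
    rw [joukowski, inv_eq_of_mul_eq_one_left hmul]
    ring

theorem exists_mem_annulus_joukowski_eq (hρ : 1 ≤ ρ) (hz : z ∈ closure (region ρ)) :
    ∃ u ∈ annulus ρ, joukowski u = z := by
  obtain ⟨u, hu, rfl⟩ := exists_joukowski_eq z
  refine ⟨u, ⟨hu, not_lt.mp fun hlt => ?_⟩, rfl⟩
  have h : ‖joukowski u - 1‖ + ‖joukowski u + 1‖ ≤ ρ + ρ⁻¹ := closure_region_subset ρ hz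
  rw [norm_joukowski_sub_add (norm_pos_iff.mp (by linarith))] at h
  exact h.not_gt (add_inv_lt_add_inv hρ hlt)

theorem eval_chebyshevU_succ_joukowski {u : ℂ} (hu : u ≠ 0) (m : ℕ) :
    (U ℂ ((m : ℤ) + 1)).eval (joukowski u) =
      u * (U ℂ m).eval (joukowski u) + u⁻¹ ^ (m + 1) := by
  induction m with
  | zero =>
    simp [joukowski]
    ring
  | succ m ih =>
    rw [show ((m + 1 : ℕ) : ℤ) + 1 = (m : ℤ) + 2 by push_cast; ring, U_add_two]
    push_cast
    simp only [Polynomial.eval_sub, Polynomial.eval_mul, Polynomial.eval_ofNat, Polynomial.eval_X]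
    have htwo : 2 * joukowski u = u + u⁻¹ := by rw [joukowski]; ring
    rw [htwo]
    linear_combination u⁻¹ * ih + (U ℂ m).eval (joukowski u) * mul_inv_cancel₀ hu

theorem norm_eval_chebyshevU_joukowski_mul_le {u : ℂ} (hu : u ∈ annulus ρ) (m : ℕ) :
    ‖(U ℂ m).eval (joukowski u)‖ * (ρ - 1) ≤ ρ ^ (m + 1) - 1 := by
  have hρ : 1 ≤ ρ := hu.1.trans hu.2
  induction m with
  | zero => simp
  | succ m ih =>
    have hinv : ‖u⁻¹ ^ (m + 1)‖ ≤ 1 := by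
      rw [norm_pow, norm_inv]
      exact pow_le_one₀ (by positivity) (inv_le_one_of_one_le₀ hu.1)
    have hstep : ‖(U ℂ (m + 1 : ℕ)).eval (joukowski u)‖ ≤
        ρ * ‖(U ℂ m).eval (joukowski u)‖ + 1 := by
      push_cast
      rw [eval_chebyshevU_succ_joukowski (ne_zero_of_mem_annulus hu)]
      refine (norm_add_le _ _).trans (add_le_add ?_ hinv)
      rw [norm_mul]
      exact mul_le_mul_of_nonneg_right hu.2 (norm_nonneg _)
    calc _ ≤ (ρ * ‖(U ℂ m).eval (joukowski u)‖ + 1) * (ρ - 1) :=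
          mul_le_mul_of_nonneg_right hstep (by linarith)
      _ = ρ * (‖(U ℂ m).eval (joukowski u)‖ * (ρ - 1)) + (ρ - 1) := by ring
      _ ≤ ρ * (ρ ^ (m + 1) - 1) + (ρ - 1) := by gcongr
      _ = _ := by ring

theorem norm_eval_chebyshevU_le (hρ : 1 < ρ) (hz : z ∈ closure (region ρ)) (m : ℕ) :
    ‖(U ℂ m).eval z‖ ≤ ρ / (ρ - 1) * ρ ^ m := by
  obtain ⟨u, hu, rfl⟩ := exists_mem_annulus_joukowski_eq hρ.le hz
  rw [div_mul_eq_mul_div, le_div_iff₀ (by linarith), ← pow_succ']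
  linarith [norm_eval_chebyshevU_joukowski_mul_le hu m]

end ChebyshevOnEllipse

section Lacunary

open Polynomial.Chebyshev

variable {q ρ l : ℝ}

/-- The degrees occurring in `lacunarySeries`. They are even, so that the Gegenbauer polynomials of
these degrees do not vanish at `0`, and for every `γ > 0` the power `lacunaryDegree i ^ γ` outgrows
every geometric sequence. -/
def lacunaryDegree (i : ℕ) : ℕ := 2 * 2 ^ i ^ 2

theorem lacunaryDegree_strictMono : StrictMono lacunaryDegree := fun i j h => by
  have hsq : i ^ 2 < j ^ 2 := Nat.pow_lt_pow_left h two_ne_zero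
  have := Nat.pow_lt_pow_right one_lt_two hsq
  unfold lacunaryDegree
  omega

theorem two_le_lacunaryDegree (i : ℕ) : 2 ≤ lacunaryDegree i :=
  Nat.le_mul_of_pos_right 2 (Nat.two_pow_pos (i ^ 2))

theorem tendsto_pow_mul_lacunaryDegree_rpow {γ : ℝ} (hq : 0 < q) (hγ : 0 < γ) :
    Tendsto (fun i => q ^ i * (lacunaryDegree i : ℝ) ^ γ) atTop atTop := by
  have hbase : Tendsto (fun i => q * ((2 : ℝ) ^ γ) ^ i) atTop atTop :=
    (tendsto_pow_atTop_atTop_of_one_lt (Real.one_lt_rpow one_lt_two hγ)).const_mul_atTop hq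
  refine tendsto_atTop_mono' _ ?_ (tendsto_pow_atTop_atTop_of_one_lt (one_lt_two (α := ℝ)))
  filter_upwards [hbase.eventually_ge_atTop 2] with i hi
  have hdegree : ((2 : ℝ) ^ γ) ^ i ^ 2 ≤ (lacunaryDegree i : ℝ) ^ γ := by
    rw [Real.rpow_pow_comm zero_le_two]
    refine Real.rpow_le_rpow (by positivity) ?_ hγ.le
    rw [lacunaryDegree]
    push_cast
    linarith [pow_pos (two_pos (α := ℝ)) (i ^ 2)]
  calc (2 : ℝ) ^ i ≤ (q * ((2 : ℝ) ^ γ) ^ i) ^ i := pow_le_pow_left₀ zero_le_two hi i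
    _ = q ^ i * ((2 : ℝ) ^ γ) ^ i ^ 2 := by rw [mul_pow, ← pow_mul, sq]
    _ ≤ _ := mul_le_mul_of_nonneg_left hdegree (by positivity)

/-- The coefficient of `U_m` in `lacunarySeries q ρ`. -/
def lacunaryCoeff (q ρ : ℝ) (m : ℕ) : ℝ :=
  Function.extend lacunaryDegree (fun i => q ^ i * ρ⁻¹ ^ lacunaryDegree i) 0 m

theorem lacunaryCoeff_lacunaryDegree (q ρ : ℝ) (i : ℕ) :
    lacunaryCoeff q ρ (lacunaryDegree i) = q ^ i * ρ⁻¹ ^ lacunaryDegree i :=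
  lacunaryDegree_strictMono.injective.extend_apply _ _ _

theorem lacunaryCoeff_eq_zero (q ρ : ℝ) {m : ℕ} (hm : m ∉ range lacunaryDegree) :
    lacunaryCoeff q ρ m = 0 :=
  Function.extend_apply' _ _ _ hm

theorem abs_lacunaryCoeff_le (hq0 : 0 ≤ q) (hq : q ≤ 1) (hρ : 0 ≤ ρ) {i m : ℕ}
    (hi : ∀ i', lacunaryDegree i' = m → i ≤ i') : |lacunaryCoeff q ρ m| ≤ q ^ i * ρ⁻¹ ^ m := by
  by_cases hm : m ∈ range lacunaryDegree
  · obtain ⟨j, rfl⟩ := hm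
    rw [lacunaryCoeff_lacunaryDegree, abs_of_nonneg (by positivity)]
    exact mul_le_mul_of_nonneg_right (pow_le_pow_of_le_one hq0 hq (hi j rfl)) (by positivity)
  · rw [lacunaryCoeff_eq_zero q ρ hm, abs_zero]
    positivity

/-- The series `∑ q ^ i * ρ ^ (-m_i) * U_{m_i}(z)`, `m_i = lacunaryDegree i`, which converges on the
closed region bounded by the Bernstein ellipse. -/
def lacunarySeries (q ρ : ℝ) (z : ℂ) : ℂ :=
  ∑' i, ((q ^ i * ρ⁻¹ ^ lacunaryDegree i : ℝ) : ℂ) * (U ℂ (lacunaryDegree i)).eval z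

theorem norm_lacunaryTerm_le (hq0 : 0 ≤ q) (hρ : 1 < ρ) (i : ℕ) {z : ℂ}
    (hz : z ∈ closure (region ρ)) :
    ‖((q ^ i * ρ⁻¹ ^ lacunaryDegree i : ℝ) : ℂ) * (U ℂ (lacunaryDegree i)).eval z‖ ≤
      ρ / (ρ - 1) * q ^ i := by
  have hρ0 : 0 < ρ := by linarith
  rw [norm_mul, Complex.norm_real, Real.norm_of_nonneg (by positivity)]
  calc _ ≤ q ^ i * ρ⁻¹ ^ lacunaryDegree i * (ρ / (ρ - 1) * ρ ^ lacunaryDegree i) :=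
        mul_le_mul_of_nonneg_left (norm_eval_chebyshevU_le hρ hz _) (by positivity)
    _ = ρ / (ρ - 1) * q ^ i * (ρ⁻¹ * ρ) ^ lacunaryDegree i := by rw [mul_pow]; ring
    _ = _ := by rw [inv_mul_cancel₀ hρ0.ne', one_pow, mul_one]

theorem summable_lacunaryBound (hq0 : 0 ≤ q) (hq : q < 1) (ρ : ℝ) :
    Summable fun i => ρ / (ρ - 1) * q ^ i :=
  (summable_geometric_of_lt_one hq0 hq).mul_left _

theorem diffContOnCl_lacunarySeries (hq0 : 0 ≤ q) (hq : q < 1) (hρ : 1 < ρ) :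
    DiffContOnCl ℂ (lacunarySeries q ρ) (region ρ) := by
  have hterm (i : ℕ) : Differentiable ℂ fun z =>
      ((q ^ i * ρ⁻¹ ^ lacunaryDegree i : ℝ) : ℂ) * (U ℂ (lacunaryDegree i)).eval z :=
    (differentiable_const _).mul (Polynomial.differentiable _)
  constructor
  · exact Complex.differentiableOn_tsum_of_summable_norm (summable_lacunaryBound hq0 hq ρ)
      (fun i => (hterm i).differentiableOn) (isOpen_region ρ)
      fun i z hz => norm_lacunaryTerm_le hq0 hρ i (subset_closure hz)
  · exact continuousOn_tsum (fun i => (hterm i).continuous.continuousOn)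
      (summable_lacunaryBound hq0 hq ρ) fun i z hz => norm_lacunaryTerm_le hq0 hρ i hz

theorem ofReal_mem_region (hρ : 1 < ρ) {x : ℝ} (hx : x ∈ Icc (-1 : ℝ) 1) : (x : ℂ) ∈ region ρ := by
  rw [← Real.cos_arccos hx.1 hx.2, ← joukowski_circleMap_one]
  exact joukowski_mem_region (norm_circleMap_of_pos one_pos _).ge
    ((norm_circleMap_of_pos one_pos _).trans_lt hρ)

theorem hasSum_lacunarySeries (hq0 : 0 ≤ q) (hq : q < 1) (hρ : 1 < ρ) {x : ℝ}
    (hx : x ∈ Icc (-1 : ℝ) 1) :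
    HasSum (fun m : ℕ => (lacunaryCoeff q ρ m : ℂ) * ((U ℝ m).eval x : ℝ))
      (lacunarySeries q ρ x) := by
  rw [← lacunaryDegree_strictMono.injective.hasSum_iff]
  · refine (Summable.of_norm_bounded (summable_lacunaryBound hq0 hq ρ) fun i =>
      norm_lacunaryTerm_le hq0 hρ i
        (subset_closure (ofReal_mem_region hρ hx))).hasSum.congr_fun fun i => ?_
    simp only [Function.comp_apply, lacunaryCoeff_lacunaryDegree, complex_ofReal_eval_U]
  · intro m hm
    rw [lacunaryCoeff_eq_zero q ρ hm, Complex.ofReal_zero, zero_mul]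

/-- If the coefficients of degree larger than `k` are small, then the `k`-th Gegenbauer coefficient
is close to the contribution of the term of degree `k`. -/
theorem norm_seriesCoeff_sub_le (hl : -1 < l) (hl0 : l ≠ 0) {β : ℕ → ℂ} {B r ε : ℝ} (hr0 : 0 ≤ r)
    (hr : r < 1) (hβ : ∀ m, ‖β m‖ ≤ B * r ^ m) {k : ℕ} (hε : 0 ≤ ε)
    (hβε : ∀ m, k < m → ‖β m‖ ≤ ε * r ^ m) :
    ‖seriesCoeff l β k - β k * ((multichoose l k)⁻¹ : ℝ)‖ ≤
      ε * (r ^ k * |multichoose l k|⁻¹) * ∑' j, connMajorant l j * (r ^ 2) ^ j := by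
  have hmajorant := summable_connMajorant_mul_pow l (sq_nonneg r) (by nlinarith : r ^ 2 < 1)
  have htail : ∑' j, connMajorant l (j + 1) * (r ^ 2) ^ (j + 1) ≤
      ∑' j, connMajorant l j * (r ^ 2) ^ j := by
    rw [hmajorant.tsum_eq_zero_add]
    exact le_add_of_nonneg_left (mul_nonneg (connMajorant_nonneg hl 0) (by positivity))
  have hhead : ((connCoeff l 0 (k + 0) * (k + l) : ℝ) : ℂ) = ((multichoose l k)⁻¹ : ℝ) := by
    rw [connCoeff_mul_eq hl hl0, risingRatio_zero, Ring.multichoose_zero_right, one_mul, mul_one]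
  rw [seriesCoeff, (hasSum_seriesCoeff hl hl0 hr0 hr hβ k).summable.tsum_eq_zero_add, hhead,
    mul_zero, add_zero, add_sub_cancel_left]
  exact (tsum_of_norm_bounded (((summable_nat_add_iff 1).mpr hmajorant).hasSum.mul_left _) fun j =>
    norm_mul_connCoeff_le hl hl0 (hβε _ (by omega))).trans
      (mul_le_mul_of_nonneg_left htail (by positivity))

theorem le_norm_coeff_lacunarySeries (hl : -1 / 2 < l) (hl0 : l ≠ 0) (hρ : 1 < ρ) (hq0 : 0 < q)
    (hq : q < 1) (hqS : q * ∑' j, connMajorant l j * (ρ⁻¹ ^ 2) ^ j ≤ 1 / 2) (i : ℕ) :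
    q ^ i / ρ ^ lacunaryDegree i / 2 * |multichoose l (lacunaryDegree i)|⁻¹ ≤
      ‖coeff l (fun x : ℝ => lacunarySeries q ρ x) (lacunaryDegree i)‖ := by
  have hl' : -1 < l := by linarith
  have hr0 : 0 ≤ ρ⁻¹ := by positivity
  have hr : ρ⁻¹ < 1 := inv_lt_one_of_one_lt₀ hρ
  set k := lacunaryDegree i
  have hβ (m : ℕ) : ‖(lacunaryCoeff q ρ m : ℂ)‖ ≤ 1 * ρ⁻¹ ^ m := by
    rw [Complex.norm_real]
    exact abs_lacunaryCoeff_le hq0.le hq.le (by linarith) fun i' _ => i'.zero_le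
  have hclose := norm_seriesCoeff_sub_le hl' hl0 hr0 hr hβ (k := k) (ε := q ^ (i + 1))
    (by positivity) fun m hm => by
      rw [Complex.norm_real]
      exact abs_lacunaryCoeff_le hq0.le hq.le (by linarith) fun i' hi' =>
        lacunaryDegree_strictMono.lt_iff_lt.mp (hi' ▸ hm)
  have hmain : ‖(lacunaryCoeff q ρ k : ℂ) * ((multichoose l k)⁻¹ : ℝ)‖ =
      q ^ i * ρ⁻¹ ^ k * |multichoose l k|⁻¹ := by
    rw [lacunaryCoeff_lacunaryDegree, norm_mul, Complex.norm_real, Complex.norm_real,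
      Real.norm_of_nonneg (by positivity), norm_inv, Real.norm_eq_abs]
  have hhalf : q ^ (i + 1) * (ρ⁻¹ ^ k * |multichoose l k|⁻¹) *
      ∑' j, connMajorant l j * (ρ⁻¹ ^ 2) ^ j ≤ q ^ i * ρ⁻¹ ^ k * |multichoose l k|⁻¹ * (1 / 2) :=
    calc _ = q ^ i * ρ⁻¹ ^ k * |multichoose l k|⁻¹ *
          (q * ∑' j, connMajorant l j * (ρ⁻¹ ^ 2) ^ j) := by ring
      _ ≤ _ := mul_le_mul_of_nonneg_left hqS (by positivity)
  have htriangle := norm_sub_norm_le ((lacunaryCoeff q ρ k : ℂ) * ((multichoose l k)⁻¹ : ℝ))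
    (seriesCoeff l (fun m => (lacunaryCoeff q ρ m : ℂ)) k)
  rw [norm_sub_rev, hmain] at htriangle
  rw [coeff_eq_seriesCoeff hl hl0 hr0 hr hβ fun x hx => hasSum_lacunarySeries hq0.le hq hρ hx]
  calc _ = q ^ i * ρ⁻¹ ^ k * |multichoose l k|⁻¹ * (1 / 2) := by rw [inv_pow]; ring
    _ ≤ _ := by linarith

theorem exists_le_norm_coeff_lacunarySeries (hl : -1 / 2 < l) (hl0 : l ≠ 0) (hρ : 1 < ρ) :
    ∃ q : ℝ, 0 < q ∧ q < 1 ∧ ∀ i,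
      q ^ i / ρ ^ lacunaryDegree i / 2 * |multichoose l (lacunaryDegree i)|⁻¹ ≤
        ‖coeff l (fun x : ℝ => lacunarySeries q ρ x) (lacunaryDegree i)‖ := by
  set S := ∑' j, connMajorant l j * (ρ⁻¹ ^ 2) ^ j with hS_def
  have hS : 0 ≤ S := tsum_nonneg fun j =>
    mul_nonneg (connMajorant_nonneg (by linarith) j) (by positivity)
  have hq : 1 / (2 * (S + 1)) < 1 := by
    rw [div_lt_one (by positivity)]
    linarith
  refine ⟨1 / (2 * (S + 1)), by positivity, hq,
    le_norm_coeff_lacunarySeries hl hl0 hρ (by positivity) hq ?_⟩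
  rw [← hS_def, div_mul_eq_mul_div, div_le_div_iff₀ (by positivity) two_pos]
  linarith

end Lacunary

section LowerBound

variable {ρ l : ℝ}

theorem norm_coeff_mul_abs_poly_le {f : ℂ → ℂ}
    (hf : ContinuousOn (fun x : ℝ => f x) (Icc (-1) 1)) (l : ℝ) (n : ℕ) {x : ℝ}
    (hx : x ∈ Icc (-1 : ℝ) 1) :
    ‖coeff l (fun x : ℝ => f x) (n + 1)‖ * |poly l (n + 1) x| ≤
      supNorm (err l n f) + supNorm (err l (n + 1) f) := by
  have hsub : coeff l (fun x : ℝ => f x) (n + 1) * ((poly l (n + 1) x : ℝ) : ℂ) =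
      err l n f x - err l (n + 1) f x := by
    rw [err, err, proj, proj, Finset.sum_range_succ _ (n + 1)]
    ring
  rw [← Real.norm_eq_abs, ← Complex.norm_real, ← norm_mul, hsub]
  exact (norm_sub_le _ _).trans (add_le_add (le_supNorm_err hf l n hx) (le_supNorm_err hf l _ hx))

theorem rpow_le_two_rpow_abs_mul_rpow {x y : ℝ} (hx : 0 < x) (hxy : x ≤ y) (hy : y ≤ 2 * x)
    (a : ℝ) : x ^ a ≤ 2 ^ |a| * y ^ a := by
  have hy0 : 0 < y := hx.trans_le hxy
  rcases le_or_gt 0 a with ha | ha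
  · exact (Real.rpow_le_rpow hx.le hxy ha).trans
      (le_mul_of_one_le_left (by positivity) (Real.one_le_rpow one_le_two (abs_nonneg a)))
  · rw [abs_of_neg ha, Real.rpow_neg zero_le_two, ← Real.inv_rpow zero_le_two,
      ← Real.mul_rpow (by norm_num) hy0.le]
    exact Real.rpow_le_rpow_of_nonpos (by positivity) (by linarith) ha.le

theorem rpow_div_pow_add_le (hρ : 0 < ρ) {n : ℕ} (hn : 1 ≤ n) (a : ℝ) :
    (n : ℝ) ^ a / ρ ^ n + ((n + 1 : ℕ) : ℝ) ^ a / ρ ^ (n + 1) ≤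
      (2 ^ |a| * ρ + 1) * (((n + 1 : ℕ) : ℝ) ^ a / ρ ^ (n + 1)) := by
  have hn1 : (1 : ℝ) ≤ n := by exact_mod_cast hn
  have h := rpow_le_two_rpow_abs_mul_rpow (x := n) (y := (n + 1 : ℕ)) (by linarith)
    (by push_cast; linarith) (by push_cast; linarith) a
  have hdiv : (n : ℝ) ^ a / ρ ^ n ≤ 2 ^ |a| * ρ * (((n + 1 : ℕ) : ℝ) ^ a / ρ ^ (n + 1)) :=
    calc _ ≤ 2 ^ |a| * ((n + 1 : ℕ) : ℝ) ^ a / ρ ^ n := by gcongr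
      _ = _ := by rw [pow_succ]; field_simp
  linarith

theorem frequently_lt_of_lacunaryDegree (hρ : 0 < ρ) {q κ p : ℝ} (hq : 0 < q) (hκ : 0 < κ)
    {E : ℕ → ℝ} (hE : ∀ i n : ℕ, lacunaryDegree i = n + 1 →
      κ * (q ^ i * ((n + 1 : ℕ) : ℝ) ^ p / ρ ^ (n + 1)) ≤ E n + E (n + 1))
    {γ : ℝ} (c : ℝ) (hγ : 0 < γ) : ∃ᶠ n : ℕ in atTop, c * ((n : ℝ) ^ (p - γ) / ρ ^ n) < E n := by
  rw [Filter.frequently_atTop]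
  intro N
  by_contra! hsmall
  have hle (n : ℕ) (hn : N ≤ n) : E n ≤ |c| * ((n : ℝ) ^ (p - γ) / ρ ^ n) :=
    (hsmall n hn).trans (mul_le_mul_of_nonneg_right (le_abs_self c) (by positivity))
  obtain ⟨i, hi, hiN⟩ := ((((tendsto_pow_mul_lacunaryDegree_rpow hq hγ).const_mul_atTop
    hκ).eventually_gt_atTop (|c| * (2 ^ |p - γ| * ρ + 1))).and
      (lacunaryDegree_strictMono.tendsto_atTop.eventually_ge_atTop (N + 1))).exists
  obtain ⟨n, hn⟩ := Nat.exists_eq_add_of_le' (one_le_two.trans (two_le_lacunaryDegree i))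
  have hn1 : 1 ≤ n := by linarith [two_le_lacunaryDegree i]
  rw [hn] at hi hiN
  set m := n + 1
  have hm : (0 : ℝ) < m := by positivity
  have hupper : E n + E m ≤
      |c| * (2 ^ |p - γ| * ρ + 1) * ((m : ℝ) ^ (p - γ) / ρ ^ m) :=
    calc _ ≤ |c| * ((n : ℝ) ^ (p - γ) / ρ ^ n + (m : ℝ) ^ (p - γ) / ρ ^ m) := by
          rw [mul_add]
          exact add_le_add (hle n (by omega)) (hle m (by omega))
      _ ≤ _ := by
          rw [mul_assoc]
          exact mul_le_mul_of_nonneg_left (rpow_div_pow_add_le hρ hn1 _) (abs_nonneg c)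
  have hlower : κ * (q ^ i * (m : ℝ) ^ γ) * ((m : ℝ) ^ (p - γ) / ρ ^ m) ≤ E n + E m := by
    refine le_trans (le_of_eq ?_) (hE i n hn)
    rw [show (m : ℝ) ^ p = (m : ℝ) ^ γ * (m : ℝ) ^ (p - γ) by
      rw [← Real.rpow_add hm, add_sub_cancel]]
    ring
  exact hi.not_ge (le_of_mul_le_mul_right (hlower.trans hupper) (by positivity))

theorem exists_frequently_lt_supNorm_err (hl : -1 / 2 < l) (hl0 : l ≠ 0) (hρ : 1 < ρ) {κ p x : ℝ}
    (hκ : 0 < κ) (hx : x ∈ Icc (-1 : ℝ) 1)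
    (hpoly : ∀ i, κ * (lacunaryDegree i : ℝ) ^ p ≤
      |multichoose l (lacunaryDegree i)|⁻¹ * |poly l (lacunaryDegree i) x|) :
    ∃ f : ℂ → ℂ, DiffContOnCl ℂ f (region ρ) ∧ ∀ γ c : ℝ, 0 < γ → ∃ᶠ n : ℕ in atTop,
      c * ((n : ℝ) ^ (p - γ) / ρ ^ n) < supNorm (err l n f) := by
  have hρ0 : 0 < ρ := by linarith
  obtain ⟨q, hq0, hq, hcoeff⟩ := exists_le_norm_coeff_lacunarySeries hl hl0 hρ
  have hf := diffContOnCl_lacunarySeries hq0.le hq hρ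
  have hcont : ContinuousOn (fun x : ℝ => lacunarySeries q ρ x) (Icc (-1) 1) :=
    hf.continuousOn.comp Complex.continuous_ofReal.continuousOn
      fun _ hx => subset_closure (ofReal_mem_region hρ hx)
  refine ⟨_, hf, fun γ c hγ =>
    frequently_lt_of_lacunaryDegree hρ0 hq0 (half_pos hκ) (fun i n hn => ?_) c hγ⟩
  have hpoly_i := hpoly i
  have hcoeff_i := hcoeff i
  rw [hn] at hpoly_i hcoeff_i
  calc _ = q ^ i / ρ ^ (n + 1) / 2 * (κ * ((n + 1 : ℕ) : ℝ) ^ p) := by ring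
    _ ≤ q ^ i / ρ ^ (n + 1) / 2 * (|multichoose l (n + 1)|⁻¹ * |poly l (n + 1) x|) :=
        mul_le_mul_of_nonneg_left hpoly_i (by positivity)
    _ = q ^ i / ρ ^ (n + 1) / 2 * |multichoose l (n + 1)|⁻¹ * |poly l (n + 1) x| := by ring
    _ ≤ _ := mul_le_mul_of_nonneg_right hcoeff_i (abs_nonneg _)
    _ ≤ _ := norm_coeff_mul_abs_poly_le hcont l n hx

theorem exists_frequently_lt_supNorm_err_of_pos (hl : 0 < l) (hρ : 1 < ρ) :
    ∃ f : ℂ → ℂ, DiffContOnCl ℂ f (region ρ) ∧ ∀ γ c : ℝ, 0 < γ → ∃ᶠ n : ℕ in atTop,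
      c * ((n : ℝ) ^ (l - γ) / ρ ^ n) < supNorm (err l n f) := by
  obtain ⟨κ, hκ, hratio⟩ := exists_le_inv_multichoose_mul hl
  refine exists_frequently_lt_supNorm_err (by linarith) hl.ne' hρ (x := 1) hκ (by norm_num)
    fun i => ?_
  rw [poly_one_right, abs_of_pos (multichoose_pos hl _),
    abs_of_pos (multichoose_pos (by positivity) _)]
  exact hratio _ (one_le_two.trans (two_le_lacunaryDegree i))

theorem exists_frequently_lt_supNorm_err_of_neg (hl : -1 / 2 < l) (hl0 : l < 0) (hρ : 1 < ρ) :
    ∃ f : ℂ → ℂ, DiffContOnCl ℂ f (region ρ) ∧ ∀ γ c : ℝ, 0 < γ → ∃ᶠ n : ℕ in atTop,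
      c * ((n : ℝ) ^ (-γ) / ρ ^ n) < supNorm (err l n f) := by
  obtain ⟨κ, hκ, hratio⟩ := exists_le_evenRatio (by linarith) hl0
  simp_rw [← zero_sub]
  refine exists_frequently_lt_supNorm_err hl hl0.ne hρ (x := 0) hκ (by norm_num) fun i => ?_
  obtain ⟨j, hj⟩ := Nat.exists_eq_add_of_le' (Nat.one_le_two_pow (n := i ^ 2))
  rw [lacunaryDegree, hj, poly_two_mul_zero hl, Real.rpow_zero, mul_one, abs_mul, abs_neg_one_pow,
    one_mul, ← abs_inv, ← abs_mul]
  exact (hratio j).trans (le_abs_self _)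

end LowerBound

end Gegenbauer

end

theorem theorem4p2 :
    -- (i), with an absolute constant `c`
    (∃ c : ℝ, 0 < c ∧ ∀ (l ρ : ℝ) (f : ℂ → ℂ) (n : ℕ), 0 < l → 1 < ρ →
      DiffContOnCl ℂ f (Gegenbauer.region ρ) → 1 ≤ n → ⌊l / Real.log ρ⌋₊ ≤ n →
      Gegenbauer.supNorm (Gegenbauer.err l n f) ≤
        Gegenbauer.K c l ρ f * ((n : ℝ) ^ l / ρ ^ n)) ∧
    -- (i), the constant `c` is asymptotically `1`
    (∀ l ε : ℝ, 0 < l → 0 < ε → ∃ X : ℝ, ∀ (ρ : ℝ) (f : ℂ → ℂ) (n : ℕ), 1 < ρ →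
      DiffContOnCl ℂ f (Gegenbauer.region ρ) → 1 ≤ n → ⌊l / Real.log ρ⌋₊ ≤ n →
      X ≤ n * Real.log ρ →
      Gegenbauer.supNorm (Gegenbauer.err l n f) ≤
        Gegenbauer.K (1 + ε) l ρ f * ((n : ℝ) ^ l / ρ ^ n)) ∧
    -- (ii)
    (∀ l : ℝ, -1 / 2 < l → l < 0 →
      (∃ C : ℝ, 0 < C ∧ Gegenbauer.UniformBound l C 1) ∧
      ∀ (C : ℝ) (N : ℕ), Gegenbauer.UniformBound l C N →
        ∀ (ρ : ℝ) (f : ℂ → ℂ) (n : ℕ), 1 < ρ →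
          DiffContOnCl ℂ f (Gegenbauer.region ρ) → N ≤ n + 1 →
          Gegenbauer.supNorm (Gegenbauer.err l n f) ≤
            Gegenbauer.D l ρ f * C / ((ρ - 1) * ρ ^ n)) ∧
    -- optimality of (i)
    (∀ l ρ : ℝ, 0 < l → 1 < ρ →
      (∃ f : ℂ → ℂ, DiffContOnCl ℂ f (Gegenbauer.region ρ) ∧
        ∀ γ c : ℝ, 0 < γ → ∃ᶠ n : ℕ in atTop,
          c * ((n : ℝ) ^ (l - γ) / ρ ^ n) < Gegenbauer.supNorm (Gegenbauer.err l n f))) ∧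
    (∀ l ω : ℝ, 0 < l → 1 < ω → ∃ c : ℝ, 0 < c ∧ ∀ n : ℕ, 1 ≤ n →
      c * ((n : ℝ) ^ l / (ω + √(ω ^ 2 - 1)) ^ n) ≤
        ‖Gegenbauer.err l n (fun z => 1 / (z - (ω : ℂ))) 1‖) ∧
    -- optimality of (ii)
    (∀ l ρ : ℝ, -1 / 2 < l → l < 0 → 1 < ρ →
      (∃ f : ℂ → ℂ, DiffContOnCl ℂ f (Gegenbauer.region ρ) ∧
        ∀ γ c : ℝ, 0 < γ → ∃ᶠ n : ℕ in atTop,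
          c * ((n : ℝ) ^ (-γ) / ρ ^ n) < Gegenbauer.supNorm (Gegenbauer.err l n f))) ∧
    (∀ l ω : ℝ, -1 / 2 < l → l < 0 → 1 < ω → ∃ c : ℝ, 0 < c ∧ ∀ n : ℕ,
      c / (ω + √(ω ^ 2 - 1)) ^ n ≤
        Gegenbauer.supNorm (Gegenbauer.err l n (fun z => 1 / (z - (ω : ℂ))))) := by
  refine ⟨⟨12, by norm_num, ?_⟩, ?_, ?_, ?_, ?_, ?_, ?_⟩
  · intro l ρ f n hl hρ hf hn hnl
    exact Gegenbauer.supNorm_err_le_K hf hρ hl hn hnl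
  · intro l ε hl hε
    exact ⟨l * (1 + ε) / ε, fun ρ f n hρ hf hn _ hX =>
      Gegenbauer.supNorm_err_le_K_one_add hf hρ hl hn hε hX⟩
  · intro l hl hl0
    exact ⟨Gegenbauer.exists_uniformBound hl hl0, fun C N hC ρ f n hρ hf hN =>
      Gegenbauer.supNorm_err_le_of_uniformBound hf hρ hl hl0.ne hC hN⟩
  · intro l ρ hl hρ
    exact Gegenbauer.exists_frequently_lt_supNorm_err_of_pos hl hρ
  · intro l ω hl hω
    exact Gegenbauer.exists_le_norm_err_cauchyKernel_one hl hω
  · intro l ρ hl hl0 hρ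
    exact Gegenbauer.exists_frequently_lt_supNorm_err_of_neg hl hl0 hρ
  · intro l ω hl hl0 hω
    exact Gegenbauer.exists_le_supNorm_err_cauchyKernel hl hl0 hω
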